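/- Let $M$ be a compact connected oriented smooth manifold without boundary, $k=\dim M$, with a volume form $\upsilon_M$ such that $\int_M\upsilon_M=1$, and let $(\omega_i)_{i\in I}$ be a family of nonzero differential forms on $\mathbb R^n$ with constant coefficients, $d_i=\deg\omega_i$. Put $X=\mathbb R^n\times M$, let $G=\operatorname{Diff}(X,(\omega_i\wedge\upsilon_M)_{i\in I})$ be the group of $C^\infty$ diffeomorphisms of $X$ preserving all forms $\omega_i\wedge\upsilon_M$, let $\alpha=0\times M$, and let $a\in H_k(X;\mathbb R)$ be the homology class of $\alpha$. For a group $\Gamma$ of diffeomorphisms of $X$, let $C^*(\Gamma,\Omega(X))$ be the double complex of nonhomogeneous cochains of $\Gamma$ with values in the right $\Gamma$-module $\Omega(X)$ of smooth forms (acting by pullback), with $\delta'$ the group differential $$(\delta'f)(g_1,\dots,g_{q+1})=f(g_2,\dots,g_{q+1})+\sum_{j=1}^q(-1)^jf(g_1,\dots,g_jg_{j+1},\dots,g_{q+1})+(-1)^{q+1}g_{q+1}^*f(g_1,\dots,g_q)$$ and $\delta''=(-1)^q d$ on $C^q(\Gamma,\Omega(X))$. Fix $i\in I$ with $d_i\ge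 1$, and put $m=d_i+k$, $p=d_i-1$. Let $\Gamma$ be the subgroup $G_a=\{g\in G: g_*a=a\}$; in particular $\Gamma=G$ if $a$ is $G$-invariant. Then the cocycle $c_a(\omega_i\wedge\upsilon_M)$ on $\Gamma$ with values in the trivial $\Gamma$-module $\mathbb R$ is defined and nontrivial. In detail: 1. $\omega_i\wedge\upsilon_M$ is a $\Gamma$-invariant exact $m$-form, $H^{j}(X)=0$ for $m-p\le j\le m-1$, $H^{m-p-1}(X)\neq0$, and $\alpha$ is a cycle whose homology class is $\Gamma$-invariant. 2. There are cochains $\varphi_{j,m-j-1}\in C^j(\Gamma,\Omega^{m-j-1}(X))$, $0\le j\le p$, with $\omega_i\wedge\upsilon_M=-d\varphi_{0,m-1}$ and $\delta'\varphi_{j-1,m-j}+\delta''\varphi_{j,m-j-1}=0$ for $1\le j\le p$. 3. For each choice of such cochains, $c_a(g_1,\dots,g_{p+1})=\int_\alpha(\delta'\varphi_{p,m-p-1})(g_1,\dots,g_{p+1})$ is a $(p+1)$-cocycle on $\Gamma$ with values in $\mathbb R$, and two choices give cohomologous cocycles. 4. For each choice, $c_a$ is not a coboundary in the complex $C^*(\Gamma,\mathbb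 R)$ of all cochains. -/

import Mathlib

open scoped Manifold ContDiff Topology

noncomputable section

namespace DiffForm

/-! ### Differential forms on smooth manifolds without boundary -/

section Forms

variable {E : Type*} [NormedAddCommGroup E] [NormedSpace ℝ E] {H : Type*} [TopologicalSpace H]
  {E' : Type*} [NormedAddCommGroup E'] [NormedSpace ℝ E'] {H' : Type*} [TopologicalSpace H']
  {X : Type*} [TopologicalSpace X] [ChartedSpace H X]
  {Y : Type*} [TopologicalSpace Y] [ChartedSpace H' Y]

/-- Differential `q`-forms on `X`: an alternating `q`-linear form on every tangent space.
Smoothness is the separate predicate `IsSmooth`. -/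
abbrev Form (I : ModelWithCorners ℝ E H) (X : Type*) [TopologicalSpace X] [ChartedSpace H X]
    (q : ℕ) : Type _ :=
  ∀ x : X, TangentSpace I x [⋀^Fin q]→L[ℝ] ℝ

variable {I : ModelWithCorners ℝ E H} {J : ModelWithCorners ℝ E' H'} {q : ℕ}

/-- The pullback `f^* θ`. -/
def pullback (I : ModelWithCorners ℝ E H) (J : ModelWithCorners ℝ E' H') {q : ℕ}
    (f : X → Y) (θ : Form J Y q) : Form I X q :=
  fun x => (θ (f x)).compContinuousLinearMap (mfderiv I J f x)

/-- The expression of `θ` in the chart at `x₀`, i.e. the pullback of `θ` under the inverse of the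
chart; meaningful on the target of the chart. -/
def localRep (θ : Form I X q) (x₀ : X) (e : E) : E [⋀^Fin q]→L[ℝ] ℝ :=
  (θ ((extChartAt I x₀).symm e)).compContinuousLinearMap
    (mfderiv 𝓘(ℝ, E) I (extChartAt I x₀).symm e)

/-- `C^∞` forms: the expressions in all charts are `C^∞`. -/
def IsSmooth (θ : Form I X q) : Prop :=
  ∀ x₀ : X, ContDiffOn ℝ ∞ (localRep θ x₀) (extChartAt I x₀).target

/-- The exterior derivative, computed at `x` in the chart at `x`. -/
def d (θ : Form I X q) : Form I X (q + 1) :=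
  fun x => (extDeriv (localRep θ x) (extChartAt I x x)).compContinuousLinearMap
    (mfderiv I 𝓘(ℝ, E) (extChartAt I x) x)

/-- Smooth closed forms. -/
def IsClosedForm (θ : Form I X q) : Prop :=
  IsSmooth θ ∧ d θ = 0

/-- Exact forms: differentials of smooth forms; in degree `0` only the zero form. -/
def IsExactForm : ∀ {q : ℕ}, Form I X q → Prop
  | 0, θ => θ = 0
  | _ + 1, θ => ∃ η, IsSmooth η ∧ θ = d η

/-- The de Rham cohomology `H^q(X)` vanishes. -/
def DeRhamVanishes (I : ModelWithCorners ℝ E H) (X : Type*) [TopologicalSpace X]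
    [ChartedSpace H X] (q : ℕ) : Prop :=
  ∀ η : Form I X q, IsClosedForm η → IsExactForm η

/-- The wedge product of alternating forms (shuffle convention), with its degree `p + q`
written as `m`. -/
def wedgeAlt {V : Type*} [AddCommGroup V] [Module ℝ V] [TopologicalSpace V] {p q m : ℕ}
    (h : p + q = m) (a : V [⋀^Fin p]→L[ℝ] ℝ) (b : V [⋀^Fin q]→L[ℝ] ℝ) : V [⋀^Fin m]→L[ℝ] ℝ :=
  let f : V [⋀^Fin m]→ₗ[ℝ] ℝ :=
    ((LinearMap.mul' ℝ ℝ).compAlternatingMap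
      (a.toAlternatingMap.domCoprod b.toAlternatingMap)).domDomCongr
        (finSumFinEquiv.trans (finCongr h))
  { toMultilinearMap := f.toMultilinearMap
    cont := by
      change Continuous fun v : Fin m → V => LinearMap.mul' ℝ ℝ
        (a.toAlternatingMap.domCoprod b.toAlternatingMap
          fun i => v ((finSumFinEquiv.trans (finCongr h)) i))
      simp only [AlternatingMap.domCoprod_apply, sum_apply, map_sum]
      refine continuous_finsetSum _ fun σ _ => ?_
      induction σ using Quotient.inductionOn' with | _ σ
      simp only [AlternatingMap.domCoprod.summand_mk'', smul_apply,
        MultilinearMap.domDomCongr_apply, MultilinearMap.domCoprod_apply]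
      have e1 : ∀ v : Fin m → V, LinearMap.mul' ℝ ℝ (Equiv.Perm.sign σ •
          (a.toMultilinearMap fun i₁ => v ((finSumFinEquiv.trans (finCongr h)) (σ (Sum.inl i₁))))
            ⊗ₜ[ℝ] b.toMultilinearMap
              fun i₂ => v ((finSumFinEquiv.trans (finCongr h)) (σ (Sum.inr i₂)))) =
          ((Equiv.Perm.sign σ : ℤ) : ℝ) *
            ((a fun i₁ => v ((finSumFinEquiv.trans (finCongr h)) (σ (Sum.inl i₁)))) *
              b fun i₂ => v ((finSumFinEquiv.trans (finCongr h)) (σ (Sum.inr i₂)))) := by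
        intro v
        rw [Units.smul_def, map_zsmul, LinearMap.mul'_apply, zsmul_eq_mul]
        rfl
      exact (continuous_const.mul ((a.cont.comp (continuous_pi fun _ => continuous_apply _)).mul
        (b.cont.comp (continuous_pi fun _ => continuous_apply _)))).congr fun v => (e1 v).symm
    map_eq_zero_of_eq' := f.map_eq_zero_of_eq' }

/-- The wedge product of differential forms. -/
def wedge {p q m : ℕ} (h : p + q = m) (α : Form I X p) (β : Form I X q) : Form I X m :=
  fun x => wedgeAlt h (α x) (β x)

end Forms


/-! ### Pullback by diffeomorphisms preserves smooth closed forms -/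

section Naturality

lemma contDiff_compCLM {V W : Type*} [NormedAddCommGroup V] [NormedSpace ℝ V]
    [NormedAddCommGroup W] [NormedSpace ℝ W] (q : ℕ) :
    ContDiff ℝ ∞ fun fA : (W [⋀^Fin q]→L[ℝ] ℝ) × (V →L[ℝ] W) =>
      fA.1.compContinuousLinearMap fA.2 := by
  -- antisymmetrization, normalized to be a left inverse of the inclusion
  let P : ContinuousMultilinearMap ℝ (fun _ : Fin q => V) ℝ →L[ℝ] V [⋀^Fin q]→L[ℝ] ℝ :=
    LinearMap.mkContinuous
      { toFun := fun f => ((q.factorial : ℝ)⁻¹) • ContinuousMultilinearMap.alternatization f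
        map_add' := fun f g => by rw [map_add, smul_add]
        map_smul' := fun c f => by
          ext v
          simp [ContinuousMultilinearMap.alternatization_apply_apply, Finset.mul_sum,
            mul_left_comm, Units.smul_def] } 1 (by
      intro f
      refine ContinuousAlternatingMap.opNorm_le_bound _ (by positivity) fun v => ?_
      have hq : (0 : ℝ) < q.factorial := by positivity
      have h1 : ‖∑ σ : Equiv.Perm (Fin q), Equiv.Perm.sign σ • f (v ∘ σ)‖
          ≤ ∑ σ : Equiv.Perm (Fin q), ‖f‖ * ∏ i, ‖v i‖ := by
        refine norm_sum_le_of_le _ fun σ _ => ?_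
        have h2 : ‖Equiv.Perm.sign σ • f (v ∘ σ)‖ = ‖f (v ∘ σ)‖ := by
          rcases Int.units_eq_one_or (Equiv.Perm.sign σ) with h | h <;> simp [h]
        rw [h2]
        refine (f.le_opNorm _).trans (le_of_eq ?_)
        congr 1
        exact Equiv.prod_comp σ fun i => ‖v i‖
      rw [Finset.sum_const, Finset.card_univ, Fintype.card_perm, Fintype.card_fin,
        nsmul_eq_mul] at h1
      simp only [LinearMap.coe_mk, AddHom.coe_mk, ContinuousAlternatingMap.smul_apply,
        ContinuousMultilinearMap.alternatization_apply_apply, norm_smul, norm_inv,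
        Real.norm_natCast, one_mul]
      rw [inv_mul_le_iff₀ hq]
      exact h1)
  have hP : ∀ f : V [⋀^Fin q]→L[ℝ] ℝ, P f.toContinuousMultilinearMap = f := by
    intro f
    ext v
    have hq : (q.factorial : ℝ) ≠ 0 := by positivity
    have h : ∀ σ : Equiv.Perm (Fin q), Equiv.Perm.sign σ • f (v ∘ σ) = f v := by
      intro σ
      have := f.toAlternatingMap.map_perm v σ
      simp only [ContinuousAlternatingMap.coe_toAlternatingMap] at this
      rw [this, smul_smul]
      simp
    have h' : P f.toContinuousMultilinearMap v = (q.factorial : ℝ)⁻¹ *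
      ∑ σ : Equiv.Perm (Fin q), Equiv.Perm.sign σ • f (v ∘ σ) := by
      simp [P, ContinuousMultilinearMap.alternatization_apply_apply]
    rw [h', Finset.sum_congr rfl fun σ _ => h σ]
    simp [Fintype.card_perm, hq]
  let Q := ContinuousMultilinearMap.compContinuousLinearMapContinuousMultilinear ℝ
    (fun _ : Fin q => V) (fun _ : Fin q => W) ℝ
  have h : (fun fA : (W [⋀^Fin q]→L[ℝ] ℝ) × (V →L[ℝ] W) =>
      fA.1.compContinuousLinearMap fA.2) = fun fA => P (Q (fun _ => fA.2)
        (ContinuousAlternatingMap.toContinuousMultilinearMapCLM ℝ fA.1)) := by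
    funext fA
    exact (hP _).symm
  have hs : ContDiff ℝ ∞ fun fA : (W [⋀^Fin q]→L[ℝ] ℝ) × (V →L[ℝ] W) =>
      (fun _ : Fin q => fA.2) := contDiff_pi.2 fun _ => contDiff_snd
  rw [h]
  refine P.contDiff.comp (ContDiff.clm_apply ?_ ?_)
  · exact (ContinuousMultilinearMap.contDiff (𝕜 := ℝ) (ι := Fin q)
      (E := fun _ : Fin q => V →L[ℝ] W)
      (F := ContinuousMultilinearMap ℝ (fun _ : Fin q => W) ℝ →L[ℝ]
        ContinuousMultilinearMap ℝ (fun _ : Fin q => V) ℝ) Q).comp hs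
  · exact (ContinuousAlternatingMap.toContinuousMultilinearMapCLM (𝕜 := ℝ) (E := W) (F := ℝ)
      (ι := Fin q) ℝ).contDiff.comp contDiff_fst

variable {E : Type*} [NormedAddCommGroup E] [NormedSpace ℝ E] {H : Type*} [TopologicalSpace H]
  {X : Type*} [TopologicalSpace X] [ChartedSpace H X] {I : ModelWithCorners ℝ E H}
  [I.Boundaryless] [IsManifold I ∞ X]

/-- A smooth self-map read in the charts at `x₀` and `y₀`. -/
def inCharts (I : ModelWithCorners ℝ E H) (f : X → X) (x₀ y₀ : X) (e : E) : E :=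
  extChartAt I y₀ (f ((extChartAt I x₀).symm e))

lemma mdifferentiableAt_symm (x₀ : X) {e : E} (he : e ∈ (extChartAt I x₀).target) :
    MDifferentiableAt 𝓘(ℝ, E) I (extChartAt I x₀).symm e :=
  ((contMDiffOn_extChartAt_symm (n := ∞) x₀).contMDiffAt
    ((isOpen_extChartAt_target x₀).mem_nhds he)).mdifferentiableAt (by simp)

lemma contDiffAt_inCharts {f : X → X} (hf : ContMDiff I I ∞ f) (x₀ y₀ : X) {e : E}
    (he : e ∈ (extChartAt I x₀).target)
    (hy : f ((extChartAt I x₀).symm e) ∈ (extChartAt I y₀).source) :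
    ContDiffAt ℝ ∞ (inCharts I f x₀ y₀) e := by
  rw [← contMDiffAt_iff_contDiffAt]
  have h1 := (contMDiffOn_extChartAt_symm (n := ∞) (I := I) x₀).contMDiffAt
    ((isOpen_extChartAt_target x₀).mem_nhds he)
  have h2 : ContMDiffAt I 𝓘(ℝ, E) ∞ (extChartAt I y₀) (f ((extChartAt I x₀).symm e)) :=
    contMDiffAt_extChartAt' (by rwa [extChartAt_source] at hy)
  exact h2.comp e (hf.contMDiffAt.comp e h1)

/-- The expression of a pullback in charts. -/
lemma localRep_pullback {q : ℕ} {f : X → X} (hf : ContMDiff I I ∞ f) (θ : Form I X q)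
    (x₀ y₀ : X) {e : E} (he : e ∈ (extChartAt I x₀).target)
    (hy : f ((extChartAt I x₀).symm e) ∈ (extChartAt I y₀).source) :
    localRep (pullback I I f θ) x₀ e =
      (localRep θ y₀ (inCharts I f x₀ y₀ e)).compContinuousLinearMap
        (fderiv ℝ (inCharts I f x₀ y₀) e) := by
  have hF := (contDiffAt_inCharts hf x₀ y₀ he hy).differentiableAt (by simp)
  have h1 := (hf.mdifferentiable (by simp) ((extChartAt I x₀).symm e)).hasMFDerivAt.comp e
    (mdifferentiableAt_symm x₀ he).hasMFDerivAt
  have h2 := (mdifferentiableAt_symm (I := I) y₀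
    ((extChartAt I y₀).map_source hy)).hasMFDerivAt.comp e hF.hasFDerivAt.hasMFDerivAt
  have hev : f ∘ (extChartAt I x₀).symm =ᶠ[𝓝 e]
      (extChartAt I y₀).symm ∘ inCharts I f x₀ y₀ := by
    have hc : ContinuousAt (f ∘ (extChartAt I x₀).symm) e := h1.1
    filter_upwards [hc.preimage_mem_nhds ((isOpen_extChartAt_source y₀).mem_nhds hy)] with z hz
    exact ((extChartAt I y₀).left_inv hz).symm
  have h3 := hasMFDerivAt_unique h1 (h2.congr_of_eventuallyEq hev)
  have hcongr : ∀ {y z : X}, z = y → ∀ {v w : Fin q → E}, v = w →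
      (θ y : E [⋀^Fin q]→L[ℝ] ℝ) v = (θ z : E [⋀^Fin q]→L[ℝ] ℝ) w := by
    rintro y _ rfl v _ rfl
    rfl
  ext v
  exact hcongr ((extChartAt I y₀).left_inv hy)
    (funext fun i => congrArg (fun L : E →L[ℝ] E => L (v i)) h3)

lemma eventually_localRep_pullback {q : ℕ} {f : X → X} (hf : ContMDiff I I ∞ f)
    (θ : Form I X q) (x₀ y₀ : X) {e : E} (he : e ∈ (extChartAt I x₀).target)
    (hy : f ((extChartAt I x₀).symm e) ∈ (extChartAt I y₀).source) :
    localRep (pullback I I f θ) x₀ =ᶠ[𝓝 e] fun z =>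
      (localRep θ y₀ (inCharts I f x₀ y₀ z)).compContinuousLinearMap
        (fderiv ℝ (inCharts I f x₀ y₀) z) := by
  have hc : ContinuousAt (f ∘ (extChartAt I x₀).symm) e :=
    hf.continuous.continuousAt.comp (continuousAt_extChartAt_symm'' he)
  filter_upwards [(isOpen_extChartAt_target x₀).mem_nhds he,
    hc.preimage_mem_nhds ((isOpen_extChartAt_source y₀).mem_nhds hy)] with z hz hz'
  exact localRep_pullback hf θ x₀ y₀ hz hz'

lemma isSmooth_pullback {q : ℕ} {f : X → X} (hf : ContMDiff I I ∞ f) {θ : Form I X q}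
    (hθ : IsSmooth θ) : IsSmooth (pullback I I f θ) := by
  intro x₀ e he
  set y₀ := f ((extChartAt I x₀).symm e)
  have hy : y₀ ∈ (extChartAt I y₀).source := mem_extChartAt_source y₀
  refine ContDiffAt.contDiffWithinAt ?_
  refine ContDiffAt.congr_of_eventuallyEq ?_ (eventually_localRep_pullback hf θ x₀ y₀ he hy)
  have hF := contDiffAt_inCharts hf x₀ y₀ he hy
  have h1 : ContDiffAt ℝ ∞ (localRep θ y₀) (inCharts I f x₀ y₀ e) :=
    (hθ y₀).contDiffAt ((isOpen_extChartAt_target y₀).mem_nhds ((extChartAt I y₀).map_source hy))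
  exact (contDiff_compCLM q).contDiffAt.comp e
    ((h1.comp e hF).prodMk (hF.fderiv_right (m := ∞) (by simp)))

lemma d_pullback {q : ℕ} {f : X → X} (hf : ContMDiff I I ∞ f) {θ : Form I X q}
    (hθ : IsSmooth θ) : d (pullback I I f θ) = pullback I I f (d θ) := by
  funext x
  set e := extChartAt I x x with he_def
  have he : e ∈ (extChartAt I x).target := mem_extChartAt_target x
  have hx : (extChartAt I x).symm e = x := extChartAt_to_inv x
  have hy : f ((extChartAt I x).symm e) ∈ (extChartAt I (f x)).source := by
    rw [hx]; exact mem_extChartAt_source (f x)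
  have hF := contDiffAt_inCharts hf x (f x) he hy
  have hFe : inCharts I f x (f x) e = extChartAt I (f x) (f x) := by
    simp only [inCharts, hx]
  have h1 : DifferentiableAt ℝ (localRep θ (f x)) (inCharts I f x (f x) e) :=
    ((hθ (f x)).contDiffAt ((isOpen_extChartAt_target (f x)).mem_nhds
      ((extChartAt I (f x)).map_source hy))).differentiableAt (by simp)
  have h2 : extDeriv (localRep (pullback I I f θ) x) e =
      (extDeriv (localRep θ (f x)) (extChartAt I (f x) (f x))).compContinuousLinearMap
        (fderiv ℝ (inCharts I f x (f x)) e) := by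
    rw [(eventually_localRep_pullback hf θ x (f x) he hy).extDeriv_eq,
      extDeriv_pullback h1 hF (by
        rw [minSmoothness_of_isRCLikeNormedField]
        exact WithTop.coe_le_coe.2 (le_top : (2 : ℕ∞) ≤ ⊤)), hFe]
  -- the two ways round the chart square
  have h3 := (mdifferentiableAt_extChartAt (I := I) (x := f x)
    (mem_chart_source H (f x))).hasMFDerivAt.comp x
      (hf.mdifferentiable (by simp) x).hasMFDerivAt
  have h4 := HasMFDerivAt.comp x (g := inCharts I f x (f x)) (f := extChartAt I x)
    (hF.differentiableAt (by simp)).hasFDerivAt.hasMFDerivAt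
    (mdifferentiableAt_extChartAt (I := I) (x := x) (mem_chart_source H x)).hasMFDerivAt
  have hev : (extChartAt I (f x)) ∘ f =ᶠ[𝓝 x] inCharts I f x (f x) ∘ extChartAt I x := by
    filter_upwards [extChartAt_source_mem_nhds (I := I) x] with z hz
    simp only [inCharts, Function.comp_apply, (extChartAt I x).left_inv hz]
  have h5 := hasMFDerivAt_unique h3 (h4.congr_of_eventuallyEq hev)
  ext v
  change extDeriv (localRep (pullback I I f θ) x) e
      (fun i => (mfderiv I 𝓘(ℝ, E) (extChartAt I x) x (v i) : E)) =
    extDeriv (localRep θ (f x)) (extChartAt I (f x) (f x))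
      (fun i => (mfderiv I 𝓘(ℝ, E) (extChartAt I (f x)) (f x) (mfderiv I I f x (v i)) : E))
  rw [h2]
  exact congrArg _ (funext fun i => (congrArg (fun L : E →L[ℝ] E => L (v i)) h5).symm)

lemma isClosedForm_pullback {q : ℕ} {f : X → X} (hf : ContMDiff I I ∞ f) {θ : Form I X q}
    (hθ : IsClosedForm θ) : IsClosedForm (pullback I I f θ) := by
  refine ⟨isSmooth_pullback hf hθ.1, ?_⟩
  rw [d_pullback hf hθ.1, hθ.2]
  rfl

end Naturality

/-! ### Diffeomorphism groups -/

section Groups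

variable {E : Type*} [NormedAddCommGroup E] [NormedSpace ℝ E] {H : Type*} [TopologicalSpace H]
  {X : Type*} [TopologicalSpace X] [ChartedSpace H X] {I : ModelWithCorners ℝ E H}

/-- The group of `C^∞` diffeomorphisms of `X`, with composition `g * h = g ∘ h`. -/
instance : Group (X ≃ₘ⟮I, I⟯ X) where
  mul g h := h.trans g
  one := Diffeomorph.refl I X ∞
  inv g := g.symm
  mul_assoc _ _ _ := rfl
  one_mul _ := rfl
  mul_one _ := rfl
  inv_mul_cancel g := g.self_trans_symm

lemma coe_mul (g h : X ≃ₘ⟮I, I⟯ X) : ⇑(g * h) = g ∘ h := rfl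

lemma coe_one : ⇑(1 : X ≃ₘ⟮I, I⟯ X) = id := rfl

lemma pullback_one {q : ℕ} (θ : Form I X q) : pullback I I (1 : X ≃ₘ⟮I, I⟯ X) θ = θ := by
  funext x
  ext v
  simp only [pullback, coe_one, mfderiv_id]
  rfl

lemma pullback_mul {q : ℕ} (g h : X ≃ₘ⟮I, I⟯ X) (θ : Form I X q) :
    pullback I I (g * h) θ = pullback I I h (pullback I I g θ) := by
  funext x
  ext v
  have := mfderiv_comp (I := I) (I' := I) (I'' := I) x
    ((g.mdifferentiable (by simp)) (h x)) ((h.mdifferentiable (by simp)) x)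
  simp only [pullback, coe_mul, this]
  rfl

/-- `Diff(X, (Θ_i))`: the diffeomorphisms of `X` preserving all forms of a family. -/
def diffPreserving {ι : Type*} {m : ι → ℕ} (Θ : ∀ i, Form I X (m i)) :
    Subgroup (X ≃ₘ⟮I, I⟯ X) where
  carrier := {g | ∀ i, pullback I I g (Θ i) = Θ i}
  mul_mem' {g h} hg hh i := by rw [pullback_mul, hg i, hh i]
  one_mem' i := pullback_one _
  inv_mem' {g} hg i := by
    have h : pullback I I (g * g⁻¹) (Θ i) = Θ i := by rw [mul_inv_cancel, pullback_one]
    rwa [pullback_mul, hg i] at h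

/-- For a functional `α` on `q`-forms (integration over a cycle), `FixesClass α g` says that the
diffeomorphism `g` fixes the real homology class of the cycle: `g_* α` and `α` agree on all closed
forms, where `(g_* α)(θ) = α(g^* θ)`. -/
def FixesClass {q : ℕ} (α : Form I X q → ℝ) (g : X ≃ₘ⟮I, I⟯ X) : Prop :=
  ∀ θ : Form I X q, IsClosedForm θ → α (pullback I I g θ) = α θ

/-- The subgroup of those elements of `G` which fix the homology class of `α`. -/
def classStabilizer [I.Boundaryless] [IsManifold I ∞ X] {q : ℕ} (G : Subgroup (X ≃ₘ⟮I, I⟯ X))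
    (α : Form I X q → ℝ) : Subgroup (X ≃ₘ⟮I, I⟯ X) where
  carrier := {g | g ∈ G ∧ FixesClass α g}
  mul_mem' {g h} hg hh := ⟨G.mul_mem hg.1 hh.1, fun θ hθ => by
    rw [pullback_mul, hh.2 _ (isClosedForm_pullback g.contMDiff hθ), hg.2 θ hθ]⟩
  one_mem' := ⟨G.one_mem, fun θ _ => by rw [pullback_one]⟩
  inv_mem' {g} hg := ⟨G.inv_mem hg.1, fun θ hθ => by
    have h := hg.2 _ (isClosedForm_pullback (g⁻¹).contMDiff hθ)
    rw [← pullback_mul, inv_mul_cancel, pullback_one] at h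
    exact h.symm⟩

end Groups

/-! ### Nonhomogeneous group cochains -/

section Cochains

/-- The differential `C^p(G, A) → C^{p+1}(G, A)` of nonhomogeneous cochains with values in a right
`G`-module `A`, whose action is written `act a g`:
`(Df)(g_1, …, g_{p+1}) = f(g_2, …, g_{p+1}) + ∑_{i=1}^p (-1)^i f(g_1, …, g_i g_{i+1}, …, g_{p+1})
  + (-1)^{p+1} f(g_1, …, g_p) g_{p+1}`. -/
def cochainD {G A : Type*} [Mul G] [AddCommGroup A] (act : A → G → A) {p : ℕ}
    (f : (Fin p → G) → A) : (Fin (p + 1) → G) → A := fun g =>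
  f (fun i => g i.succ)
    + ∑ i : Fin p, (-1 : ℤ) ^ ((i : ℕ) + 1) • f (Fin.contractNth i.castSucc (· * ·) g)
    + (-1 : ℤ) ^ (p + 1) • act (f fun i => g i.castSucc) (g (Fin.last p))

/-- The differential of `C^*(G, ℝ)`, where `ℝ` is the trivial `G`-module. -/
def trivD {G : Type*} [Mul G] {p : ℕ} (f : (Fin p → G) → ℝ) : (Fin (p + 1) → G) → ℝ :=
  cochainD (fun a _ => a) f

variable {E : Type*} [NormedAddCommGroup E] [NormedSpace ℝ E] {H : Type*} [TopologicalSpace H]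
  {X : Type*} [TopologicalSpace X] [ChartedSpace H X] {I : ModelWithCorners ℝ E H}

/-- The first differential `δ'` of the double complex `C^*(G, Ω(X))`, where `G` acts on forms from
the right by pullback. -/
def delta₁ {G : Subgroup (X ≃ₘ⟮I, I⟯ X)} {p q : ℕ} (c : (Fin p → G) → Form I X q) :
    (Fin (p + 1) → G) → Form I X q :=
  cochainD (fun θ (g : G) => pullback I I (g : X ≃ₘ⟮I, I⟯ X) θ) c

/-- The second differential `δ'' = (-1)^p d` of the double complex `C^*(G, Ω(X))`. -/
def delta₂ {G : Subgroup (X ≃ₘ⟮I, I⟯ X)} {p q : ℕ} (c : (Fin p → G) → Form I X q) :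
    (Fin p → G) → Form I X (q + 1) :=
  fun g => (-1 : ℤ) ^ p • d (c g)

/-- Let `Θ` be a form of degree `m = p + r + 1`. `IsDescent p r Θ φ` says that the cochains
`φ_{i,m-i-1} ∈ C^i(G, Ω^{m-i-1}(X))`, `0 ≤ i ≤ p`, satisfy `Θ = -dφ_{0,m-1}` and
`δ' φ_{i-1,m-i} + δ'' φ_{i,m-i-1} = 0` for `1 ≤ i ≤ p`. (The family `φ` is indexed by all bidegrees;
its other members are irrelevant.) -/
structure IsDescent (G : Subgroup (X ≃ₘ⟮I, I⟯ X)) (p r : ℕ) (Θ : Form I X (p + r + 1))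
    (φ : ∀ i q : ℕ, (Fin i → G) → Form I X q) : Prop where
  smooth : ∀ i q g, IsSmooth (φ i q g)
  start : ∀ g : Fin 0 → G, Θ = -d (φ 0 (p + r) g)
  step : ∀ i q, i + q + 1 = p + r → r ≤ q → delta₁ (φ i (q + 1)) + delta₂ (φ (i + 1) q) = 0

/-- The cochain `c_a(g_1, …, g_{p+1}) = ∫_α (δ' φ_{p,r})(g_1, …, g_{p+1})`. -/
def periodCochain {G : Subgroup (X ≃ₘ⟮I, I⟯ X)} (p r : ℕ) (α : Form I X r → ℝ)
    (φ : ∀ i q : ℕ, (Fin i → G) → Form I X q) : (Fin (p + 1) → G) → ℝ :=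
  fun g => α (delta₁ (φ p r) g)

/-- The cocycle `c_a(Θ)` on `G` with values in the trivial `G`-module `ℝ` is defined, where `Θ` is a
form of degree `m = p + r + 1` and `α` is integration over a cycle of dimension `r = m - p - 1`:
`Θ` is a `G`-invariant exact form, `H^{m-p}(X) = ⋯ = H^{m-1}(X) = 0`, `H^{m-p-1}(X) ≠ 0`, `α` is a
cycle with `G`-invariant homology class, cochains `φ` as in `IsDescent` exist, each choice of them
gives a cocycle, and any two choices give cohomologous cocycles. -/
structure CocycleDefined (G : Subgroup (X ≃ₘ⟮I, I⟯ X)) (p r : ℕ) (Θ : Form I X (p + r + 1))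
    (α : Form I X r → ℝ) : Prop where
  smooth : IsSmooth Θ
  invariant : ∀ g ∈ G, pullback I I g Θ = Θ
  exact : IsExactForm Θ
  vanishing : ∀ j, r + 1 ≤ j → j ≤ p + r → DeRhamVanishes I X j
  nonvanishing : ¬ DeRhamVanishes I X r
  cycle : ∀ θ : Form I X r, IsExactForm θ → α θ = 0
  class_invariant : ∀ g ∈ G, FixesClass α g
  exists_descent : ∃ φ, IsDescent G p r Θ φ
  cocycle : ∀ φ, IsDescent G p r Θ φ → trivD (periodCochain p r α φ) = 0
  unique : ∀ φ ψ, IsDescent G p r Θ φ → IsDescent G p r Θ ψ →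
    ∃ b : (Fin p → G) → ℝ, periodCochain p r α φ - periodCochain p r α ψ = trivD b

/-- The cocycle `c_a(Θ)` is nontrivial: whatever the choice of `φ`, it is not a coboundary in the
complex `C^*(G, ℝ)` of all cochains. -/
def CocycleNontrivial (G : Subgroup (X ≃ₘ⟮I, I⟯ X)) (p r : ℕ) (Θ : Form I X (p + r + 1))
    (α : Form I X r → ℝ) : Prop :=
  ∀ φ, IsDescent G p r Θ φ → ¬ ∃ b : (Fin p → G) → ℝ, periodCochain p r α φ = trivD b

end Cochains

/-! ### Orientations and integration over a compact manifold -/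

section Integration

variable {k : ℕ} {M : Type*} [TopologicalSpace M] [ChartedSpace (EuclideanSpace ℝ (Fin k)) M]

/-- The sign, with respect to the orientations `o` of the tangent spaces, of the coordinate frame of
the chart at `y₀` at the point with coordinates `e`. -/
def frameSign (o : ∀ y : M, Orientation ℝ (TangentSpace (𝓡 k) y) (Fin k)) (y₀ : M)
    (e : EuclideanSpace ℝ (Fin k)) : ℝ :=
  SignType.sign ((o ((extChartAt (𝓡 k) y₀).symm e)).someVector fun i =>
    mfderiv 𝓘(ℝ, EuclideanSpace ℝ (Fin k)) (𝓡 k) (extChartAt (𝓡 k) y₀).symm e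
      (EuclideanSpace.single i (1 : ℝ)))

/-- An orientation of `M`: orientations of the tangent spaces which are locally constant in
charts. -/
def IsOrientation (o : ∀ y : M, Orientation ℝ (TangentSpace (𝓡 k) y) (Fin k)) : Prop :=
  ∀ y₀ : M, ContinuousOn (frameSign o y₀) (extChartAt (𝓡 k) y₀).target

variable [T2Space M] [CompactSpace M] [IsManifold (𝓡 k) ∞ M]

variable (k M) in
/-- A smooth partition of unity subordinate to the charts. -/
def chartPartition : SmoothPartitionOfUnity M (𝓡 k) M Set.univ :=
  (SmoothPartitionOfUnity.exists_isSubordinate_chartAt_source (𝓡 k) M).choose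

/-- The integral `∫_M η` of a `k`-form over the compact oriented `k`-manifold `(M, o)`, by means of
a partition of unity subordinate to the charts. -/
def integral (o : ∀ y : M, Orientation ℝ (TangentSpace (𝓡 k) y) (Fin k))
    (η : Form (𝓡 k) M k) : ℝ :=
  ∑ᶠ y₀ : M, ∫ e in (extChartAt (𝓡 k) y₀).target,
    chartPartition k M y₀ ((extChartAt (𝓡 k) y₀).symm e) *
      (frameSign o y₀ e * localRep η y₀ e fun i => EuclideanSpace.single i (1 : ℝ))

/-- Integration over the cycle `0 × M` of `ℝ^n × M`. -/
def sliceIntegral (n : ℕ) (o : ∀ y : M, Orientation ℝ (TangentSpace (𝓡 k) y) (Fin k))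
    (θ : Form ((𝓡 n).prod (𝓡 k)) (EuclideanSpace ℝ (Fin n) × M) k) : ℝ :=
  integral o (pullback (𝓡 k) ((𝓡 n).prod (𝓡 k))
    (fun y : M => ((0 : EuclideanSpace ℝ (Fin n)), y)) θ)

end Integration

/-- The form `w ∧ υ` on `ℝ^n × M` (i.e. `pr_1^* w ∧ pr_2^* υ`), where `w` is a form on `ℝ^n` with
constant coefficients and `υ` is a form on `M`; its degree `d + l` is written as `m`. -/
def constWedge {n k d l m : ℕ} {M : Type*} [TopologicalSpace M]
    [ChartedSpace (EuclideanSpace ℝ (Fin k)) M] (h : d + l = m)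
    (w : EuclideanSpace ℝ (Fin n) [⋀^Fin d]→L[ℝ] ℝ) (υ : Form (𝓡 k) M l) :
    Form ((𝓡 n).prod (𝓡 k)) (EuclideanSpace ℝ (Fin n) × M) m :=
  let wForm : Form (𝓡 n) (EuclideanSpace ℝ (Fin n)) d := fun _ => w
  wedge h (pullback ((𝓡 n).prod (𝓡 k)) (𝓡 n) Prod.fst wForm)
    (pullback ((𝓡 n).prod (𝓡 k)) (𝓡 k) Prod.snd υ)

/-- The group `Diff(ℝ^n × M, (w_i ∧ υ))`. -/
def constWedgeGroup {n k l : ℕ} {M : Type*} [TopologicalSpace M]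
    [ChartedSpace (EuclideanSpace ℝ (Fin k)) M] {ι : Type*} {deg : ι → ℕ}
    (w : ∀ i, EuclideanSpace ℝ (Fin n) [⋀^Fin (deg i)]→L[ℝ] ℝ) (υ : Form (𝓡 k) M l) :
    Subgroup ((EuclideanSpace ℝ (Fin n) × M)
      ≃ₘ⟮(𝓡 n).prod (𝓡 k), (𝓡 n).prod (𝓡 k)⟯ (EuclideanSpace ℝ (Fin n) × M)) :=
  diffPreserving fun i => constWedge (rfl : deg i + l = deg i + l) (w i) υ

end DiffForm

end

open scoped Manifold ContDiff Topology

noncomputable section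

namespace DiffForm

/-! ### Algebra of group cochains -/

section CochainAlgebra

variable {G A : Type*}

/-! The cocycle is defined because `X = ℝ^n × M` retracts onto `0 × M`. Integration along the
contraction `(x, y) ↦ (tx, y)` gives an operator `K` (`homotopyOp`) with `dKη = η - ρ^*η` for closed
`η`, where `ρ(x, y) = (0, y)` (`d_homotopyOp`). The rank of `ρ` is at most `k`, so `ρ^*η = 0` in
degrees above `k`, and there `K` produces primitives of closed forms. This makes `Θ = w ∧ υ` exact,
kills `H^j(X)` for `j > k`, and solves the descent equations one after another
(`isDescent_descentCochain`). The last form `δ'φ_{p,k}` is closed, and on closed forms integration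
over `α` does not notice pullback by `Γ`; hence `c_a` is a cocycle. The same operator shows that two
descents differ by closed forms up to `δ'`-closed terms, which gives uniqueness up to a coboundary.
That `α` is a cycle is Stokes' theorem on `M`.

Nontriviality is already visible on the translations of `ℝ^n`. They preserve every `w_i ∧ υ`, and
they fix the class of `α` because `θ - ρ^*θ` is exact and `ρ^*θ` is translation invariant. By
uniqueness any descent may be replaced, over translations, by the canonical one built from `K`.
There everything is explicit: by homogeneity of `Θ` under scalings of `ℝ^n`, `φ_i(v_1, …, v_i)` at
the point `x` is a nonzero multiple of the contraction of `Θ` with `v_1, …, v_i, x`, and `δ'`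
replaces `x` by the next translation vector (`exists_descentCochain_translationGroup`,
`delta₁_contractions`). So `c_a(v_1, …, v_{p+1})` is a nonzero multiple of `w(v_1, …, v_{p+1})`; the
factor works out to `1/(p+1)!`, but only its nonvanishing is used.

Finally, the antisymmetrization of a coboundary over commuting elements vanishes
(`sum_sign_trivD_eq_zero`), while that of the alternating form `w` is `(p+1)! w`. Since `w ≠ 0`,
`c_a` is not a coboundary, with no regularity assumed of the bounding cochain. -/

lemma contractNth_zero_cons_cons {p : ℕ} (op : G → G → G) (a b : G) (r : Fin p → G) :
    Fin.contractNth 0 op (Fin.cons a (Fin.cons b r : Fin (p + 1) → G)) =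
      (Fin.cons (op a b) r : Fin (p + 1) → G) := by
  funext k
  refine Fin.cases ?_ (fun k => ?_) k
  · rw [Fin.contractNth_apply_of_eq _ _ _ _ (by simp)]; simp
  · rw [Fin.contractNth_apply_of_gt _ _ _ _ (by simp)]; simp

lemma contractNth_succ_cons {p : ℕ} (op : G → G → G) (j : Fin (p + 1)) (a : G)
    (r : Fin (p + 1) → G) :
    Fin.contractNth j.succ op (Fin.cons a r : Fin (p + 2) → G) =
      (Fin.cons a (Fin.contractNth j op r) : Fin (p + 1) → G) := by
  funext k
  refine Fin.cases ?_ (fun k => ?_) k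
  · rw [Fin.contractNth_apply_of_lt _ _ _ _ (by simp)]; simp
  · rw [Fin.cons_succ]
    rcases lt_trichotomy (k : ℕ) j with h | h | h
    · rw [Fin.contractNth_apply_of_lt _ _ _ _ h,
        Fin.contractNth_apply_of_lt _ _ _ _ (by simpa using h), ← Fin.succ_castSucc, Fin.cons_succ]
    · rw [Fin.contractNth_apply_of_eq _ _ _ _ h,
        Fin.contractNth_apply_of_eq _ _ _ _ (by simpa using h), ← Fin.succ_castSucc, Fin.cons_succ,
        Fin.cons_succ]
    · rw [Fin.contractNth_apply_of_gt _ _ _ _ h,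
        Fin.contractNth_apply_of_gt _ _ _ _ (by simpa using h), Fin.cons_succ]

variable [AddCommGroup A]

section

variable [Mul G] (act : A → G → A)

lemma cochainD_zero (f : (Fin 0 → G) → A) (g : Fin 1 → G) :
    cochainD act f g = f Fin.elim0 - act (f Fin.elim0) (g 0) := by
  have h : ∀ x : Fin 0 → G, x = Fin.elim0 := fun x => Subsingleton.elim _ _
  simp only [cochainD, h]
  simp [sub_eq_add_neg]

/-- Recursion for the differential of nonhomogeneous cochains. -/
lemma cochainD_cons_cons {p : ℕ} (f : (Fin (p + 1) → G) → A) (a b : G) (r : Fin p → G) :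
    cochainD act f (Fin.cons a (Fin.cons b r : Fin (p + 1) → G)) =
      f (Fin.cons b r) - f (Fin.cons (a * b) r) + f (Fin.cons a r)
        - cochainD act (fun h : Fin p → G => f (Fin.cons a h)) (Fin.cons b r) := by
  simp only [cochainD]
  rw [Fin.sum_univ_succ]
  have h0 : (fun i : Fin (p + 1) =>
      (Fin.cons a (Fin.cons b r : Fin (p + 1) → G) : Fin (p + 2) → G) i.succ) = Fin.cons b r := by
    funext i; simp
  have h1 : (fun i : Fin p => (Fin.cons b r : Fin (p + 1) → G) i.succ) = r := by
    funext i; simp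
  have h2 : (fun i : Fin (p + 1) =>
      (Fin.cons a (Fin.cons b r : Fin (p + 1) → G) : Fin (p + 2) → G) i.castSucc) =
      Fin.cons a (fun i : Fin p => (Fin.cons b r : Fin (p + 1) → G) i.castSucc) := by
    funext i
    refine Fin.cases ?_ (fun i => ?_) i
    · simp
    · rw [← Fin.succ_castSucc, Fin.cons_succ, Fin.cons_succ]
  have h3 : (Fin.cons a (Fin.cons b r : Fin (p + 1) → G) : Fin (p + 2) → G) (Fin.last (p + 1)) =
      (Fin.cons b r : Fin (p + 1) → G) (Fin.last p) := by
    rw [← Fin.succ_last, Fin.cons_succ]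
  rw [h0, h1, h2, h3, Fin.castSucc_zero, contractNth_zero_cons_cons]
  simp only [← Fin.succ_castSucc, contractNth_succ_cons]
  -- The faces that do not touch `a` are the faces of `(b, r)` moved up by one index, which reverses
  -- their signs.
  have h4 : ∀ i : Fin p, ((-1 : ℤ) ^ ((i.succ : Fin (p + 1)) : ℕ).succ : ℤ) =
      -((-1) ^ ((i : ℕ) + 1)) := by
    intro i; rw [Nat.succ_eq_add_one, Fin.val_succ]; ring
  simp only [Nat.succ_eq_add_one] at h4
  simp only [h4, neg_smul, Finset.sum_neg_distrib, pow_succ (-1 : ℤ) (p + 1)]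
  simp
  abel

variable {act}

lemma cochainD_add (hadd : ∀ a b g, act (a + b) g = act a g + act b g) {p : ℕ}
    (f f' : (Fin p → G) → A) : cochainD act (f + f') = cochainD act f + cochainD act f' := by
  funext g
  simp only [cochainD, Pi.add_apply, hadd, smul_add, Finset.sum_add_distrib]
  abel

/-- The differential of nonhomogeneous cochains, as a homomorphism. -/
def cochainDHom (hadd : ∀ a b g, act (a + b) g = act a g + act b g) (p : ℕ) :
    ((Fin p → G) → A) →+ ((Fin (p + 1) → G) → A) :=
  AddMonoidHom.mk' (cochainD act) (cochainD_add hadd)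

lemma cochainD_sub (hadd : ∀ a b g, act (a + b) g = act a g + act b g) {p : ℕ}
    (f f' : (Fin p → G) → A) : cochainD act (f - f') = cochainD act f - cochainD act f' :=
  map_sub (cochainDHom hadd p) f f'

lemma cochainD_neg (hadd : ∀ a b g, act (a + b) g = act a g + act b g) {p : ℕ}
    (f : (Fin p → G) → A) : cochainD act (-f) = -cochainD act f :=
  map_neg (cochainDHom hadd p) f

lemma cochainD_zsmul (hadd : ∀ a b g, act (a + b) g = act a g + act b g) {p : ℕ} (n : ℤ)
    (f : (Fin p → G) → A) : cochainD act (n • f) = n • cochainD act f :=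
  map_zsmul (cochainDHom hadd p) n f

/-- A cochain which is additive in each argument is a cocycle for the trivial action. -/
lemma cochainD_eq_zero_of_multiadditive {G A : Type*} [AddCommGroup A] [Mul G] {p : ℕ}
    (f : (Fin p → G) → A)
    (hf : ∀ i (g : Fin p → G) a b, f (Function.update g i (a * b)) =
      f (Function.update g i a) + f (Function.update g i b)) :
    cochainD (fun a (_ : G) => a) f = 0 := by
  induction p with
  | zero =>
    funext g
    rw [cochainD_zero]
    simp
  | succ p ih =>
    funext g
    obtain ⟨a, b, r, rfl⟩ : ∃ a b, ∃ r : Fin p → G,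
        g = Fin.cons a (Fin.cons b r : Fin (p + 1) → G) :=
      ⟨g 0, g 1, fun i => g i.succ.succ, by
        funext i
        refine Fin.cases rfl (fun i => ?_) i
        refine Fin.cases rfl (fun i => ?_) i
        rfl⟩
    -- With the first argument fixed the cochain is still multiadditive, so its differential
    -- vanishes by induction; the three remaining terms cancel by additivity in the first argument.
    rw [cochainD_cons_cons, ih (fun h => f (Fin.cons a h))]
    · have := hf 0 (Fin.cons a r) a b
      rw [Fin.update_cons_zero, Fin.update_cons_zero, Fin.update_cons_zero] at this
      rw [this]
      simp
    · intro i g x y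
      simpa only [Fin.cons_update] using hf i.succ (Fin.cons a g) x y

end

/-- Induction on the arity through the recursion `cochainD_cons_cons`, in place of matching pairs of
faces in a double sum. -/
lemma cochainD_cochainD [Semigroup G] {act : A → G → A}
    (hadd : ∀ a b g, act (a + b) g = act a g + act b g)
    (hmul : ∀ a g h, act a (g * h) = act (act a g) h) {p : ℕ} (f : (Fin p → G) → A) :
    cochainD act (cochainD act f) = 0 := by
  have cases1 : ∀ {p : ℕ} (g : Fin (p + 1) → G), ∃ a, ∃ r : Fin p → G, g = Fin.cons a r :=
    fun g => ⟨g 0, fun i => g i.succ, (Fin.cons_self_tail g).symm⟩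
  have hsub : ∀ a b g, act (a - b) g = act a g - act b g := fun a b g =>
    map_sub (AddMonoidHom.mk' (fun a => act a g) (fun a b => hadd a b g)) a b
  induction p with
  | zero =>
    funext g
    obtain ⟨a, r, rfl⟩ := cases1 g
    obtain ⟨b, r, rfl⟩ := cases1 r
    rw [cochainD_cons_cons, cochainD_zero, cochainD_zero, cochainD_zero, cochainD_zero,
      cochainD_zero]
    simp only [Fin.cons_zero, hmul, hsub, Pi.zero_apply]
    abel
  | succ p ih =>
    funext g
    obtain ⟨a, r, rfl⟩ := cases1 g
    obtain ⟨b, r, rfl⟩ := cases1 r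
    obtain ⟨c, r, rfl⟩ := cases1 r
    -- The recursion read as an identity of cochains in the arguments after `a`. Applying the
    -- differential again, the last term dies by the induction hypothesis.
    have h1 : (fun h : Fin (p + 1) → G => cochainD act f (Fin.cons a h)) =
        (fun h => f h - f (Fin.cons (a * h 0) (Fin.tail h)) + f (Fin.cons a (Fin.tail h)))
          - cochainD act (fun h => f (Fin.cons a h)) := by
      funext h
      obtain ⟨b, r, rfl⟩ := cases1 h
      rw [cochainD_cons_cons]
      simp
    rw [cochainD_cons_cons, h1, cochainD_sub hadd, ih, sub_zero, cochainD_cons_cons act f b c r,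
      cochainD_cons_cons act f (a * b) c r, cochainD_cons_cons act f a c r,
      cochainD_cons_cons act _ b c r]
    have h2 : (fun h : Fin p → G => (fun h : Fin (p + 1) → G => f h - f (Fin.cons (a * h 0)
        (Fin.tail h)) + f (Fin.cons a (Fin.tail h))) (Fin.cons b h)) =
        (fun h => f (Fin.cons b h)) - (fun h => f (Fin.cons (a * b) h)) +
          fun h => f (Fin.cons a h) := by
      funext h
      simp
    rw [h2, cochainD_add hadd, cochainD_sub hadd]
    simp only [Fin.cons_zero, Fin.tail_cons, mul_assoc, Pi.add_apply, Pi.sub_apply, Pi.zero_apply]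
    abel

lemma trivD_sub [Mul G] {p : ℕ} (b b' : (Fin p → G) → ℝ) :
    trivD (b - b') = trivD b - trivD b' := cochainD_sub (fun _ _ _ => rfl) b b'

/-- Under antisymmetrization this makes the terms of an inner face cancel in pairs. -/
lemma contractNth_swap {p : ℕ} (op : G → G → G) (j : Fin p) (g : Fin (p + 1) → G)
    (hc : ∀ i k, op (g i) (g k) = op (g k) (g i)) :
    Fin.contractNth j.castSucc op (g ∘ Equiv.swap j.castSucc j.succ) =
      Fin.contractNth j.castSucc op g := by
  funext k
  rcases lt_trichotomy (k : ℕ) j with h | h | h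
  · rw [Fin.contractNth_apply_of_lt _ _ _ _ (by simpa using h),
      Fin.contractNth_apply_of_lt _ _ _ _ (by simpa using h), Function.comp_apply,
      Equiv.swap_apply_of_ne_of_ne]
    · simp [Fin.ext_iff]; omega
    · simp [Fin.ext_iff]; omega
  · obtain rfl : k = j := Fin.ext h
    rw [Fin.contractNth_apply_of_eq _ _ _ _ (by simp),
      Fin.contractNth_apply_of_eq _ _ _ _ (by simp), Function.comp_apply, Function.comp_apply,
      Equiv.swap_apply_left, Equiv.swap_apply_right, hc]
  · rw [Fin.contractNth_apply_of_gt _ _ _ _ (by simpa using h),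
      Fin.contractNth_apply_of_gt _ _ _ _ (by simpa using h), Function.comp_apply,
      Equiv.swap_apply_of_ne_of_ne]
    · simp [Fin.ext_iff]; omega
    · simp [Fin.ext_iff]; omega

/-- On commuting elements the antisymmetrization of a coboundary vanishes. -/
lemma sum_sign_trivD_eq_zero [Mul G] {p : ℕ} (b : (Fin p → G) → ℝ) (g : Fin (p + 1) → G)
    (hc : ∀ i k, g i * g k = g k * g i) :
    ∑ σ : Equiv.Perm (Fin (p + 1)), ((Equiv.Perm.sign σ : ℤ) : ℝ) * trivD b (g ∘ σ) = 0 := by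
  -- Reindexing by an adjacent transposition fixes the inner face and reverses the sign, so the sum
  -- equals its own negative.
  have hswap : ∀ j : Fin p, ∑ σ : Equiv.Perm (Fin (p + 1)), ((Equiv.Perm.sign σ : ℤ) : ℝ) *
      b (Fin.contractNth j.castSucc (· * ·) (g ∘ σ)) = 0 := by
    intro j
    have h := Equiv.sum_comp (Equiv.mulRight (Equiv.swap j.castSucc j.succ))
      fun σ : Equiv.Perm (Fin (p + 1)) => ((Equiv.Perm.sign σ : ℤ) : ℝ) *
        b (Fin.contractNth j.castSucc (· * ·) (g ∘ σ))
    have hne : j.castSucc ≠ j.succ := by simp [Fin.ext_iff]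
    simp only [Equiv.coe_mulRight, Equiv.Perm.sign_mul, Equiv.Perm.sign_swap hne,
      Equiv.Perm.coe_mul, ← Function.comp_assoc] at h
    simp only [fun σ : Equiv.Perm (Fin (p + 1)) => contractNth_swap (· * ·) j (g ∘ σ)
      fun i k => hc (σ i) (σ k)] at h
    simp only [mul_neg, mul_one, Units.val_neg, Int.cast_neg, neg_mul,
      Finset.sum_neg_distrib] at h
    linarith
  -- The two outer faces differ by the cyclic rotation, of sign `(-1)^p`; in the coboundary they
  -- carry the relative sign `(-1)^(p+1)` and cancel.
  have hrot : ∑ σ : Equiv.Perm (Fin (p + 1)), ((Equiv.Perm.sign σ : ℤ) : ℝ) *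
        b (fun i => (g ∘ σ) i.succ) = (-1) ^ p *
      ∑ σ : Equiv.Perm (Fin (p + 1)), ((Equiv.Perm.sign σ : ℤ) : ℝ) *
        b (fun i => (g ∘ σ) i.castSucc) := by
    rw [Finset.mul_sum, ← Equiv.sum_comp (Equiv.mulRight (finRotate (p + 1)))
      fun σ : Equiv.Perm (Fin (p + 1)) => (-1) ^ p * (((Equiv.Perm.sign σ : ℤ) : ℝ) *
        b (fun i => (g ∘ σ) i.castSucc))]
    refine Finset.sum_congr rfl fun σ _ => ?_
    have h : ∀ i : Fin p, finRotate (p + 1) i.castSucc = i.succ := by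
      intro i; simp
    simp only [Equiv.coe_mulRight, Equiv.Perm.sign_mul, sign_finRotate, Equiv.Perm.coe_mul,
      Function.comp_apply, h]
    push_cast
    rw [← mul_assoc, mul_comm _ ((-1 : ℝ) ^ p), ← mul_assoc, ← mul_pow]
    simp
  have : ∀ σ : Equiv.Perm (Fin (p + 1)), ((Equiv.Perm.sign σ : ℤ) : ℝ) * trivD b (g ∘ σ) =
      ((Equiv.Perm.sign σ : ℤ) : ℝ) * b (fun i => (g ∘ σ) i.succ) +
      ∑ j : Fin p, (-1) ^ ((j : ℕ) + 1) * (((Equiv.Perm.sign σ : ℤ) : ℝ) *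
        b (Fin.contractNth j.castSucc (· * ·) (g ∘ σ))) +
      (-1) ^ (p + 1) * (((Equiv.Perm.sign σ : ℤ) : ℝ) * b (fun i => (g ∘ σ) i.castSucc)) := by
    intro σ
    simp only [trivD, cochainD, zsmul_eq_mul, mul_add, Finset.mul_sum]
    push_cast
    congr 1
    · congr 1
      exact Finset.sum_congr rfl fun j _ => by ring
    · ring
  simp only [this, Finset.sum_add_distrib]
  rw [Finset.sum_comm]
  simp only [← Finset.mul_sum, hswap, hrot]
  simp only [mul_zero, Finset.sum_const_zero]
  ring

end CochainAlgebra

/-! ### Calculus of smooth forms -/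

section FormCalculus

variable {E : Type*} [NormedAddCommGroup E] [NormedSpace ℝ E] {H : Type*} [TopologicalSpace H]
  {X : Type*} [TopologicalSpace X] [ChartedSpace H X] {I : ModelWithCorners ℝ E H} {q : ℕ}

lemma form_congr (θ : Form I X q) {y z : X} (h : y = z) {v w : Fin q → E} (h' : v = w) :
    (θ y : E [⋀^Fin q]→L[ℝ] ℝ) v = (θ z : E [⋀^Fin q]→L[ℝ] ℝ) w := by
  subst h h'
  rfl

lemma localRep_add (θ η : Form I X q) (x₀ : X) :
    localRep (θ + η) x₀ = localRep θ x₀ + localRep η x₀ := rfl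

lemma localRep_smul (c : ℝ) (θ : Form I X q) (x₀ : X) :
    localRep (c • θ) x₀ = c • localRep θ x₀ := rfl

lemma neg_eq_smul (θ : Form I X q) : -θ = (-1 : ℝ) • θ :=
  (neg_one_smul ℝ θ).symm

lemma zsmul_eq_smul (n : ℤ) (θ : Form I X q) : n • θ = (n : ℝ) • θ :=
  (Int.cast_smul_eq_zsmul ℝ n θ).symm

lemma pullback_id (θ : Form I X q) : pullback I I id θ = θ := by
  funext x
  ext v
  simp only [pullback, mfderiv_id]
  rfl

lemma isSmooth_zero : IsSmooth (0 : Form I X q) := fun _ =>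
  (contDiffOn_const (c := (0 : E [⋀^Fin q]→L[ℝ] ℝ))).congr fun _ _ => rfl

lemma IsSmooth.add {θ η : Form I X q} (hθ : IsSmooth θ) (hη : IsSmooth η) : IsSmooth (θ + η) :=
  fun x₀ => (hθ x₀).add (hη x₀)

lemma IsSmooth.smul (c : ℝ) {θ : Form I X q} (hθ : IsSmooth θ) : IsSmooth (c • θ) :=
  fun x₀ => (hθ x₀).const_smul c

lemma IsSmooth.neg {θ : Form I X q} (hθ : IsSmooth θ) : IsSmooth (-θ) := by
  rw [neg_eq_smul]; exact hθ.smul _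

lemma IsSmooth.zsmul (n : ℤ) {θ : Form I X q} (hθ : IsSmooth θ) : IsSmooth (n • θ) := by
  rw [zsmul_eq_smul]; exact hθ.smul _

lemma IsSmooth.sub {θ η : Form I X q} (hθ : IsSmooth θ) (hη : IsSmooth η) : IsSmooth (θ - η) := by
  rw [sub_eq_add_neg]; exact hθ.add hη.neg

lemma IsSmooth.sum {ι : Type*} (s : Finset ι) {θ : ι → Form I X q}
    (h : ∀ i ∈ s, IsSmooth (θ i)) : IsSmooth (∑ i ∈ s, θ i) :=
  Finset.sum_induction _ _ (fun _ _ => IsSmooth.add) isSmooth_zero h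

lemma d_smul (c : ℝ) (θ : Form I X q) : d (c • θ) = c • d θ := by
  funext x
  simp only [d, localRep_smul, extDeriv_smul]
  rfl

lemma d_neg (θ : Form I X q) : d (-θ) = -d θ := by
  rw [neg_eq_smul, d_smul, neg_eq_smul (d θ)]

lemma d_zsmul (n : ℤ) (θ : Form I X q) : d (n • θ) = n • d θ := by
  rw [zsmul_eq_smul, d_smul, zsmul_eq_smul n (d θ)]

lemma d_zero : d (0 : Form I X q) = 0 := by
  have := d_smul (0 : ℝ) (0 : Form I X q)
  simpa only [zero_smul] using this

section

variable [I.Boundaryless]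

lemma IsSmooth.contDiffAt {θ : Form I X q} (hθ : IsSmooth θ) (x₀ : X) {e : E}
    (he : e ∈ (extChartAt I x₀).target) : ContDiffAt ℝ ∞ (localRep θ x₀) e :=
  (hθ x₀).contDiffAt ((isOpen_extChartAt_target x₀).mem_nhds he)

lemma IsSmooth.differentiableAt {θ : Form I X q} (hθ : IsSmooth θ) (x₀ : X) {e : E}
    (he : e ∈ (extChartAt I x₀).target) : DifferentiableAt ℝ (localRep θ x₀) e :=
  (hθ.contDiffAt x₀ he).differentiableAt (by simp)

lemma d_add {θ η : Form I X q} (hθ : IsSmooth θ) (hη : IsSmooth η) : d (θ + η) = d θ + d η := by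
  funext x
  have he := mem_extChartAt_target (I := I) x
  simp only [d, localRep_add, extDeriv_add (hθ.differentiableAt x he) (hη.differentiableAt x he)]
  rfl

lemma d_sub {θ η : Form I X q} (hθ : IsSmooth θ) (hη : IsSmooth η) : d (θ - η) = d θ - d η := by
  rw [sub_eq_add_neg, d_add hθ hη.neg, d_neg, sub_eq_add_neg]

lemma d_sum {ι : Type*} (s : Finset ι) {θ : ι → Form I X q} (h : ∀ i ∈ s, IsSmooth (θ i)) :
    d (∑ i ∈ s, θ i) = ∑ i ∈ s, d (θ i) := by
  classical
  induction s using Finset.induction_on with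
  | empty => exact d_zero
  | insert a s ha ih =>
    rw [Finset.sum_insert ha, Finset.sum_insert ha, d_add (h a (by simp)) (IsSmooth.sum s
      fun i hi => h i (by simp [hi])), ih fun i hi => h i (by simp [hi])]

end

end FormCalculus

/-! ### Pullback by smooth maps between manifolds -/

section MapNaturality

variable {E : Type*} [NormedAddCommGroup E] [NormedSpace ℝ E] {H : Type*} [TopologicalSpace H]
  {X : Type*} [TopologicalSpace X] [ChartedSpace H X] {I : ModelWithCorners ℝ E H}
  [I.Boundaryless] [IsManifold I ∞ X]
  {E' : Type*} [NormedAddCommGroup E'] [NormedSpace ℝ E'] {H' : Type*} [TopologicalSpace H']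
  {Y : Type*} [TopologicalSpace Y] [ChartedSpace H' Y] {J : ModelWithCorners ℝ E' H'}
  [IsManifold J ∞ Y]

/-- A map read in the charts at `x₀` and `y₀`. -/
def mapInCharts (I : ModelWithCorners ℝ E H) (J : ModelWithCorners ℝ E' H') (f : X → Y)
    (x₀ : X) (y₀ : Y) (e : E) : E' :=
  extChartAt J y₀ (f ((extChartAt I x₀).symm e))

lemma contDiffAt_mapInCharts {f : X → Y} (hf : ContMDiff I J ∞ f) (x₀ : X) (y₀ : Y) {e : E}
    (he : e ∈ (extChartAt I x₀).target)
    (hy : f ((extChartAt I x₀).symm e) ∈ (extChartAt J y₀).source) :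
    ContDiffAt ℝ ∞ (mapInCharts I J f x₀ y₀) e := by
  rw [← contMDiffAt_iff_contDiffAt]
  have h1 := (contMDiffOn_extChartAt_symm (n := ∞) (I := I) x₀).contMDiffAt
    ((isOpen_extChartAt_target x₀).mem_nhds he)
  have h2 : ContMDiffAt J 𝓘(ℝ, E') ∞ (extChartAt J y₀) (f ((extChartAt I x₀).symm e)) :=
    contMDiffAt_extChartAt' (by rwa [extChartAt_source] at hy)
  exact h2.comp e (hf.contMDiffAt.comp e h1)

variable [J.Boundaryless]

/-- Needed for maps between different manifolds, such as the inclusion of the slice `0 × M`; with `f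
= id` it is the change of charts formula. -/
lemma localRep_map_pullback {q : ℕ} {f : X → Y} (hf : ContMDiff I J ∞ f) (θ : Form J Y q)
    (x₀ : X) (y₀ : Y) {e : E} (he : e ∈ (extChartAt I x₀).target)
    (hy : f ((extChartAt I x₀).symm e) ∈ (extChartAt J y₀).source) :
    localRep (pullback I J f θ) x₀ e =
      (localRep θ y₀ (mapInCharts I J f x₀ y₀ e)).compContinuousLinearMap
        (fderiv ℝ (mapInCharts I J f x₀ y₀) e) := by
  have hF := (contDiffAt_mapInCharts hf x₀ y₀ he hy).differentiableAt (by simp)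
  have h1 := (hf.mdifferentiable (by simp) ((extChartAt I x₀).symm e)).hasMFDerivAt.comp e
    (mdifferentiableAt_symm x₀ he).hasMFDerivAt
  have h2 := (mdifferentiableAt_symm (I := J) y₀
    ((extChartAt J y₀).map_source hy)).hasMFDerivAt.comp e hF.hasFDerivAt.hasMFDerivAt
  have hev : f ∘ (extChartAt I x₀).symm =ᶠ[𝓝 e]
      (extChartAt J y₀).symm ∘ mapInCharts I J f x₀ y₀ := by
    have hc : ContinuousAt (f ∘ (extChartAt I x₀).symm) e := h1.1
    filter_upwards [hc.preimage_mem_nhds ((isOpen_extChartAt_source y₀).mem_nhds hy)] with z hz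
    exact ((extChartAt J y₀).left_inv hz).symm
  have h3 := hasMFDerivAt_unique h1 (h2.congr_of_eventuallyEq hev)
  ext v
  exact form_congr θ ((extChartAt J y₀).left_inv hy).symm
    (funext fun i => congrArg (fun L : E →L[ℝ] E' => L (v i)) h3)

lemma eventually_localRep_map_pullback {q : ℕ} {f : X → Y} (hf : ContMDiff I J ∞ f)
    (θ : Form J Y q) (x₀ : X) (y₀ : Y) {e : E} (he : e ∈ (extChartAt I x₀).target)
    (hy : f ((extChartAt I x₀).symm e) ∈ (extChartAt J y₀).source) :
    localRep (pullback I J f θ) x₀ =ᶠ[𝓝 e] fun z =>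
      (localRep θ y₀ (mapInCharts I J f x₀ y₀ z)).compContinuousLinearMap
        (fderiv ℝ (mapInCharts I J f x₀ y₀) z) := by
  have hc : ContinuousAt (f ∘ (extChartAt I x₀).symm) e :=
    hf.continuous.continuousAt.comp (continuousAt_extChartAt_symm'' he)
  filter_upwards [(isOpen_extChartAt_target x₀).mem_nhds he,
    hc.preimage_mem_nhds ((isOpen_extChartAt_source y₀).mem_nhds hy)] with z hz hz'
  exact localRep_map_pullback hf θ x₀ y₀ hz hz'

lemma isSmooth_map_pullback {q : ℕ} {f : X → Y} (hf : ContMDiff I J ∞ f) {θ : Form J Y q}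
    (hθ : IsSmooth θ) : IsSmooth (pullback I J f θ) := by
  intro x₀ e he
  set y₀ := f ((extChartAt I x₀).symm e)
  have hy : y₀ ∈ (extChartAt J y₀).source := mem_extChartAt_source y₀
  refine ContDiffAt.contDiffWithinAt ?_
  refine ContDiffAt.congr_of_eventuallyEq ?_ (eventually_localRep_map_pullback hf θ x₀ y₀ he hy)
  have hF := contDiffAt_mapInCharts hf x₀ y₀ he hy
  have h1 : ContDiffAt ℝ ∞ (localRep θ y₀) (mapInCharts I J f x₀ y₀ e) :=
    hθ.contDiffAt y₀ ((extChartAt J y₀).map_source hy)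
  exact (contDiff_compCLM q).contDiffAt.comp e
    ((h1.comp e hF).prodMk (hF.fderiv_right (m := ∞) (by simp)))

lemma extDeriv_localRep_map_pullback {q : ℕ} {f : X → Y} (hf : ContMDiff I J ∞ f)
    {θ : Form J Y q} (hθ : IsSmooth θ) (x₀ : X) (y₀ : Y) {e : E}
    (he : e ∈ (extChartAt I x₀).target)
    (hy : f ((extChartAt I x₀).symm e) ∈ (extChartAt J y₀).source) :
    extDeriv (localRep (pullback I J f θ) x₀) e =
      (extDeriv (localRep θ y₀) (mapInCharts I J f x₀ y₀ e)).compContinuousLinearMap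
        (fderiv ℝ (mapInCharts I J f x₀ y₀) e) := by
  have h1 : DifferentiableAt ℝ (localRep θ y₀) (mapInCharts I J f x₀ y₀ e) :=
    hθ.differentiableAt y₀ ((extChartAt J y₀).map_source hy)
  have hF := contDiffAt_mapInCharts hf x₀ y₀ he hy
  rw [(eventually_localRep_map_pullback hf θ x₀ y₀ he hy).extDeriv_eq,
    extDeriv_pullback h1 hF (by
      rw [minSmoothness_of_isRCLikeNormedField]
      exact WithTop.coe_le_coe.2 (le_top : (2 : ℕ∞) ≤ ⊤))]

/-- The exterior derivative can be computed in any chart. -/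
lemma localRep_d {q : ℕ} {θ : Form I X q} (hθ : IsSmooth θ) (x₀ : X) {e : E}
    (he : e ∈ (extChartAt I x₀).target) :
    localRep (d θ) x₀ e = extDeriv (localRep θ x₀) e := by
  set x := (extChartAt I x₀).symm e with hx
  have hy : id ((extChartAt I x₀).symm e) ∈ (extChartAt I x).source := mem_extChartAt_source x
  have h := extDeriv_localRep_map_pullback (contMDiff_id (I := I) (M := X)) hθ x₀ x he hy
  rw [pullback_id] at h
  rw [h]
  -- The derivative of the transition map is the composite of the derivatives of one chart and of
  -- the inverse of the other, which are exactly the two factors in the definitions of `d` and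
  -- `localRep`.
  have key : ∀ A : E →L[ℝ] E, HasMFDerivAt 𝓘(ℝ, E) 𝓘(ℝ, E) (mapInCharts I I id x₀ x) e A →
      fderiv ℝ (mapInCharts I I id x₀ x) e = A := fun A hA => by
    rw [← mfderiv_eq_fderiv]
    exact hA.mfderiv
  rw [key _ ((mdifferentiableAt_extChartAt (I := I) (x := x)
    (mem_chart_source H x)).hasMFDerivAt.comp e (mdifferentiableAt_symm x₀ he).hasMFDerivAt)]
  rfl

lemma isSmooth_d {q : ℕ} {θ : Form I X q} (hθ : IsSmooth θ) : IsSmooth (d θ) := by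
  intro x₀
  have h : ContDiffOn ℝ ∞ (extDeriv (localRep θ x₀)) (extChartAt I x₀).target := by
    have h1 : ContDiffOn ℝ ∞ (fderiv ℝ (localRep θ x₀)) (extChartAt I x₀).target :=
      (hθ x₀).fderiv_of_isOpen (isOpen_extChartAt_target x₀) (by simp)
    exact (ContinuousAlternatingMap.alternatizeUncurryFinCLM ℝ E ℝ (n := q)).contDiff.comp_contDiffOn
      h1
  exact h.congr fun e he => localRep_d hθ x₀ he

/-- A form is determined by its local expressions. -/
lemma form_eq_localRep {q : ℕ} (θ : Form I X q) (x₀ : X) {x : X}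
    (hx : x ∈ (extChartAt I x₀).source) : (θ x : E [⋀^Fin q]→L[ℝ] ℝ) =
      (localRep θ x₀ (extChartAt I x₀ x)).compContinuousLinearMap
        (mfderiv I 𝓘(ℝ, E) (extChartAt I x₀) x : E →L[ℝ] E) := by
  have h1 := (mdifferentiableAt_symm (I := I) x₀
    ((extChartAt I x₀).map_source hx)).hasMFDerivAt.comp x (mdifferentiableAt_extChartAt (I := I)
      (x := x₀) (by rwa [extChartAt_source] at hx)).hasMFDerivAt
  have hev : id =ᶠ[𝓝 x] (extChartAt I x₀).symm ∘ extChartAt I x₀ := by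
    filter_upwards [(isOpen_extChartAt_source x₀).mem_nhds hx] with z hz
    exact ((extChartAt I x₀).left_inv hz).symm
  have h3 := hasMFDerivAt_unique (h1.congr_of_eventuallyEq hev) (hasMFDerivAt_id x)
  ext v
  exact form_congr θ ((extChartAt I x₀).left_inv hx).symm
    (funext fun i => (congrArg (fun L : E →L[ℝ] E => L (v i)) h3).symm)

lemma form_ext_localRep {q : ℕ} {θ η : Form I X q}
    (h : ∀ x, localRep θ x (extChartAt I x x) = localRep η x (extChartAt I x x)) : θ = η := by
  funext x
  have h1 := form_eq_localRep θ x (mem_extChartAt_source (I := I) x)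
  rw [h x, ← form_eq_localRep η x (mem_extChartAt_source (I := I) x)] at h1
  exact h1

lemma d_map_pullback {q : ℕ} {f : X → Y} (hf : ContMDiff I J ∞ f) {θ : Form J Y q}
    (hθ : IsSmooth θ) : d (pullback I J f θ) = pullback I J f (d θ) := by
  refine form_ext_localRep fun x => ?_
  have he : extChartAt I x x ∈ (extChartAt I x).target := mem_extChartAt_target x
  have hx : (extChartAt I x).symm (extChartAt I x x) = x := extChartAt_to_inv x
  have hy : f ((extChartAt I x).symm (extChartAt I x x)) ∈ (extChartAt J (f x)).source := by
    rw [hx]; exact mem_extChartAt_source (f x)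
  rw [localRep_d (isSmooth_map_pullback hf hθ) x he, localRep_map_pullback hf (d θ) x (f x) he hy,
    extDeriv_localRep_map_pullback hf hθ x (f x) he hy,
    show extDeriv (localRep θ (f x)) (mapInCharts I J f x (f x) (extChartAt I x x)) = _ from
      (localRep_d hθ (f x) ((extChartAt J (f x)).map_source hy)).symm]
  rfl

end MapNaturality

/-! ### Descent in the double complex -/

section Descent

variable {E : Type*} [NormedAddCommGroup E] [NormedSpace ℝ E] {H : Type*} [TopologicalSpace H]
  {X : Type*} [TopologicalSpace X] [ChartedSpace H X] {I : ModelWithCorners ℝ E H}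
  {G : Subgroup (X ≃ₘ⟮I, I⟯ X)}

lemma delta₁_add {p q : ℕ} (c c' : (Fin p → G) → Form I X q) :
    delta₁ (c + c') = delta₁ c + delta₁ c' := cochainD_add (fun _ _ _ => rfl) c c'

lemma delta₁_sub {p q : ℕ} (c c' : (Fin p → G) → Form I X q) :
    delta₁ (c - c') = delta₁ c - delta₁ c' := cochainD_sub (fun _ _ _ => rfl) c c'

lemma delta₁_neg {p q : ℕ} (c : (Fin p → G) → Form I X q) : delta₁ (-c) = -delta₁ c :=
  cochainD_neg (fun _ _ _ => rfl) c

lemma delta₁_zsmul {p q : ℕ} (n : ℤ) (c : (Fin p → G) → Form I X q) :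
    delta₁ (n • c) = n • delta₁ c := cochainD_zsmul (fun _ _ _ => rfl) n c

lemma delta₁_delta₁ {p q : ℕ} (c : (Fin p → G) → Form I X q) : delta₁ (delta₁ c) = 0 :=
  cochainD_cochainD (act := fun (θ : Form I X q) (g : G) => pullback I I (g : X ≃ₘ⟮I, I⟯ X) θ)
    (fun _ _ _ => rfl) (fun θ g h => pullback_mul (g : X ≃ₘ⟮I, I⟯ X) h θ) c

/-- The cochain of arity zero with an invariant value is a cocycle. -/
lemma delta₁_zero_of_invariant {q : ℕ} {c : (Fin 0 → G) → Form I X q} {Θ : Form I X q}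
    (hc : ∀ g, c g = Θ) (hinv : ∀ g ∈ G, pullback I I g Θ = Θ) : delta₁ c = 0 := by
  funext g
  rw [delta₁, cochainD_zero, hc, hinv _ (g 0).2]
  exact sub_self Θ

/-! ### Restriction to a subgroup -/

section Restrict

variable {G' : Subgroup (X ≃ₘ⟮I, I⟯ X)} (h : G' ≤ G)

/-- Restriction of families of cochains to a subgroup. -/
def restrictCochain (φ : ∀ i q : ℕ, (Fin i → G) → Form I X q) :
    ∀ i q : ℕ, (Fin i → G') → Form I X q :=
  fun i q g => φ i q fun j => Subgroup.inclusion h (g j)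

lemma delta₁_restrictCochain (φ : ∀ i q : ℕ, (Fin i → G) → Form I X q) (i q : ℕ)
    (g : Fin (i + 1) → G') :
    delta₁ (restrictCochain h φ i q) g = delta₁ (φ i q) fun j => Subgroup.inclusion h (g j) := by
  simp only [delta₁, cochainD, restrictCochain]
  have h1 : ∀ k : Fin i, (fun j => Subgroup.inclusion h (Fin.contractNth k.castSucc (· * ·) g j)) =
      Fin.contractNth k.castSucc (· * ·) (fun j => Subgroup.inclusion h (g j)) := fun k =>
    Fin.comp_contractNth (· * ·) (· * ·) (f := Subgroup.inclusion h)
      (map_mul (Subgroup.inclusion h)) k.castSucc g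
  simp only [h1]
  rfl

lemma trivD_restrict {p : ℕ} (b : (Fin p → G) → ℝ) (g : Fin (p + 1) → G') :
    trivD (fun g' : Fin p → G' => b fun j => Subgroup.inclusion h (g' j)) g =
      trivD b fun j => Subgroup.inclusion h (g j) := by
  simp only [trivD, cochainD]
  have h1 : ∀ k : Fin p, (fun j => Subgroup.inclusion h (Fin.contractNth k.castSucc (· * ·) g j)) =
      Fin.contractNth k.castSucc (· * ·) (fun j => Subgroup.inclusion h (g j)) := fun k =>
    Fin.comp_contractNth (· * ·) (· * ·) (f := Subgroup.inclusion h)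
      (map_mul (Subgroup.inclusion h)) k.castSucc g
  simp only [h1]

lemma IsDescent.restrict {p r : ℕ} {Θ : Form I X (p + r + 1)}
    {φ : ∀ i q : ℕ, (Fin i → G) → Form I X q}
    (hφ : IsDescent G p r Θ φ) : IsDescent G' p r Θ (restrictCochain h φ) where
  smooth i q g := hφ.smooth i q _
  start g := hφ.start _
  step i q hi hq := by
    funext g
    rw [Pi.add_apply, delta₁_restrictCochain]
    exact congrFun (hφ.step i q hi hq) _

end Restrict

variable [I.Boundaryless] [IsManifold I ∞ X]

lemma isSmooth_delta₁ {p q : ℕ} {c : (Fin p → G) → Form I X q} (hc : ∀ g, IsSmooth (c g))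
    (g : Fin (p + 1) → G) : IsSmooth (delta₁ c g) :=
  ((hc _).add (IsSmooth.sum _ fun _ _ => (hc _).zsmul _)).add
    ((isSmooth_pullback (Diffeomorph.contMDiff _) (hc _)).zsmul _)

/-- Pullback by diffeomorphisms commutes with `d`. Smoothness enters both there and in the
additivity of `d`. -/
lemma d_delta₁ {p q : ℕ} {c : (Fin p → G) → Form I X q} (hc : ∀ g, IsSmooth (c g)) :
    (fun g => d (delta₁ c g)) = delta₁ fun g => d (c g) := by
  funext g
  have h1 : ∀ i : Fin p, IsSmooth
      ((-1 : ℤ) ^ ((i : ℕ) + 1) • c (Fin.contractNth i.castSucc (· * ·) g)) :=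
    fun i => (hc _).zsmul _
  have h2 := isSmooth_pullback (f := (g (Fin.last p) : X ≃ₘ⟮I, I⟯ X)) (Diffeomorph.contMDiff _)
    (hc fun i => g i.castSucc)
  simp only [delta₁, cochainD]
  rw [d_add ((hc _).add (IsSmooth.sum _ fun i _ => h1 i)) (h2.zsmul _),
    d_add (hc _) (IsSmooth.sum _ fun i _ => h1 i), d_sum _ fun i _ => h1 i, d_zsmul,
    d_pullback (Diffeomorph.contMDiff _) (hc _)]
  simp only [d_zsmul]

/-- `dδ'c = δ'dc = -δ'Θ = 0` by invariance of `Θ`. -/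
lemma isClosedForm_delta₁_of_const {q : ℕ} {c : (Fin 0 → G) → Form I X q} {Θ : Form I X (q + 1)}
    (hc : ∀ g, IsSmooth (c g)) (hd : ∀ g, Θ = -d (c g))
    (hinv : ∀ g ∈ G, pullback I I g Θ = Θ) (g : Fin 1 → G) : IsClosedForm (delta₁ c g) := by
  refine ⟨isSmooth_delta₁ hc g, ?_⟩
  have h := d_delta₁ hc
  have h1 : (fun g => d (c g)) = -fun _ : Fin 0 → G => Θ := by
    funext g
    rw [Pi.neg_apply, hd g, neg_neg]
  rw [h1, delta₁_neg, delta₁_zero_of_invariant (fun _ => rfl) hinv, neg_zero] at h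
  exact congrFun h g

/-- `dδ'c' = δ'dc'` equals `±δ'δ'c = 0`. -/
lemma isClosedForm_delta₁_of_step {p q : ℕ} {c : (Fin p → G) → Form I X (q + 1)}
    {c' : (Fin (p + 1) → G) → Form I X q} (hc' : ∀ g, IsSmooth (c' g))
    (h : delta₁ c + delta₂ c' = 0) (g : Fin (p + 2) → G) : IsClosedForm (delta₁ c' g) := by
  refine ⟨isSmooth_delta₁ hc' g, ?_⟩
  have h1 : (fun g => d (c' g)) = (-1 : ℤ) ^ p • delta₁ c := by
    have h2 : delta₁ c = -((-1 : ℤ) ^ (p + 1) • fun g => d (c' g)) := eq_neg_of_add_eq_zero_left h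
    funext g
    have h4 : delta₁ c g = -((-1 : ℤ) ^ (p + 1) • d (c' g)) := congrFun h2 g
    rw [Pi.smul_apply, h4, pow_succ, mul_neg_one, neg_smul, neg_neg, smul_smul, ← pow_add,
      Even.neg_one_pow ⟨p, rfl⟩, one_smul]
  have h3 := congrFun (d_delta₁ hc') g
  rw [h1, delta₁_zsmul, delta₁_delta₁, smul_zero] at h3
  exact h3

variable {p r : ℕ} {Θ : Form I X (p + r + 1)}

lemma IsDescent.isClosedForm_delta₁ {φ : ∀ i q : ℕ, (Fin i → G) → Form I X q}
    (hφ : IsDescent G p r Θ φ) (hinv : ∀ g ∈ G, pullback I I g Θ = Θ) :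
    ∀ {i q : ℕ}, i + q = p + r → r ≤ q → ∀ g, IsClosedForm (delta₁ (φ i q) g)
  | 0, q, h, _, g => by
    obtain rfl : q = p + r := by omega
    exact isClosedForm_delta₁_of_const (hφ.smooth 0 _) hφ.start hinv g
  | i + 1, q, h, hq, g =>
    isClosedForm_delta₁_of_step (hφ.smooth (i + 1) q) (hφ.step i q (by omega) hq) g

/-! ### Existence and uniqueness of descents from a choice of primitives -/

section Homotopy

/-- The descent cochains constructed from a primitive operator `K`. -/
def descentCochain (G : Subgroup (X ≃ₘ⟮I, I⟯ X)) (K : ∀ q, Form I X (q + 1) → Form I X q)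
    (Θ : ∀ q, Form I X q) : ∀ i q : ℕ, (Fin i → G) → Form I X q
  | 0, q => fun _ => -K q (Θ (q + 1))
  | i + 1, q => fun g => (-1 : ℤ) ^ i • K q (delta₁ (descentCochain G K Θ i (q + 1)) g)

variable {K : ∀ q, Form I X (q + 1) → Form I X q}
  (hKs : ∀ q η, IsSmooth η → IsSmooth (K q η))
  (hK : ∀ q η, r ≤ q → IsClosedForm η → d (K q η) = η)

include hKs in
lemma isSmooth_descentCochain {Θ : ∀ q, Form I X q} (hΘ : ∀ q, IsSmooth (Θ q)) :
    ∀ i q g, IsSmooth (descentCochain G K Θ i q g)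
  | 0, q, _ => (hKs q _ (hΘ (q + 1))).neg
  | i + 1, q, g =>
    (hKs q _ (isSmooth_delta₁ (isSmooth_descentCochain hΘ i (q + 1)) g)).zsmul _

include hKs hK in
-- Closedness of `δ'φ_i` and the descent equation for `φ_{i+1}` are obtained alternately: the former
-- allows `K` to be applied, the latter makes `δ'φ_{i+1}` closed. Linearity of `K` is not needed.
lemma isDescent_descentCochain (hΘ : IsClosedForm Θ) (hinv : ∀ g ∈ G, pullback I I g Θ = Θ) :
    IsDescent G p r Θ (descentCochain G K (Function.update 0 (p + r + 1) Θ)) := by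
  -- A family with `Θ` in its own degree and zero elsewhere, so that the recursion can run over all
  -- bidegrees without transporting forms along equalities of degrees.
  set Θf : ∀ q, Form I X q := Function.update 0 (p + r + 1) Θ with hΘf
  have hΘs : ∀ q, IsSmooth (Θf q) := by
    intro q
    by_cases h : q = p + r + 1
    · subst h
      rw [hΘf, Function.update_self]
      exact hΘ.1
    · rw [hΘf, Function.update_of_ne h]
      exact isSmooth_zero
  have hs := isSmooth_descentCochain (G := G) hKs hΘs
  have hstart : ∀ g, Θ = -d (descentCochain G K Θf 0 (p + r) g) := by
    intro g
    rw [descentCochain, hΘf, Function.update_self, d_neg, neg_neg, hK _ _ (by omega) hΘ]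
  have hstep : ∀ i q, r ≤ q → (∀ g, IsClosedForm (delta₁ (descentCochain G K Θf i (q + 1)) g)) →
      delta₁ (descentCochain G K Θf i (q + 1)) + delta₂ (descentCochain G K Θf (i + 1) q) = 0 := by
    intro i q hq hcl
    funext g
    simp only [Pi.add_apply, delta₂, descentCochain]
    rw [d_zsmul, hK _ _ hq (hcl g), smul_smul, pow_succ, mul_comm, ← mul_assoc, ← pow_add,
      Even.neg_one_pow ⟨i, rfl⟩, one_mul, neg_one_zsmul]
    exact add_neg_cancel _
  have hcl : ∀ i q, i + q = p + r → r ≤ q →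
      ∀ g, IsClosedForm (delta₁ (descentCochain G K Θf i q) g) := by
    intro i
    induction i with
    | zero =>
      intro q h _ g
      obtain rfl : q = p + r := by omega
      exact isClosedForm_delta₁_of_const (hs 0 _) hstart hinv g
    | succ i ih =>
      intro q h hq g
      exact isClosedForm_delta₁_of_step (hs (i + 1) q)
        (hstep i q hq (ih (q + 1) (by omega) (by omega))) g
  exact ⟨hs, hstart, fun i q h hq => hstep i q hq (hcl i (q + 1) (by omega) (by omega))⟩

include hKs hK in
-- The difference of two descents is corrected step by step to a closed cochain without changing its
-- `δ'`. In arity zero no correction is needed, since both cochains are primitives of `-Θ`.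
lemma IsDescent.exists_closed_delta₁_eq {φ ψ : ∀ i q : ℕ, (Fin i → G) → Form I X q}
    (hφ : IsDescent G p r Θ φ) (hψ : IsDescent G p r Θ ψ) :
    ∀ i q, i + q = p + r → r ≤ q → ∃ B : (Fin i → G) → Form I X q,
      (∀ g, IsClosedForm (B g)) ∧ delta₁ B = delta₁ (φ i q - ψ i q) := by
  intro i
  induction i with
  | zero =>
    intro q h _
    obtain rfl : q = p + r := by omega
    refine ⟨φ 0 (p + r) - ψ 0 (p + r), fun g => ⟨(hφ.smooth _ _ g).sub (hψ.smooth _ _ g), ?_⟩, rfl⟩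
    rw [Pi.sub_apply, d_sub (hφ.smooth _ _ g) (hψ.smooth _ _ g), ← neg_eq_iff_eq_neg.2 (hφ.start g),
      ← neg_eq_iff_eq_neg.2 (hψ.start g), sub_self]
  | succ i ih =>
    intro q h hq
    obtain ⟨B, hB, hBd⟩ := ih (q + 1) (by omega) (by omega)
    have hχ : ∀ g, IsSmooth (K q (B g)) := fun g => hKs q _ (hB g).1
    have hχs := isSmooth_delta₁ hχ
    -- The descent equations give `d(φ_{i+1} - ψ_{i+1}) = -(-1)^(i+1) δ'(φ_i - ψ_i) = -(-1)^(i+1)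
    -- δ'B`. Adding `(-1)^(i+1) δ'KB` cancels this and is invisible to `δ'`.
    refine ⟨φ (i + 1) q - ψ (i + 1) q + (-1 : ℤ) ^ (i + 1) • delta₁ fun g => K q (B g),
      fun g => ⟨((hφ.smooth _ _ g).sub (hψ.smooth _ _ g)).add ((hχs g).zsmul _), ?_⟩, ?_⟩
    · have h1 := congrFun (hφ.step i q (by omega) hq) g
      have h2 := congrFun (hψ.step i q (by omega) hq) g
      have h3 := congrFun (d_delta₁ hχ) g
      simp only [hK q _ hq (hB _)] at h3
      have h4 : delta₁ B g = delta₁ (φ i (q + 1)) g - delta₁ (ψ i (q + 1)) g := by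
        rw [hBd, delta₁_sub]; rfl
      simp only [Pi.add_apply, delta₂, Pi.zero_apply] at h1 h2
      rw [Pi.add_apply, Pi.sub_apply, Pi.smul_apply,
        d_add ((hφ.smooth _ _ g).sub (hψ.smooth _ _ g)) ((hχs g).zsmul _),
        d_sub (hφ.smooth _ _ g) (hψ.smooth _ _ g), d_zsmul, h3, h4,
        eq_neg_of_add_eq_zero_left h1, eq_neg_of_add_eq_zero_left h2]
      have h5 : ((-1 : ℤ) ^ (i + 1)) * (-1) ^ (i + 1) = 1 := by
        rw [← mul_pow]; simp
      simp only [smul_sub, smul_neg, smul_smul, h5, one_smul]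
      abel
    · rw [delta₁_add, delta₁_zsmul, delta₁_delta₁, smul_zero, add_zero]

end Homotopy

/-! ### Passing from forms to periods -/

section Period

variable {α : Form I X r → ℝ} (hαa : ∀ θ η, IsSmooth θ → IsSmooth η → α (θ + η) = α θ + α η)
  (hαs : ∀ (c : ℝ) θ, α (c • θ) = c * α θ)

include hαa hαs in
-- On closed forms the functional `α` intertwines pullback with the trivial action, so it is a
-- cochain map there; closedness of the values of `B` is essential for the last face.
lemma alpha_delta₁_of_closed (hG : ∀ g ∈ G, FixesClass α g) {p : ℕ}
    {B : (Fin p → G) → Form I X r} (hB : ∀ g, IsClosedForm (B g)) :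
    (fun g => α (delta₁ B g)) = trivD fun g => α (B g) := by
  have hz : ∀ (n : ℤ) θ, α (n • θ) = n • α θ := fun n θ => by
    rw [zsmul_eq_smul, hαs, zsmul_eq_mul]
  have hα0 : α 0 = 0 := by simpa using hαs 0 0
  have hsum : ∀ {ι : Type} (s : Finset ι) (θ : ι → Form I X r), (∀ i, IsSmooth (θ i)) →
      α (∑ i ∈ s, θ i) = ∑ i ∈ s, α (θ i) := by
    classical
    intro ι s θ hθ
    induction s using Finset.induction_on with
    | empty => simpa using hα0
    | insert a s ha ih =>
      rw [Finset.sum_insert ha, Finset.sum_insert ha, hαa _ _ (hθ a) (IsSmooth.sum s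
        fun i _ => hθ i), ih]
  funext g
  have h1 : ∀ i : Fin p, IsSmooth
      ((-1 : ℤ) ^ ((i : ℕ) + 1) • B (Fin.contractNth i.castSucc (· * ·) g)) :=
    fun i => (hB _).1.zsmul _
  have h2 := isSmooth_pullback (f := (g (Fin.last p) : X ≃ₘ⟮I, I⟯ X)) (Diffeomorph.contMDiff _)
    (hB fun i => g i.castSucc).1
  simp only [delta₁, trivD, cochainD]
  rw [hαa _ _ ((hB _).1.add (IsSmooth.sum _ fun i _ => h1 i)) (h2.zsmul _),
    hαa _ _ (hB _).1 (IsSmooth.sum _ fun i _ => h1 i), hsum _ _ h1, hz,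
    hG _ (g (Fin.last p)).2 _ (hB _)]
  simp only [hz]

include hαa hαs in
lemma IsDescent.trivD_periodCochain {φ : ∀ i q : ℕ, (Fin i → G) → Form I X q}
    (hφ : IsDescent G p r Θ φ) (hinv : ∀ g ∈ G, pullback I I g Θ = Θ)
    (hG : ∀ g ∈ G, FixesClass α g) : trivD (periodCochain p r α φ) = 0 := by
  have h := alpha_delta₁_of_closed hαa hαs hG (hφ.isClosedForm_delta₁ hinv rfl le_rfl)
  rw [delta₁_delta₁] at h
  refine h.symm.trans ?_
  funext g
  simpa using hαs 0 0

include hαa hαs in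
-- With `B` closed and `δ'B = δ'(φ_p - ψ_p)`, the difference of the periods is `α(δ'B)`, the
-- coboundary of `α ∘ B`.
lemma IsDescent.exists_period_sub_eq {K : ∀ q, Form I X (q + 1) → Form I X q}
    (hKs : ∀ q η, IsSmooth η → IsSmooth (K q η))
    (hK : ∀ q η, r ≤ q → IsClosedForm η → d (K q η) = η)
    {φ ψ : ∀ i q : ℕ, (Fin i → G) → Form I X q}
    (hφ : IsDescent G p r Θ φ) (hψ : IsDescent G p r Θ ψ)
    (hG : ∀ g ∈ G, FixesClass α g) :
    ∃ b : (Fin p → G) → ℝ, periodCochain p r α φ - periodCochain p r α ψ = trivD b := by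
  obtain ⟨B, hB, hBd⟩ := hφ.exists_closed_delta₁_eq hKs hK hψ p r rfl le_rfl
  refine ⟨fun g => α (B g), ?_⟩
  rw [← alpha_delta₁_of_closed hαa hαs hG hB]
  funext g
  have h1 := isSmooth_delta₁ (hφ.smooth p r) g
  have h2 := isSmooth_delta₁ (hψ.smooth p r) g
  have h3 : α (delta₁ (φ p r) g - delta₁ (ψ p r) g) =
      α (delta₁ (φ p r) g) - α (delta₁ (ψ p r) g) := by
    rw [sub_eq_add_neg, hαa _ _ h1 h2.neg, neg_eq_smul (delta₁ (ψ p r) g), hαs]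
    ring
  rw [hBd, delta₁_sub]
  exact h3.symm

end Period

end Descent

/-! ### Smooth dependence of integrals on parameters -/

section ParametricIntegral

variable {E : Type} [NormedAddCommGroup E] [NormedSpace ℝ E]

/-- Differentiation under the integral sign; the derivative is bounded on the compact product of
`[0, 1]` with a closed ball. -/
lemma hasFDerivAt_parametric_integral [ProperSpace E] {F : Type*} [NormedAddCommGroup F]
    [NormedSpace ℝ F]
    {U : Set E} (hU : IsOpen U) {f : ℝ × E → F} (hf : ContDiffOn ℝ ∞ f (Set.univ ×ˢ U)) {z : E}
    (hz : z ∈ U) : HasFDerivAt (fun z => ∫ t in (0 : ℝ)..1, f (t, z))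
      (∫ t in (0 : ℝ)..1, (fderiv ℝ f (t, z)).comp (ContinuousLinearMap.inr ℝ ℝ E)) z := by
  have hO : IsOpen ((Set.univ : Set ℝ) ×ˢ U) := isOpen_univ.prod hU
  have hf' : ContinuousOn (fun s : ℝ × E => (fderiv ℝ f s).comp (ContinuousLinearMap.inr ℝ ℝ E))
      (Set.univ ×ˢ U) :=
    ((hf.continuousOn_fderiv_of_isOpen hO (by simp)).clm_comp continuousOn_const)
  obtain ⟨ε, hε, hball⟩ := Metric.nhds_basis_closedBall.mem_iff.1 (hU.mem_nhds hz)
  have hcomp : IsCompact (Set.Icc (0 : ℝ) 1 ×ˢ Metric.closedBall z ε) :=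
    isCompact_Icc.prod (isCompact_closedBall z ε)
  obtain ⟨C, hC⟩ := hcomp.exists_bound_of_continuousOn
    (hf'.mono (Set.prod_mono (Set.subset_univ _) hball))
  have hline : ∀ z ∈ U, Continuous fun t : ℝ => f (t, z) := fun z hz =>
    hf.continuousOn.comp_continuous (by fun_prop) fun t => ⟨trivial, hz⟩
  have hline' : Continuous fun t : ℝ =>
      (fderiv ℝ f (t, z)).comp (ContinuousLinearMap.inr ℝ ℝ E) :=
    hf'.comp_continuous (f := fun t : ℝ => (t, z)) (by fun_prop) fun t => ⟨trivial, hz⟩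
  refine intervalIntegral.hasFDerivAt_integral_of_dominated_of_fderiv_le
    (F' := fun z t => (fderiv ℝ f (t, z)).comp (ContinuousLinearMap.inr ℝ ℝ E))
    (bound := fun _ => C) (Metric.closedBall_mem_nhds z hε) ?_ ?_ ?_ ?_ ?_ ?_
  · filter_upwards [hU.mem_nhds hz] with x hx
    exact (hline x hx).aestronglyMeasurable
  · exact (hline z hz).intervalIntegrable _ _
  · exact hline'.aestronglyMeasurable
  · refine Filter.Eventually.of_forall fun t ht x hx => hC (t, x) ⟨?_, hx⟩
    rw [Set.uIoc_of_le zero_le_one] at ht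
    exact ⟨ht.1.le, ht.2⟩
  · exact intervalIntegrable_const
  · refine Filter.Eventually.of_forall fun t _ x hx => ?_
    have h1 : HasFDerivAt f (fderiv ℝ f (t, x)) (t, x) :=
      ((hf.contDiffAt (hO.mem_nhds ⟨trivial, hball hx⟩)).differentiableAt (by simp)).hasFDerivAt
    exact h1.comp x (hasFDerivAt_prodMk_right t x)

/-- Induction on the order: the derivative is an integral of the same kind with values in `E →L[ℝ]
F`. The target is therefore generalized, and `E` and `F` share a universe. -/
lemma contDiffOn_parametric_integral [ProperSpace E] {F : Type} [NormedAddCommGroup F]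
    [NormedSpace ℝ F]
    {U : Set E} (hU : IsOpen U) {f : ℝ × E → F} (hf : ContDiffOn ℝ ∞ f (Set.univ ×ˢ U)) :
    ContDiffOn ℝ ∞ (fun z => ∫ t in (0 : ℝ)..1, f (t, z)) U := by
  have hO : IsOpen ((Set.univ : Set ℝ) ×ˢ U) := isOpen_univ.prod hU
  refine contDiffOn_infty.2 fun n => ?_
  induction n generalizing F with
  | zero =>
    rw [Nat.cast_zero, contDiffOn_zero]
    exact fun z hz => (hasFDerivAt_parametric_integral hU hf hz).continuousAt.continuousWithinAt
  | succ n ih =>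
    rw [Nat.cast_succ, contDiffOn_succ_iff_fderiv_of_isOpen hU]
    refine ⟨fun z hz => (hasFDerivAt_parametric_integral hU
      hf hz).differentiableAt.differentiableWithinAt, by simp, ?_⟩
    have h1 : ContDiffOn ℝ ∞ (fun s : ℝ × E => (fderiv ℝ f s).comp
        (ContinuousLinearMap.inr ℝ ℝ E)) (Set.univ ×ˢ U) :=
      (hf.fderiv_of_isOpen hO (by simp)).clm_comp contDiffOn_const
    exact (ih h1).congr fun z hz => (hasFDerivAt_parametric_integral hU hf hz).fderiv

lemma clm_integral_comm {F F' : Type*} [NormedAddCommGroup F] [NormedSpace ℝ F]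
    [CompleteSpace F] [NormedAddCommGroup F'] [NormedSpace ℝ F'] [CompleteSpace F']
    (L : F →L[ℝ] F') {f : ℝ → F} (hf : Continuous f) :
    L (∫ t in (0 : ℝ)..1, f t) = ∫ t in (0 : ℝ)..1, L (f t) :=
  (L.intervalIntegral_comp_comm (hf.intervalIntegrable 0 1)).symm

end ParametricIntegral

/-! ### The homotopy formula on `V × U` -/

section Poincare

variable {V W : Type} [NormedAddCommGroup V] [NormedSpace ℝ V] [NormedAddCommGroup W]
  [NormedSpace ℝ W] {q : ℕ}

variable (V W) in
/-- The linear map `(x, y) ↦ (tx, y)`. -/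
def scaleFst (t : ℝ) : V × W →L[ℝ] V × W :=
  (t • ContinuousLinearMap.fst ℝ V W).prod (ContinuousLinearMap.snd ℝ V W)

lemma scaleFst_apply (t : ℝ) (z : V × W) : scaleFst V W t z = (t • z.1, z.2) := rfl

lemma scaleFst_one : scaleFst V W 1 = ContinuousLinearMap.id ℝ (V × W) := by
  ext z <;> simp [scaleFst_apply]

/-- The integrand of the homotopy operator for the contraction `(x, y) ↦ (tx, y)`. -/
def homotopyIntegrand (θ : V × W → (V × W) [⋀^Fin (q + 1)]→L[ℝ] ℝ) (t : ℝ) (z : V × W) :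
    (V × W) [⋀^Fin q]→L[ℝ] ℝ :=
  ((θ (t • z.1, z.2)).curryLeft (z.1, 0)).compContinuousLinearMap (scaleFst V W t)

variable (V W) in
/-- The contraction, as a function of all its arguments. -/
def contraction (s : ℝ × (V × W)) : V × W := (s.1 • s.2.1, s.2.2)

lemma contDiff_contraction : ContDiff ℝ ∞ (contraction V W) := by
  unfold contraction
  fun_prop

lemma fderiv_contraction (t : ℝ) (z : V × W) (s : ℝ × (V × W)) :
    fderiv ℝ (contraction V W) (t, z) s = (s.1 • z.1 + t • s.2.1, s.2.2) := by
  have h1 : HasFDerivAt (fun s : ℝ × (V × W) => s.1 • s.2.1) _ (t, z) :=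
    HasFDerivAt.fun_smul (hasFDerivAt_fst (𝕜 := ℝ))
      ((hasFDerivAt_fst (𝕜 := ℝ)).comp (t, z) (hasFDerivAt_snd (𝕜 := ℝ)))
  have h2 : HasFDerivAt (fun s : ℝ × (V × W) => s.2.2) _ (t, z) :=
    (hasFDerivAt_snd (𝕜 := ℝ)).comp (t, z) (hasFDerivAt_snd (𝕜 := ℝ))
  rw [show contraction V W = fun s => (s.1 • s.2.1, s.2.2) from rfl, (h1.prodMk h2).fderiv]
  simp [add_comm]

/-- The pullback of `θ` under the contraction. -/
def contractionPullback (θ : V × W → (V × W) [⋀^Fin q]→L[ℝ] ℝ) (s : ℝ × (V × W)) :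
    (ℝ × (V × W)) [⋀^Fin q]→L[ℝ] ℝ :=
  (θ (contraction V W s)).compContinuousLinearMap (fderiv ℝ (contraction V W) s)

variable {U : Set W}

lemma contDiffOn_contractionPullback {θ : V × W → (V × W) [⋀^Fin q]→L[ℝ] ℝ}
    (hθ : ContDiffOn ℝ ∞ θ (Set.univ ×ˢ U)) :
    ContDiffOn ℝ ∞ (contractionPullback θ) (Set.univ ×ˢ (Set.univ ×ˢ U)) := by
  have h1 : ContDiffOn ℝ ∞ (fun s => θ (contraction V W s)) (Set.univ ×ˢ (Set.univ ×ˢ U)) :=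
    hθ.comp contDiff_contraction.contDiffOn fun s hs => ⟨trivial, hs.2.2⟩
  have h2 : ContDiff ℝ ∞ (fderiv ℝ (contraction V W)) :=
    contDiff_contraction.fderiv_right (m := ∞) (by simp)
  exact (contDiff_compCLM q).comp_contDiffOn (h1.prodMk h2.contDiffOn)

/-- Restriction to a slice `t × V × W` after contraction with `∂/∂t`. -/
def timeContraction (V W : Type) [NormedAddCommGroup V] [NormedSpace ℝ V] [NormedAddCommGroup W]
    [NormedSpace ℝ W] (q : ℕ) :
    ((ℝ × (V × W)) [⋀^Fin (q + 1)]→L[ℝ] ℝ) →L[ℝ] (V × W) [⋀^Fin q]→L[ℝ] ℝ :=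
  (ContinuousAlternatingMap.compContinuousLinearMapCLM
    (ContinuousLinearMap.inr ℝ ℝ (V × W))).comp
  ((ContinuousLinearMap.apply ℝ ((ℝ × (V × W)) [⋀^Fin q]→L[ℝ] ℝ) ((1, 0) : ℝ × (V × W))).comp
    (ContinuousAlternatingMap.curryLeftLI (𝕜 := ℝ) (E := ℝ × (V × W)) (F := ℝ)
      (n := q)).toContinuousLinearMap)

lemma timeContraction_apply (η : (ℝ × (V × W)) [⋀^Fin (q + 1)]→L[ℝ] ℝ) (u : Fin q → V × W) :
    timeContraction V W q η u = η (Fin.cons (1, 0) fun i => (0, u i)) := rfl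

/-- The integrand is `ι_{∂/∂t}` of the pullback under `(t, x, y) ↦ (tx, y)`, restricted to a time
slice; smoothness and the Cartan formula are read off on `ℝ × (V × W)`. -/
lemma homotopyIntegrand_eq (θ : V × W → (V × W) [⋀^Fin (q + 1)]→L[ℝ] ℝ) (t : ℝ) (z : V × W) :
    homotopyIntegrand θ t z = timeContraction V W q (contractionPullback θ (t, z)) := by
  ext u
  rw [timeContraction_apply]
  refine congrArg (θ (t • z.1, z.2)) (funext fun i => ?_)
  refine Fin.cases ?_ (fun i => ?_) i
  · simp [fderiv_contraction]
  · simp [fderiv_contraction, scaleFst_apply]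

lemma compInr_contractionPullback (θ : V × W → (V × W) [⋀^Fin q]→L[ℝ] ℝ) (t : ℝ) (z : V × W) :
    (contractionPullback θ (t, z)).compContinuousLinearMap (ContinuousLinearMap.inr ℝ ℝ (V × W)) =
      (θ (t • z.1, z.2)).compContinuousLinearMap (scaleFst V W t) := by
  ext u
  refine congrArg (θ (t • z.1, z.2)) (funext fun i => ?_)
  simp [fderiv_contraction, scaleFst_apply]

lemma contDiffOn_homotopyIntegrand {θ : V × W → (V × W) [⋀^Fin (q + 1)]→L[ℝ] ℝ}
    (hθ : ContDiffOn ℝ ∞ θ (Set.univ ×ˢ U)) :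
    ContDiffOn ℝ ∞ (fun s : ℝ × (V × W) => homotopyIntegrand θ s.1 s.2)
      (Set.univ ×ˢ (Set.univ ×ˢ U)) := by
  simp only [homotopyIntegrand_eq]
  exact (timeContraction V W q).contDiff.comp_contDiffOn (contDiffOn_contractionPullback hθ)

lemma isOpen_cylinder {V W : Type} [TopologicalSpace V] [TopologicalSpace W] {U : Set W}
    (hU : IsOpen U) : IsOpen ((Set.univ : Set ℝ) ×ˢ ((Set.univ : Set V) ×ˢ U)) :=
  isOpen_univ.prod (isOpen_univ.prod hU)

variable (hU : IsOpen U)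

include hU

/-- The contracted form as a function of the time. -/
lemma hasDerivAt_contractionPullback {θ : V × W → (V × W) [⋀^Fin q]→L[ℝ] ℝ}
    (hθ : ContDiffOn ℝ ∞ θ (Set.univ ×ˢ U)) {z : V × W} (hz : z.2 ∈ U) (t : ℝ) :
    HasDerivAt (fun t : ℝ => (θ (t • z.1, z.2)).compContinuousLinearMap (scaleFst V W t))
      ((fderiv ℝ (contractionPullback θ) (t, z) (1, 0)).compContinuousLinearMap
        (ContinuousLinearMap.inr ℝ ℝ (V × W))) t := by
  have h1 : HasFDerivAt (contractionPullback θ) (fderiv ℝ (contractionPullback θ) (t, z)) (t, z) :=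
    (((contDiffOn_contractionPullback hθ).contDiffAt ((isOpen_cylinder hU).mem_nhds
      ⟨trivial, trivial, hz⟩)).differentiableAt (by simp)).hasFDerivAt
  have h2 : HasDerivAt (fun t : ℝ => (t, z)) ((1 : ℝ), (0 : V × W)) t :=
    (hasDerivAt_id t).prodMk (hasDerivAt_const t z)
  have h3 := (ContinuousAlternatingMap.compContinuousLinearMapCLM (ι := Fin q) (F := ℝ)
    (ContinuousLinearMap.inr ℝ ℝ (V × W))).hasFDerivAt.comp_hasDerivAt t
      (h1.comp_hasDerivAt t h2)
  refine h3.congr_of_eventuallyEq (Filter.Eventually.of_forall fun t => ?_)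
  exact (compInr_contractionPullback θ t z).symm

lemma extDeriv_contractionPullback {θ : V × W → (V × W) [⋀^Fin q]→L[ℝ] ℝ}
    (hθ : ContDiffOn ℝ ∞ θ (Set.univ ×ˢ U)) {z : V × W} (hz : z.2 ∈ U) (t : ℝ)
    (hd : extDeriv θ (t • z.1, z.2) = 0) : extDeriv (contractionPullback θ) (t, z) = 0 := by
  have h1 : DifferentiableAt ℝ θ (contraction V W (t, z)) :=
    (hθ.contDiffAt (x := contraction V W (t, z))
      ((isOpen_univ.prod hU).mem_nhds ⟨trivial, hz⟩)).differentiableAt (by simp)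
  have h2 := extDeriv_pullback h1 (contDiff_contraction (V := V) (W := W)).contDiffAt (by
      rw [minSmoothness_of_isRCLikeNormedField]
      exact WithTop.coe_le_coe.2 (le_top : (2 : ℕ∞) ≤ ⊤))
  refine h2.trans ?_
  rw [show contraction V W (t, z) = (t • z.1, z.2) from rfl, hd]
  rfl

/-- The Cartan formula for the contraction. -/
lemma extDeriv_homotopyIntegrand {θ : V × W → (V × W) [⋀^Fin (q + 1)]→L[ℝ] ℝ}
    (hθ : ContDiffOn ℝ ∞ θ (Set.univ ×ˢ U)) {z : V × W} (hz : z.2 ∈ U) (t : ℝ)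
    (hd : extDeriv θ (t • z.1, z.2) = 0) :
    (fderiv ℝ (contractionPullback θ) (t, z) (1, 0)).compContinuousLinearMap
      (ContinuousLinearMap.inr ℝ ℝ (V × W)) =
    ContinuousAlternatingMap.alternatizeUncurryFin
      ((fderiv ℝ (fun s : ℝ × (V × W) => homotopyIntegrand θ s.1 s.2) (t, z)).comp
        (ContinuousLinearMap.inr ℝ ℝ (V × W))) := by
  have hdiff : DifferentiableAt ℝ (contractionPullback θ) (t, z) :=
    ((contDiffOn_contractionPullback hθ).contDiffAt ((isOpen_cylinder hU).mem_nhds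
      ⟨trivial, trivial, hz⟩)).differentiableAt (by simp)
  have h1 : fderiv ℝ (fun s : ℝ × (V × W) => homotopyIntegrand θ s.1 s.2) (t, z) =
      (timeContraction V W q).comp (fderiv ℝ (contractionPullback θ) (t, z)) := by
    simp only [homotopyIntegrand_eq]
    exact ((timeContraction V W q).hasFDerivAt.comp (t, z) hdiff.hasFDerivAt).fderiv
  have h2 := extDeriv_contractionPullback hU hθ hz t hd
  ext u
  -- The pulled back form is closed; its differential is evaluated on `∂/∂t` followed by vectors
  -- tangent to the slice. The term of index zero is the time derivative, the others are minus the
  -- differential of the contraction.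
  have h3 := congrArg (fun A => A (Fin.cons ((1 : ℝ), (0 : V × W)) fun i => ((0 : ℝ), u i) :
    Fin (q + 2) → ℝ × (V × W))) h2
  simp only [extDeriv, ContinuousAlternatingMap.alternatizeUncurryFin_apply] at h3
  rw [Fin.sum_univ_succ] at h3
  rw [h1, ContinuousAlternatingMap.alternatizeUncurryFin_apply]
  simp only [Fin.val_zero, pow_zero, one_smul, Fin.cons_zero, Fin.cons_succ, Fin.val_succ,
    pow_succ, mul_neg_one, neg_smul, Finset.sum_neg_distrib,
    ContinuousAlternatingMap.coe_zero, Pi.zero_apply] at h3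
  rw [add_neg_eq_zero] at h3
  refine Eq.trans ?_ (h3.trans (Finset.sum_congr rfl fun i _ => ?_))
  · rfl
  · congr 1
    rw [ContinuousLinearMap.comp_apply, ContinuousLinearMap.comp_apply, timeContraction_apply]
    refine congrArg _ (funext fun j => ?_)
    refine Fin.cases ?_ (fun j => ?_) j
    · simp [Fin.removeNth]
    · simp [Fin.removeNth]

/-- Degree zero is separate, since there is no operator into degree `-1`: a closed function is
constant along the paths `t ↦ (tx, y)`. -/
lemma contraction_eq_of_closed_zero {θ : V × W → (V × W) [⋀^Fin 0]→L[ℝ] ℝ}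
    (hθ : ContDiffOn ℝ ∞ θ (Set.univ ×ˢ U)) {z : V × W} (hz : z.2 ∈ U)
    (hd : ∀ t : ℝ, extDeriv θ (t • z.1, z.2) = 0) :
    θ z = (θ (0, z.2)).compContinuousLinearMap (scaleFst V W 0) := by
  have h : ∀ t, HasDerivAt
      (fun t : ℝ => (θ (t • z.1, z.2)).compContinuousLinearMap (scaleFst V W t)) 0 t := by
    intro t
    have h1 := hasDerivAt_contractionPullback hU hθ hz t
    have h2 := extDeriv_contractionPullback hU hθ hz t (hd t)
    have h3 : (fderiv ℝ (contractionPullback θ) (t, z) (1, 0)).compContinuousLinearMap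
        (ContinuousLinearMap.inr ℝ ℝ (V × W)) = 0 := by
      ext u
      have h4 := congrArg (fun A => A (fun _ => ((1 : ℝ), (0 : V × W)))) h2
      simp only [extDeriv, ContinuousAlternatingMap.alternatizeUncurryFin_apply] at h4
      simp only [Nat.reduceAdd, Finset.univ_unique, Fin.default_eq_zero, Fin.isValue,
        Finset.sum_singleton, Fin.val_eq_zero, pow_zero, one_smul,
        ContinuousAlternatingMap.coe_zero, Pi.zero_apply] at h4
      refine Eq.trans ?_ h4
      exact congrArg (fun v => fderiv ℝ (contractionPullback θ) (t, z) (1, 0) v)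
        (Subsingleton.elim _ _)
    rwa [h3] at h1
  have h5 := is_const_of_deriv_eq_zero (fun t => (h t).differentiableAt) (fun t => (h t).deriv) 1 0
  simp only [one_smul, zero_smul, scaleFst_one] at h5
  exact h5

/-- The homotopy formula for closed forms. -/
lemma extDeriv_integral_homotopyIntegrand [ProperSpace V] [ProperSpace W]
    {θ : V × W → (V × W) [⋀^Fin (q + 1)]→L[ℝ] ℝ}
    (hθ : ContDiffOn ℝ ∞ θ (Set.univ ×ˢ U)) {z : V × W} (hz : z.2 ∈ U)
    (hd : ∀ t : ℝ, extDeriv θ (t • z.1, z.2) = 0) :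
    extDeriv (fun z => ∫ t in (0 : ℝ)..1, homotopyIntegrand θ t z) z =
      θ z - (θ (0, z.2)).compContinuousLinearMap (scaleFst V W 0) := by
  have hO := isOpen_cylinder (V := V) hU
  have hsm := contDiffOn_homotopyIntegrand hθ
  have h1 := hasFDerivAt_parametric_integral (isOpen_univ.prod hU) hsm
    (z := z) ⟨trivial, hz⟩
  have hcont : Continuous fun t : ℝ =>
      (fderiv ℝ (fun s : ℝ × (V × W) => homotopyIntegrand θ s.1 s.2) (t, z)).comp
        (ContinuousLinearMap.inr ℝ ℝ (V × W)) :=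
    ((hsm.continuousOn_fderiv_of_isOpen hO (by simp)).clm_comp continuousOn_const).comp_continuous
      (f := fun t : ℝ => (t, z)) (by fun_prop) fun t => ⟨trivial, trivial, hz⟩
  rw [extDeriv, h1.fderiv, ← ContinuousAlternatingMap.alternatizeUncurryFinCLM_apply]
  refine (clm_integral_comm (F := (V × W) →L[ℝ] ((V × W) [⋀^Fin q]→L[ℝ] ℝ))
    (F' := (V × W) [⋀^Fin (q + 1)]→L[ℝ] ℝ)
    (ContinuousAlternatingMap.alternatizeUncurryFinCLM ℝ (V × W) ℝ (n := q)) hcont).trans ?_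
  have h2 : ∀ t : ℝ, HasDerivAt
      (fun t : ℝ => (θ (t • z.1, z.2)).compContinuousLinearMap (scaleFst V W t))
      (ContinuousAlternatingMap.alternatizeUncurryFinCLM ℝ (V × W) ℝ
        ((fderiv ℝ (fun s : ℝ × (V × W) => homotopyIntegrand θ s.1 s.2) (t, z)).comp
          (ContinuousLinearMap.inr ℝ ℝ (V × W)))) t := by
    intro t
    have h3 := hasDerivAt_contractionPullback hU hθ hz t
    rwa [extDeriv_homotopyIntegrand hU hθ hz t (hd t)] at h3
  -- The integrand is a time derivative; the endpoint `1` gives `θ` and the endpoint `0` gives its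
  -- pullback to the slice.
  rw [intervalIntegral.integral_eq_sub_of_hasDerivAt (fun t _ => h2 t)
    (((ContinuousLinearMap.continuous _).comp hcont).intervalIntegrable _ _)]
  simp only [one_smul, zero_smul, scaleFst_one]
  rfl

end Poincare

/-! ### Charts and the homotopy operator on `ℝ^n × M` -/

section Cylinder

variable {n k : ℕ} {M : Type*} [TopologicalSpace M] [ChartedSpace (EuclideanSpace ℝ (Fin k)) M]

lemma extChartAt_cylinder_target (x₀ : EuclideanSpace ℝ (Fin n) × M) :
    (extChartAt ((𝓡 n).prod (𝓡 k)) x₀).target =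
      Set.univ ×ˢ (extChartAt (𝓡 k) x₀.2).target := by
  rw [extChartAt_prod, extChartAt_model_space_eq_id]
  rfl

lemma extChartAt_cylinder_symm (x₀ : EuclideanSpace ℝ (Fin n) × M)
    (z : EuclideanSpace ℝ (Fin n) × EuclideanSpace ℝ (Fin k)) :
    (extChartAt ((𝓡 n).prod (𝓡 k)) x₀).symm z = (z.1, (extChartAt (𝓡 k) x₀.2).symm z.2) := by
  rw [extChartAt_prod, extChartAt_model_space_eq_id]
  rfl

lemma extChartAt_cylinder_apply (x₀ x : EuclideanSpace ℝ (Fin n) × M) :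
    extChartAt ((𝓡 n).prod (𝓡 k)) x₀ x = (x.1, extChartAt (𝓡 k) x₀.2 x.2) := by
  rw [extChartAt_prod, extChartAt_model_space_eq_id]
  rfl

lemma extChartAt_cylinder_source (x₀ : EuclideanSpace ℝ (Fin n) × M) :
    (extChartAt ((𝓡 n).prod (𝓡 k)) x₀).source =
      Set.univ ×ˢ (extChartAt (𝓡 k) x₀.2).source := by
  rw [extChartAt_prod, extChartAt_model_space_eq_id]
  rfl

/-- The value of a form at a point, as an alternating form on the model space. -/
abbrev valueAt {E : Type*} [NormedAddCommGroup E] [NormedSpace ℝ E] {H : Type*}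
    [TopologicalSpace H] {X : Type*} [TopologicalSpace X] [ChartedSpace H X]
    {I : ModelWithCorners ℝ E H} {q : ℕ} (θ : Form I X q) (x : X) : E [⋀^Fin q]→L[ℝ] ℝ := θ x

/-- The projection onto the slice `0 × M`. -/
def sliceProj (n : ℕ) (M : Type*) (x : EuclideanSpace ℝ (Fin n) × M) :
    EuclideanSpace ℝ (Fin n) × M := (0, x.2)

lemma contMDiff_sliceProj :
    ContMDiff ((𝓡 n).prod (𝓡 k)) ((𝓡 n).prod (𝓡 k)) ∞ (sliceProj n M) :=
  contMDiff_const.prodMk contMDiff_snd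

lemma mfderiv_sliceProj (x : EuclideanSpace ℝ (Fin n) × M)
    (u : EuclideanSpace ℝ (Fin n) × EuclideanSpace ℝ (Fin k)) :
    (mfderiv ((𝓡 n).prod (𝓡 k)) ((𝓡 n).prod (𝓡 k)) (sliceProj n M) x u :
      EuclideanSpace ℝ (Fin n) × EuclideanSpace ℝ (Fin k)) = (0, u.2) := by
  have h := (hasMFDerivAt_const (I := (𝓡 n).prod (𝓡 k)) (I' := 𝓡 n)
    (0 : EuclideanSpace ℝ (Fin n)) x).prodMk (hasMFDerivAt_snd (I := 𝓡 n) (I' := 𝓡 k) x)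
  have h2 : HasMFDerivAt ((𝓡 n).prod (𝓡 k)) ((𝓡 n).prod (𝓡 k)) (sliceProj n M) x _ := h
  rw [h2.mfderiv]
  rfl

lemma IsSmooth.contDiffOn_cylinder {q : ℕ}
    {η : Form ((𝓡 n).prod (𝓡 k)) (EuclideanSpace ℝ (Fin n) × M) q} (hη : IsSmooth η)
    (x₀ : EuclideanSpace ℝ (Fin n) × M) :
    ContDiffOn ℝ ∞ (localRep η x₀) (Set.univ ×ˢ (extChartAt (𝓡 k) x₀.2).target) := by
  rw [← extChartAt_cylinder_target]
  exact hη x₀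

/-- The differential of the projection has rank at most `k`, so it makes any `q > k` vectors
linearly dependent. -/
lemma pullback_sliceProj_eq_zero {q : ℕ} (hq : k < q)
    (η : Form ((𝓡 n).prod (𝓡 k)) (EuclideanSpace ℝ (Fin n) × M) q) :
    pullback ((𝓡 n).prod (𝓡 k)) ((𝓡 n).prod (𝓡 k)) (sliceProj n M) η = 0 := by
  funext x
  ext u
  refine AlternatingMap.map_linearDependent (valueAt η (sliceProj n M x)).toAlternatingMap
    _ fun h => ?_
  have h1 : (fun i => (mfderiv ((𝓡 n).prod (𝓡 k)) ((𝓡 n).prod (𝓡 k)) (sliceProj n M) x (u i) :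
      EuclideanSpace ℝ (Fin n) × EuclideanSpace ℝ (Fin k))) =
      LinearMap.inr ℝ (EuclideanSpace ℝ (Fin n)) (EuclideanSpace ℝ (Fin k)) ∘ fun i => (u i).2 :=
    funext fun i => mfderiv_sliceProj x (u i)
  have h2 : LinearIndependent ℝ (LinearMap.inr ℝ (EuclideanSpace ℝ (Fin n))
    (EuclideanSpace ℝ (Fin k)) ∘ fun i => ((u i).2 : EuclideanSpace ℝ (Fin k))) := h1 ▸ h
  have h3 := (h2.of_comp).fintype_card_le_finrank
  rw [finrank_euclideanSpace, Fintype.card_fin, Fintype.card_fin] at h3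
  omega

variable [IsManifold (𝓡 k) ∞ M]

lemma mfderiv_extChartAt_cylinder_symm (x₀ : EuclideanSpace ℝ (Fin n) × M)
    {z : EuclideanSpace ℝ (Fin n) × EuclideanSpace ℝ (Fin k)}
    (hz : z.2 ∈ (extChartAt (𝓡 k) x₀.2).target)
    (u : EuclideanSpace ℝ (Fin n) × EuclideanSpace ℝ (Fin k)) :
    (mfderiv 𝓘(ℝ, EuclideanSpace ℝ (Fin n) × EuclideanSpace ℝ (Fin k)) ((𝓡 n).prod (𝓡 k))
      (extChartAt ((𝓡 n).prod (𝓡 k)) x₀).symm z u :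
      EuclideanSpace ℝ (Fin n) × EuclideanSpace ℝ (Fin k)) =
    (u.1, mfderiv 𝓘(ℝ, EuclideanSpace ℝ (Fin k)) (𝓡 k) (extChartAt (𝓡 k) x₀.2).symm z.2 u.2) := by
  have h1 : HasMFDerivAt 𝓘(ℝ, EuclideanSpace ℝ (Fin n) × EuclideanSpace ℝ (Fin k)) (𝓡 n)
      Prod.fst z (ContinuousLinearMap.fst ℝ (EuclideanSpace ℝ (Fin n))
        (EuclideanSpace ℝ (Fin k))) := hasFDerivAt_fst.hasMFDerivAt
  have h2 : HasMFDerivAt 𝓘(ℝ, EuclideanSpace ℝ (Fin n) × EuclideanSpace ℝ (Fin k)) (𝓡 k)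
      Prod.snd z (ContinuousLinearMap.snd ℝ (EuclideanSpace ℝ (Fin n))
        (EuclideanSpace ℝ (Fin k))) := hasFDerivAt_snd.hasMFDerivAt
  have h3 := (mdifferentiableAt_symm (I := 𝓡 k) x₀.2 hz).hasMFDerivAt.comp z h2
  have h4 := h1.prodMk h3
  have h5 : ⇑(extChartAt ((𝓡 n).prod (𝓡 k)) x₀).symm = fun z =>
      (z.1, ((extChartAt (𝓡 k) x₀.2).symm ∘ Prod.snd) z) :=
    funext fun z : EuclideanSpace ℝ (Fin n) × EuclideanSpace ℝ (Fin k) => extChartAt_cylinder_symm x₀ z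
  rw [← h5] at h4
  rw [h4.mfderiv]
  rfl

lemma mfderiv_extChartAt_cylinder (x₀ : EuclideanSpace ℝ (Fin n) × M)
    {x : EuclideanSpace ℝ (Fin n) × M} (hx : x.2 ∈ (extChartAt (𝓡 k) x₀.2).source)
    (u : EuclideanSpace ℝ (Fin n) × EuclideanSpace ℝ (Fin k)) :
    (mfderiv ((𝓡 n).prod (𝓡 k)) 𝓘(ℝ, EuclideanSpace ℝ (Fin n) × EuclideanSpace ℝ (Fin k))
      (extChartAt ((𝓡 n).prod (𝓡 k)) x₀) x u :
      EuclideanSpace ℝ (Fin n) × EuclideanSpace ℝ (Fin k)) =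
    (u.1, mfderiv (𝓡 k) 𝓘(ℝ, EuclideanSpace ℝ (Fin k)) (extChartAt (𝓡 k) x₀.2) x.2 u.2) := by
  have h1 := hasMFDerivAt_fst (I := 𝓡 n) (I' := 𝓡 k) x
  have h2 := (mdifferentiableAt_extChartAt (I := 𝓡 k) (x := x₀.2) (y := x.2)
    (by rwa [extChartAt_source] at hx)).hasMFDerivAt.comp x
      (hasMFDerivAt_snd (I := 𝓡 n) (I' := 𝓡 k) x)
  have h4 : HasMFDerivAt ((𝓡 n).prod (𝓡 k))
      𝓘(ℝ, EuclideanSpace ℝ (Fin n) × EuclideanSpace ℝ (Fin k))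
      (fun x => (x.1, (extChartAt (𝓡 k) x₀.2 ∘ Prod.snd) x)) x _ := ⟨h1.1.prodMk h2.1, h1.2.prodMk h2.2⟩
  have h5 : (extChartAt ((𝓡 n).prod (𝓡 k)) x₀ : EuclideanSpace ℝ (Fin n) × M → _) = fun x =>
      (x.1, (extChartAt (𝓡 k) x₀.2 ∘ Prod.snd) x) :=
    funext fun z => extChartAt_cylinder_apply x₀ z
  rw [← h5] at h4
  rw [h4.mfderiv]
  rfl

lemma localRep_cylinder_apply {q : ℕ}
    (η : Form ((𝓡 n).prod (𝓡 k)) (EuclideanSpace ℝ (Fin n) × M) q)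
    (x₀ : EuclideanSpace ℝ (Fin n) × M)
    {z : EuclideanSpace ℝ (Fin n) × EuclideanSpace ℝ (Fin k)}
    (hz : z.2 ∈ (extChartAt (𝓡 k) x₀.2).target)
    (u : Fin q → EuclideanSpace ℝ (Fin n) × EuclideanSpace ℝ (Fin k)) :
    localRep η x₀ z u = valueAt η (z.1, (extChartAt (𝓡 k) x₀.2).symm z.2) fun i =>
      ((u i).1, mfderiv 𝓘(ℝ, EuclideanSpace ℝ (Fin k)) (𝓡 k) (extChartAt (𝓡 k) x₀.2).symm z.2
        (u i).2) :=
  form_congr η (extChartAt_cylinder_symm x₀ z)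
    (funext fun i => mfderiv_extChartAt_cylinder_symm x₀ hz (u i))

/-- A smooth form depends smoothly on the first coordinate. -/
lemma IsSmooth.contDiff_fst {q : ℕ}
    {η : Form ((𝓡 n).prod (𝓡 k)) (EuclideanSpace ℝ (Fin n) × M) q} (hη : IsSmooth η) (y : M) :
    ContDiff ℝ ∞ fun a : EuclideanSpace ℝ (Fin n) => valueAt η (a, y) := by
  have hy : y ∈ (extChartAt (𝓡 k) y).source := mem_extChartAt_source y
  -- The chart is the identity in the first factor, so its derivative at `(a, y)` does not depend on
  -- `a` and can be taken at `a = 0`.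
  set A : EuclideanSpace ℝ (Fin n) × EuclideanSpace ℝ (Fin k) →L[ℝ]
      EuclideanSpace ℝ (Fin n) × EuclideanSpace ℝ (Fin k) :=
    mfderiv ((𝓡 n).prod (𝓡 k)) 𝓘(ℝ, EuclideanSpace ℝ (Fin n) × EuclideanSpace ℝ (Fin k))
      (extChartAt ((𝓡 n).prod (𝓡 k)) ((0 : EuclideanSpace ℝ (Fin n)), y)) (0, y)
  have h : (fun a : EuclideanSpace ℝ (Fin n) => valueAt η (a, y)) = fun a =>
      ContinuousAlternatingMap.compContinuousLinearMapCLM A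
        (localRep η ((0 : EuclideanSpace ℝ (Fin n)), y) (a, extChartAt (𝓡 k) y y)) := by
    funext a
    rw [valueAt, form_eq_localRep η (0, y) (x := (a, y)) (by rw [extChartAt_cylinder_source]; simp),
      extChartAt_cylinder_apply]
    ext u
    refine congrArg (localRep η ((0 : EuclideanSpace ℝ (Fin n)), y) (a, extChartAt (𝓡 k) y y))
      (funext fun i => ?_)
    exact (mfderiv_extChartAt_cylinder (0, y) (x := (a, y)) hy (u i)).trans
      (mfderiv_extChartAt_cylinder (0, y) (x := (0, y)) hy (u i)).symm
  rw [h]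
  refine (ContinuousLinearMap.contDiff
    (E := (EuclideanSpace ℝ (Fin n) × EuclideanSpace ℝ (Fin k)) [⋀^Fin q]→L[ℝ] ℝ)
    (F := (EuclideanSpace ℝ (Fin n) × EuclideanSpace ℝ (Fin k)) [⋀^Fin q]→L[ℝ] ℝ)
    (ContinuousAlternatingMap.compContinuousLinearMapCLM A)).comp (contDiffOn_univ.1 ?_)
  exact (hη.contDiffOn_cylinder (0, y)).comp (by fun_prop) fun a _ =>
    ⟨trivial, mem_extChartAt_target y⟩

/-- The homotopy operator for the contraction of `ℝ^n × M` to `0 × M`. -/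
def homotopyOp (q : ℕ) (η : Form ((𝓡 n).prod (𝓡 k)) (EuclideanSpace ℝ (Fin n) × M) (q + 1)) :
    Form ((𝓡 n).prod (𝓡 k)) (EuclideanSpace ℝ (Fin n) × M) q := fun x =>
  (∫ t in (0 : ℝ)..1, homotopyIntegrand (V := EuclideanSpace ℝ (Fin n))
    (W := EuclideanSpace ℝ (Fin k)) (fun z => valueAt η (z.1, x.2)) t (x.1, 0) :
    (EuclideanSpace ℝ (Fin n) × EuclideanSpace ℝ (Fin k)) [⋀^Fin q]→L[ℝ] ℝ)

variable {q : ℕ}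

lemma IsSmooth.continuous_homotopyIntegrand
    {η : Form ((𝓡 n).prod (𝓡 k)) (EuclideanSpace ℝ (Fin n) × M) (q + 1)} (hη : IsSmooth η)
    (a : EuclideanSpace ℝ (Fin n)) (y : M) :
    Continuous fun t : ℝ => homotopyIntegrand (V := EuclideanSpace ℝ (Fin n))
      (W := EuclideanSpace ℝ (Fin k)) (fun z => valueAt η (z.1, y)) t (a, 0) := by
  have h1 : ContDiffOn ℝ ∞ (fun z : EuclideanSpace ℝ (Fin n) × EuclideanSpace ℝ (Fin k) =>
      valueAt η (z.1, y))
      (Set.univ ×ˢ Set.univ) :=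
    ((hη.contDiff_fst y).comp _root_.contDiff_fst).contDiffOn
  exact (contDiffOn_homotopyIntegrand h1).continuousOn.comp_continuous
    (f := fun t : ℝ => (t, ((a, 0) : EuclideanSpace ℝ (Fin n) × EuclideanSpace ℝ (Fin k))))
    (by fun_prop) fun t => ⟨trivial, trivial, trivial⟩

/-- `homotopyOp` is defined without charts, by freezing the point `y` of `M`; the coordinate `0` in
its definition is a placeholder that the integrand ignores. Since the contraction acts only on the
first factor, the operator has the Euclidean form in every chart. -/
lemma localRep_homotopyOp
    {η : Form ((𝓡 n).prod (𝓡 k)) (EuclideanSpace ℝ (Fin n) × M) (q + 1)} (hη : IsSmooth η)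
    (x₀ : EuclideanSpace ℝ (Fin n) × M)
    {z : EuclideanSpace ℝ (Fin n) × EuclideanSpace ℝ (Fin k)}
    (hz : z.2 ∈ (extChartAt (𝓡 k) x₀.2).target) :
    localRep (homotopyOp q η) x₀ z = ∫ t in (0 : ℝ)..1, homotopyIntegrand (localRep η x₀) t z := by
  set A : EuclideanSpace ℝ (Fin n) × EuclideanSpace ℝ (Fin k) →L[ℝ]
      EuclideanSpace ℝ (Fin n) × EuclideanSpace ℝ (Fin k) :=
    mfderiv 𝓘(ℝ, EuclideanSpace ℝ (Fin n) × EuclideanSpace ℝ (Fin k)) ((𝓡 n).prod (𝓡 k))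
      (extChartAt ((𝓡 n).prod (𝓡 k)) x₀).symm z with hA
  set y := (extChartAt (𝓡 k) x₀.2).symm z.2 with hy
  have h1 : ∀ t : ℝ, homotopyIntegrand (localRep η x₀) t z =
      ContinuousAlternatingMap.compContinuousLinearMapCLM A
        (homotopyIntegrand (V := EuclideanSpace ℝ (Fin n))
          (W := EuclideanSpace ℝ (Fin k)) (fun z => valueAt η (z.1, y)) t (z.1, 0)) := by
    intro t
    ext u
    refine (localRep_cylinder_apply η x₀ (z := (t • z.1, z.2)) hz _).trans ?_
    refine congrArg (valueAt η (t • z.1, y)) (funext fun i => ?_)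
    refine Fin.cases ?_ (fun i => ?_) i
    · exact congrArg (Prod.mk z.1) (map_zero (mfderiv 𝓘(ℝ, EuclideanSpace ℝ (Fin k)) (𝓡 k)
        (extChartAt (𝓡 k) x₀.2).symm z.2))
    · exact congrArg (scaleFst (EuclideanSpace ℝ (Fin n)) (EuclideanSpace ℝ (Fin k)) t)
        (mfderiv_extChartAt_cylinder_symm x₀ hz (u i)).symm
  simp only [h1]
  have h2 := clm_integral_comm
    (F := (EuclideanSpace ℝ (Fin n) × EuclideanSpace ℝ (Fin k)) [⋀^Fin q]→L[ℝ] ℝ)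
    (F' := (EuclideanSpace ℝ (Fin n) × EuclideanSpace ℝ (Fin k)) [⋀^Fin q]→L[ℝ] ℝ)
    (ContinuousAlternatingMap.compContinuousLinearMapCLM A)
    (hη.continuous_homotopyIntegrand z.1 y)
  rw [← h2]
  have h3 : (homotopyOp q η ((extChartAt ((𝓡 n).prod (𝓡 k)) x₀).symm z) :
      (EuclideanSpace ℝ (Fin n) × EuclideanSpace ℝ (Fin k)) [⋀^Fin q]→L[ℝ] ℝ) =
      homotopyOp q η (z.1, y) := by
    rw [extChartAt_cylinder_symm]
  ext u
  exact congrArg (fun B : (EuclideanSpace ℝ (Fin n) × EuclideanSpace ℝ (Fin k))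
    [⋀^Fin q]→L[ℝ] ℝ => B (A ∘ u)) h3

lemma isSmooth_homotopyOp
    {η : Form ((𝓡 n).prod (𝓡 k)) (EuclideanSpace ℝ (Fin n) × M) (q + 1)} (hη : IsSmooth η) :
    IsSmooth (homotopyOp q η) := by
  intro x₀
  rw [extChartAt_cylinder_target]
  have hU := isOpen_extChartAt_target (I := 𝓡 k) x₀.2
  exact (contDiffOn_parametric_integral (isOpen_univ.prod hU)
    (contDiffOn_homotopyIntegrand (hη.contDiffOn_cylinder x₀))).congr
    fun z hz => localRep_homotopyOp hη x₀ hz.2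

lemma localRep_pullback_sliceProj
    (η : Form ((𝓡 n).prod (𝓡 k)) (EuclideanSpace ℝ (Fin n) × M) q)
    (x₀ : EuclideanSpace ℝ (Fin n) × M)
    {z : EuclideanSpace ℝ (Fin n) × EuclideanSpace ℝ (Fin k)}
    (hz : z.2 ∈ (extChartAt (𝓡 k) x₀.2).target) :
    localRep (pullback ((𝓡 n).prod (𝓡 k)) ((𝓡 n).prod (𝓡 k)) (sliceProj n M) η) x₀ z =
      (localRep η x₀ (0, z.2)).compContinuousLinearMap (scaleFst _ _ 0) := by
  ext u
  rw [localRep_cylinder_apply _ x₀ hz]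
  refine Eq.trans ?_ (localRep_cylinder_apply η x₀ (z := (0, z.2)) hz _).symm
  refine congrArg (valueAt η (0, (extChartAt (𝓡 k) x₀.2).symm z.2)) (funext fun i => ?_)
  refine (mfderiv_sliceProj _ _).trans ?_
  exact Prod.ext (zero_smul ℝ (u i).1).symm rfl

lemma IsClosedForm.extDeriv_localRep {E : Type*} [NormedAddCommGroup E] [NormedSpace ℝ E]
    {H : Type*} [TopologicalSpace H] {X : Type*} [TopologicalSpace X] [ChartedSpace H X]
    {I : ModelWithCorners ℝ E H} [I.Boundaryless] [IsManifold I ∞ X] {θ : Form I X q}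
    (hθ : IsClosedForm θ) (x₀ : X) {e : E} (he : e ∈ (extChartAt I x₀).target) :
    extDeriv (localRep θ x₀) e = 0 := by
  rw [← localRep_d hθ.1 x₀ he, hθ.2]
  rfl

/-- The homotopy formula on `ℝ^n × M`. -/
lemma d_homotopyOp
    {η : Form ((𝓡 n).prod (𝓡 k)) (EuclideanSpace ℝ (Fin n) × M) (q + 1)} (hη : IsClosedForm η) :
    d (homotopyOp q η) = η - pullback ((𝓡 n).prod (𝓡 k)) ((𝓡 n).prod (𝓡 k)) (sliceProj n M) η := by
  refine form_ext_localRep fun x => ?_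
  rw [localRep_d (isSmooth_homotopyOp hη.1) x (mem_extChartAt_target x), extChartAt_cylinder_apply]
  set z : EuclideanSpace ℝ (Fin n) × EuclideanSpace ℝ (Fin k) := (x.1, extChartAt (𝓡 k) x.2 x.2)
  have hU := isOpen_extChartAt_target (I := 𝓡 k) x.2
  have hz : z.2 ∈ (extChartAt (𝓡 k) x.2).target := mem_extChartAt_target x.2
  have h1 : localRep (homotopyOp q η) x =ᶠ[𝓝 z]
      fun z => ∫ t in (0 : ℝ)..1, homotopyIntegrand (localRep η x) t z := by
    filter_upwards [(isOpen_univ.prod hU).mem_nhds (show z ∈ Set.univ ×ˢ _ from ⟨trivial, hz⟩)]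
      with z' hz'
    exact localRep_homotopyOp hη.1 x hz'.2
  rw [h1.extDeriv_eq, extDeriv_integral_homotopyIntegrand hU (hη.1.contDiffOn_cylinder x) hz,
    ← localRep_pullback_sliceProj η x hz]
  · rfl
  · intro t
    exact hη.extDeriv_localRep x (by rw [extChartAt_cylinder_target]; exact ⟨trivial, hz⟩)

lemma pullback_sliceProj_of_closed_zero
    {η : Form ((𝓡 n).prod (𝓡 k)) (EuclideanSpace ℝ (Fin n) × M) 0} (hη : IsClosedForm η) :
    pullback ((𝓡 n).prod (𝓡 k)) ((𝓡 n).prod (𝓡 k)) (sliceProj n M) η = η := by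
  refine form_ext_localRep fun x => ?_
  rw [extChartAt_cylinder_apply]
  have hU := isOpen_extChartAt_target (I := 𝓡 k) x.2
  have hz : extChartAt (𝓡 k) x.2 x.2 ∈ (extChartAt (𝓡 k) x.2).target := mem_extChartAt_target x.2
  rw [localRep_pullback_sliceProj η x hz]
  refine (contraction_eq_of_closed_zero hU (hη.1.contDiffOn_cylinder x)
    (z := (x.1, extChartAt (𝓡 k) x.2 x.2)) hz fun t => ?_).symm
  exact hη.extDeriv_localRep x (by rw [extChartAt_cylinder_target]; exact ⟨trivial, hz⟩)

/-- A closed form differs from its pullback to `0 × M` by an exact form. -/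
lemma isExactForm_sub_pullback_sliceProj : ∀ {q : ℕ}
    {η : Form ((𝓡 n).prod (𝓡 k)) (EuclideanSpace ℝ (Fin n) × M) q}, IsClosedForm η →
    IsExactForm (η - pullback ((𝓡 n).prod (𝓡 k)) ((𝓡 n).prod (𝓡 k)) (sliceProj n M) η)
  | 0, _, hη => sub_eq_zero.2 (pullback_sliceProj_of_closed_zero hη).symm
  | q + 1, η, hη => ⟨homotopyOp q η, isSmooth_homotopyOp hη.1, (d_homotopyOp hη).symm⟩

lemma d_homotopyOp_of_lt (hq : k ≤ q)
    {η : Form ((𝓡 n).prod (𝓡 k)) (EuclideanSpace ℝ (Fin n) × M) (q + 1)} (hη : IsClosedForm η) :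
    d (homotopyOp q η) = η := by
  rw [d_homotopyOp hη, pullback_sliceProj_eq_zero (by omega), sub_zero]

lemma deRhamVanishes_cylinder (hq : k < q) :
    DeRhamVanishes ((𝓡 n).prod (𝓡 k)) (EuclideanSpace ℝ (Fin n) × M) q := by
  intro η hη
  have h := isExactForm_sub_pullback_sliceProj hη
  rwa [pullback_sliceProj_eq_zero hq, sub_zero] at h

end Cylinder

/-! ### Stokes' theorem on a compact oriented manifold -/

section LocalStokes

open MeasureTheory

/-- Integration by parts against the constant function `1`. -/
lemma integral_fderiv_eq_zero {E : Type*} [NormedAddCommGroup E] [NormedSpace ℝ E]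
    [MeasurableSpace E] [BorelSpace E] [FiniteDimensional ℝ E] (μ : Measure E)
    [μ.IsAddHaarMeasure] {h : E → ℝ} (hh : ContDiff ℝ ∞ h) (hc : HasCompactSupport h) (v : E) :
    ∫ e, fderiv ℝ h e v ∂μ = 0 := by
  have h1 : Continuous fun e => fderiv ℝ h e v := (hh.continuous_fderiv (by simp)).clm_apply
    continuous_const
  have h2 := integral_mul_fderiv_eq_neg_fderiv_mul_of_integrable (μ := μ) (f := fun _ : E => (1 : ℝ))
    (g := h) (v := v) (by simp)
    (by simpa using h1.integrable_of_hasCompactSupport (hc.fderiv_apply ℝ v))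
    (by simpa using hh.continuous.integrable_of_hasCompactSupport hc)
    (fun _ _ => differentiableAt_const _) (fun _ _ => hh.differentiable (by simp) _)
  simpa using h2

lemma integral_extDeriv_eq_zero {E : Type*} [NormedAddCommGroup E] [NormedSpace ℝ E]
    [MeasurableSpace E] [BorelSpace E] [FiniteDimensional ℝ E] (μ : Measure E)
    [μ.IsAddHaarMeasure] {q : ℕ} {g : E → E [⋀^Fin q]→L[ℝ] ℝ} (hg : ContDiff ℝ ∞ g)
    (hc : HasCompactSupport g) (v : Fin (q + 1) → E) : ∫ e, extDeriv g e v ∂μ = 0 := by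
  have h1 : ∀ u : Fin q → E, ContDiff ℝ ∞ fun e => g e u := fun u =>
    (ContinuousLinearMap.contDiff (ContinuousAlternatingMap.apply ℝ E ℝ u)).comp hg
  have h2 : ∀ u : Fin q → E, HasCompactSupport fun e => g e u := fun u =>
    hc.comp_left (g := fun A : E [⋀^Fin q]→L[ℝ] ℝ => A u) rfl
  simp only [extDeriv_apply (hg.differentiable (by simp) _)]
  rw [integral_finsetSum]
  · refine Finset.sum_eq_zero fun i _ => ?_
    simp only [zsmul_eq_mul]
    rw [integral_const_mul, integral_fderiv_eq_zero μ (h1 _) (h2 _), mul_zero]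
  · intro i _
    simp only [zsmul_eq_mul]
    refine Integrable.const_mul ?_ _
    exact (((h1 _).continuous_fderiv (by simp)).clm_apply
      continuous_const).integrable_of_hasCompactSupport ((h2 _).fderiv_apply ℝ _)

/-- The standard frame of `ℝ^k`. -/
def stdFrame (k : ℕ) : Fin k → EuclideanSpace ℝ (Fin k) := fun i => EuclideanSpace.single i (1 : ℝ)

/-- Top degree alternating forms are multiples of the determinant. -/
lemma map_comp_stdFrame {k : ℕ} (A : EuclideanSpace ℝ (Fin k) [⋀^Fin k]→ₗ[ℝ] ℝ)
    (L : EuclideanSpace ℝ (Fin k) →L[ℝ] EuclideanSpace ℝ (Fin k)) :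
    (A fun i => L (stdFrame k i)) = L.det * A (stdFrame k) := by
  set b := (EuclideanSpace.basisFun (Fin k) ℝ).toBasis with hb
  have hstd : stdFrame k = b := by
    funext i
    simp [hb, stdFrame]
  have h1 : ∀ v, A v = A b * b.det v := fun v =>
    congrArg (fun B : EuclideanSpace ℝ (Fin k) [⋀^Fin k]→ₗ[ℝ] ℝ => B v)
      (AlternatingMap.eq_smul_basis_det b A)
  rw [h1, hstd]
  have h2 := b.det_comp (L : EuclideanSpace ℝ (Fin k) →ₗ[ℝ] EuclideanSpace ℝ (Fin k)) b
  rw [b.det_self, mul_one] at h2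
  rw [mul_comm]
  congr 1

end LocalStokes

/-! ### Independence of the integral from charts -/

section Stokes

open MeasureTheory

variable {k : ℕ} {M : Type*} [TopologicalSpace M] [ChartedSpace (EuclideanSpace ℝ (Fin k)) M]

/-- Two expressions of a form of top degree, and the frame signs, in different charts. -/
lemma frameSign_eq [IsManifold (𝓡 k) ∞ M]
    (o : ∀ y : M, Orientation ℝ (TangentSpace (𝓡 k) y) (Fin k)) (y z : M)
    {e : EuclideanSpace ℝ (Fin k)} (he : e ∈ (extChartAt (𝓡 k) y).target)
    (hz : (extChartAt (𝓡 k) y).symm e ∈ (extChartAt (𝓡 k) z).source) :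
    frameSign o y e = (SignType.sign (fderiv ℝ (mapInCharts (𝓡 k) (𝓡 k) id y z) e).det : ℝ) *
      frameSign o z (mapInCharts (𝓡 k) (𝓡 k) id y z e) := by
  have hF := (contDiffAt_mapInCharts (contMDiff_id (I := 𝓡 k) (M := M)) y z he hz).differentiableAt
    (by simp)
  have h1 := (mdifferentiableAt_symm (I := 𝓡 k) y he).hasMFDerivAt
  have h2 := (mdifferentiableAt_symm (I := 𝓡 k) z
    ((extChartAt (𝓡 k) z).map_source hz)).hasMFDerivAt.comp e hF.hasFDerivAt.hasMFDerivAt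
  have hev : (extChartAt (𝓡 k) y).symm =ᶠ[𝓝 e]
      (extChartAt (𝓡 k) z).symm ∘ mapInCharts (𝓡 k) (𝓡 k) id y z := by
    filter_upwards [h1.1.preimage_mem_nhds ((isOpen_extChartAt_source z).mem_nhds hz)] with x hx
    exact ((extChartAt (𝓡 k) z).left_inv hx).symm
  have h3 := hasMFDerivAt_unique h1 (h2.congr_of_eventuallyEq hev)
  set ψ := mapInCharts (𝓡 k) (𝓡 k) (id : M → M) y z with hψ
  have hpt : (extChartAt (𝓡 k) z).symm (ψ e) = (extChartAt (𝓡 k) y).symm e :=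
    (extChartAt (𝓡 k) z).left_inv hz
  have hcongr : ∀ {x x' : M}, x = x' → ∀ v : Fin k → EuclideanSpace ℝ (Fin k),
      ((o x).someVector : EuclideanSpace ℝ (Fin k) [⋀^Fin k]→ₗ[ℝ] ℝ) v =
      ((o x').someVector : EuclideanSpace ℝ (Fin k) [⋀^Fin k]→ₗ[ℝ] ℝ) v := by
    rintro x _ rfl v
    rfl
  set L : EuclideanSpace ℝ (Fin k) →L[ℝ] EuclideanSpace ℝ (Fin k) :=
    mfderiv 𝓘(ℝ, EuclideanSpace ℝ (Fin k)) (𝓡 k) (extChartAt (𝓡 k) z).symm (ψ e) with hL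
  have h4 : frameSign o y e = SignType.sign
      ((((o ((extChartAt (𝓡 k) z).symm (ψ e))).someVector :
        EuclideanSpace ℝ (Fin k) [⋀^Fin k]→ₗ[ℝ] ℝ).compLinearMap
          (L : EuclideanSpace ℝ (Fin k) →ₗ[ℝ] EuclideanSpace ℝ (Fin k)))
          fun i => fderiv ℝ ψ e (stdFrame k i)) := by
    refine congrArg (fun x : ℝ => ((SignType.sign x : SignType) : ℝ)) ?_
    refine (hcongr hpt.symm _).trans ?_
    refine congrArg ((o ((extChartAt (𝓡 k) z).symm (ψ e))).someVector :
        EuclideanSpace ℝ (Fin k) [⋀^Fin k]→ₗ[ℝ] ℝ) (funext fun i => ?_)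
    exact congrArg (fun B : EuclideanSpace ℝ (Fin k) →L[ℝ] EuclideanSpace ℝ (Fin k) =>
      B (stdFrame k i)) h3
  -- The frames of the two charts differ by the derivative of the transition map, and the sign is
  -- multiplicative.
  rw [h4, map_comp_stdFrame, sign_mul]
  simp only [SignType.coe_mul]
  rfl

lemma localRep_stdFrame_eq [IsManifold (𝓡 k) ∞ M] (ζ : Form (𝓡 k) M k) (y z : M)
    {e : EuclideanSpace ℝ (Fin k)} (he : e ∈ (extChartAt (𝓡 k) y).target)
    (hz : (extChartAt (𝓡 k) y).symm e ∈ (extChartAt (𝓡 k) z).source) :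
    localRep ζ y e (stdFrame k) = (fderiv ℝ (mapInCharts (𝓡 k) (𝓡 k) id y z) e).det *
      localRep ζ z (mapInCharts (𝓡 k) (𝓡 k) id y z e) (stdFrame k) := by
  have h := localRep_map_pullback (contMDiff_id (I := 𝓡 k) (M := M)) ζ y z he hz
  rw [pullback_id] at h
  rw [h]
  exact map_comp_stdFrame (localRep ζ z (mapInCharts (𝓡 k) (𝓡 k) id y z e)).toAlternatingMap _

variable [T2Space M] [CompactSpace M] [IsManifold (𝓡 k) ∞ M]

lemma tsupport_chartPartition_subset (z : M) :
    tsupport (chartPartition k M z) ⊆ (extChartAt (𝓡 k) z).source := by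
  rw [extChartAt_source]
  exact (SmoothPartitionOfUnity.exists_isSubordinate_chartAt_source (𝓡 k) M).choose_spec z

variable (k M) in
lemma finite_chartPartition : {z : M | (Function.support (chartPartition k M z)).Nonempty}.Finite :=
  (chartPartition k M).locallyFinite.finite_nonempty_of_compact

variable (k M) in
/-- The finite set of indices of nonzero functions in the partition of unity. -/
def partitionIndex : Finset M := (finite_chartPartition k M).toFinset

lemma chartPartition_eq_zero {z : M} (hz : z ∉ partitionIndex k M) (x : M) :
    chartPartition k M z x = 0 := by
  by_contra h
  exact hz ((finite_chartPartition k M).mem_toFinset.2 ⟨x, h⟩)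

lemma sum_chartPartition (x : M) : ∑ z ∈ partitionIndex k M, chartPartition k M z x = 1 := by
  rw [← finsum_eq_sum_of_support_subset, (chartPartition k M).sum_eq_one (Set.mem_univ x)]
  intro z hz
  by_contra h
  exact hz (chartPartition_eq_zero h x)

variable (k) in
/-- The support of a partition function, in coordinates. -/
def chartSupport (z : M) : Set (EuclideanSpace ℝ (Fin k)) :=
  extChartAt (𝓡 k) z '' tsupport (chartPartition k M z)

lemma isCompact_chartSupport (z : M) : IsCompact (chartSupport k z) :=
  (isClosed_tsupport _).isCompact.image_of_continuousOn
    ((continuousOn_extChartAt z).mono (tsupport_chartPartition_subset z))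

lemma chartSupport_subset (z : M) : chartSupport k z ⊆ (extChartAt (𝓡 k) z).target := by
  rintro _ ⟨x, hx, rfl⟩
  exact (extChartAt (𝓡 k) z).map_source (tsupport_chartPartition_subset z hx)

lemma symm_notMem_tsupport {z : M} {e : EuclideanSpace ℝ (Fin k)}
    (he : e ∈ (extChartAt (𝓡 k) z).target) (h : e ∉ chartSupport k z) :
    (extChartAt (𝓡 k) z).symm e ∉ tsupport (chartPartition k M z) := fun h' =>
  h ⟨_, h', (extChartAt (𝓡 k) z).right_inv he⟩

/-- Continuity on the open target would not suffice; the support condition reduces integrability to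
a compact subset. -/
lemma integrableOn_target {z : M} {f : EuclideanSpace ℝ (Fin k) → ℝ}
    (hf : ContinuousOn f (extChartAt (𝓡 k) z).target)
    (h0 : ∀ e ∈ (extChartAt (𝓡 k) z).target, e ∉ chartSupport k z → f e = 0) :
    IntegrableOn f (extChartAt (𝓡 k) z).target :=
  ((hf.mono (chartSupport_subset z)).integrableOn_compact
    (isCompact_chartSupport z)).of_forall_sdiff_eq_zero
      (isOpen_extChartAt_target z).measurableSet fun e he => h0 e he.1 he.2

lemma contDiffOn_chartPartition (y z : M) :
    ContDiffOn ℝ ∞ (fun e => chartPartition k M y ((extChartAt (𝓡 k) z).symm e))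
      (extChartAt (𝓡 k) z).target :=
  ((chartPartition k M y).contMDiff.comp_contMDiffOn
    (contMDiffOn_extChartAt_symm (n := ∞) (I := 𝓡 k) z)).contDiffOn

variable {o : ∀ y : M, Orientation ℝ (TangentSpace (𝓡 k) y) (Fin k)}

lemma integral_eq_sum (η : Form (𝓡 k) M k) :
    integral o η = ∑ y ∈ partitionIndex k M, ∫ e in (extChartAt (𝓡 k) y).target,
      chartPartition k M y ((extChartAt (𝓡 k) y).symm e) *
        (frameSign o y e * localRep η y e (stdFrame k)) := by
  refine finsum_eq_sum_of_support_subset _ fun y hy => ?_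
  by_contra h
  refine hy ?_
  simp only [chartPartition_eq_zero h, zero_mul, integral_zero]

variable (ho : IsOrientation o)

include ho

lemma continuousOn_integrand {η : Form (𝓡 k) M k} (hη : IsSmooth η) (y z : M) :
    ContinuousOn (fun e => chartPartition k M y ((extChartAt (𝓡 k) z).symm e) *
        (frameSign o z e * localRep η z e (stdFrame k))) (extChartAt (𝓡 k) z).target :=
  (contDiffOn_chartPartition y z).continuousOn.mul ((ho z).mul
    (((ContinuousAlternatingMap.apply ℝ (EuclideanSpace ℝ (Fin k)) ℝ
      (stdFrame k)).continuous).comp_continuousOn (hη z).continuousOn))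

lemma integrableOn_integrand {η : Form (𝓡 k) M k} (hη : IsSmooth η) (y : M) :
    IntegrableOn (fun e => chartPartition k M y ((extChartAt (𝓡 k) y).symm e) *
        (frameSign o y e * localRep η y e (stdFrame k))) (extChartAt (𝓡 k) y).target :=
  integrableOn_target (continuousOn_integrand ho hη y y) fun e he h => by
    rw [image_eq_zero_of_notMem_tsupport (symm_notMem_tsupport he h), zero_mul]

lemma integral_add {η θ : Form (𝓡 k) M k} (hη : IsSmooth η) (hθ : IsSmooth θ) :
    integral o (η + θ) = integral o η + integral o θ := by
  rw [integral_eq_sum, integral_eq_sum, integral_eq_sum, ← Finset.sum_add_distrib]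
  refine Finset.sum_congr rfl fun y _ => ?_
  rw [← MeasureTheory.integral_add (integrableOn_integrand ho hη y)
    (integrableOn_integrand ho hθ y)]
  refine integral_congr_ae (Filter.Eventually.of_forall fun e => ?_)
  simp only [localRep_add, Pi.add_apply, ContinuousAlternatingMap.add_apply]
  ring

omit ho in
lemma integral_smul (c : ℝ) (η : Form (𝓡 k) M k) : integral o (c • η) = c * integral o η := by
  rw [integral_eq_sum, integral_eq_sum, Finset.mul_sum]
  refine Finset.sum_congr rfl fun y _ => ?_
  rw [← integral_const_mul]
  refine integral_congr_ae (Filter.Eventually.of_forall fun e => ?_)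
  simp only [localRep_smul, Pi.smul_apply, ContinuousAlternatingMap.smul_apply, smul_eq_mul]
  ring

omit ho in
lemma integral_zero_form : integral o (0 : Form (𝓡 k) M k) = 0 := by
  simpa using integral_smul (o := o) 0 (0 : Form (𝓡 k) M k)

lemma integral_sum {ι : Type*} (s : Finset ι) {η : ι → Form (𝓡 k) M k}
    (hη : ∀ i, IsSmooth (η i)) : integral o (∑ i ∈ s, η i) = ∑ i ∈ s, integral o (η i) := by
  classical
  induction s using Finset.induction_on with
  | empty => exact integral_zero_form
  | insert a s ha ih =>
    rw [Finset.sum_insert ha, Finset.sum_insert ha,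
      integral_add ho (hη a) (IsSmooth.sum s fun i _ => hη i), ih]

omit ho in
/-- The summands of the integral can be computed in another chart. -/
lemma integral_integrand_eq (ζ : Form (𝓡 k) M k) (y z : M)
    (hζ : ∀ x, x ∉ tsupport (chartPartition k M z) → ζ x = 0) :
    ∫ e in (extChartAt (𝓡 k) y).target, chartPartition k M y ((extChartAt (𝓡 k) y).symm e) *
        (frameSign o y e * localRep ζ y e (stdFrame k)) =
    ∫ e in (extChartAt (𝓡 k) z).target, chartPartition k M y ((extChartAt (𝓡 k) z).symm e) *
        (frameSign o z e * localRep ζ z e (stdFrame k)) := by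
  have hopen : ∀ y z : M, IsOpen ((extChartAt (𝓡 k) y).target ∩
      (extChartAt (𝓡 k) y).symm ⁻¹' (extChartAt (𝓡 k) z).source) := fun y z =>
    (continuousOn_extChartAt_symm y).isOpen_inter_preimage (isOpen_extChartAt_target y)
      (isOpen_extChartAt_source z)
  set A := (extChartAt (𝓡 k) y).target ∩
    (extChartAt (𝓡 k) y).symm ⁻¹' (extChartAt (𝓡 k) z).source with hA
  set B := (extChartAt (𝓡 k) z).target ∩
    (extChartAt (𝓡 k) z).symm ⁻¹' (extChartAt (𝓡 k) y).source with hB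
  set ψ := mapInCharts (𝓡 k) (𝓡 k) (id : M → M) y z with hψ
  have himage : ψ '' A = B := by
    ext e'
    constructor
    · rintro ⟨e, ⟨he, he'⟩, rfl⟩
      refine ⟨(extChartAt (𝓡 k) z).map_source he', ?_⟩
      change (extChartAt (𝓡 k) z).symm (extChartAt (𝓡 k) z ((extChartAt (𝓡 k) y).symm e)) ∈
        (extChartAt (𝓡 k) y).source
      rw [(extChartAt (𝓡 k) z).left_inv he']
      exact (extChartAt (𝓡 k) y).map_target he
    · rintro ⟨he, he'⟩
      refine ⟨extChartAt (𝓡 k) y ((extChartAt (𝓡 k) z).symm e'),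
        ⟨(extChartAt (𝓡 k) y).map_source he', ?_⟩, ?_⟩
      · rw [Set.mem_preimage, (extChartAt (𝓡 k) y).left_inv he']
        exact (extChartAt (𝓡 k) z).map_target he
      · change extChartAt (𝓡 k) z ((extChartAt (𝓡 k) y).symm _) = e'
        rw [(extChartAt (𝓡 k) y).left_inv he', (extChartAt (𝓡 k) z).right_inv he]
  have hinj : Set.InjOn ψ A := by
    rintro e ⟨he, he'⟩ f ⟨hf, hf'⟩ hef
    have h1 := (extChartAt (𝓡 k) z).injOn he' hf' hef
    exact (extChartAt (𝓡 k) y).symm.injOn he hf h1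
  -- Both integrals reduce to the overlap of the charts: outside it the first integrand vanishes
  -- because `ζ` does, the second because the partition function at `y` does.
  rw [setIntegral_eq_of_subset_of_forall_sdiff_eq_zero (s := A)
      (isOpen_extChartAt_target y).measurableSet Set.inter_subset_left,
    setIntegral_eq_of_subset_of_forall_sdiff_eq_zero (s := B)
      (isOpen_extChartAt_target z).measurableSet Set.inter_subset_left, ← himage,
    integral_image_eq_integral_abs_det_fderiv_smul volume (hopen y z).measurableSet
      (f' := fun e => fderiv ℝ ψ e) _ hinj]
  -- The coefficient of the form changes by `det`, the frame sign by `sign det`, and their product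
  -- is the Jacobian `|det|`.
  · refine setIntegral_congr_fun (hopen y z).measurableSet fun e he => ?_
    have hpt : (extChartAt (𝓡 k) z).symm (ψ e) = (extChartAt (𝓡 k) y).symm e :=
      (extChartAt (𝓡 k) z).left_inv he.2
    simp only [smul_eq_mul]
    rw [hpt, frameSign_eq o y z he.1 he.2, localRep_stdFrame_eq ζ y z he.1 he.2,
      ← sign_mul_self (fderiv ℝ ψ e).det]
    ring
  · intro e he
    exact ((contDiffAt_mapInCharts (contMDiff_id (I := 𝓡 k) (M := M)) y z he.1
      he.2).differentiableAt (by simp)).hasFDerivAt.hasFDerivWithinAt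
  · rintro e ⟨he, he'⟩
    have h1 : (extChartAt (𝓡 k) z).symm e ∉ tsupport (chartPartition k M y) := fun h =>
      he' ⟨he, tsupport_chartPartition_subset y h⟩
    rw [image_eq_zero_of_notMem_tsupport h1, zero_mul]
  · rintro e ⟨he, he'⟩
    have h1 := hζ ((extChartAt (𝓡 k) y).symm e) fun h =>
      he' ⟨he, tsupport_chartPartition_subset z h⟩
    have h2 : localRep ζ y e = 0 := by
      rw [localRep, h1]
      rfl
    rw [h2]
    simp

omit [T2Space M] [CompactSpace M] [IsManifold (𝓡 k) ∞ M] in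
/-- Frame signs are locally constant. -/
lemma eventually_frameSign_eq (z : M) {e : EuclideanSpace ℝ (Fin k)}
    (he : e ∈ (extChartAt (𝓡 k) z).target) : ∀ᶠ e' in 𝓝 e, frameSign o z e' = frameSign o z e := by
  have h1 := ((ho z).continuousAt ((isOpen_extChartAt_target z).mem_nhds he))
  -- Signs take the values `-1, 0, 1`, so two of them at distance less than `1` coincide.
  have h2 := h1.eventually (Metric.ball_mem_nhds _ (by norm_num : (0 : ℝ) < 1))
  filter_upwards [h2] with e' he'
  rw [Real.dist_eq, abs_lt] at he'
  unfold frameSign at he' ⊢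
  generalize (SignType.sign ((o ((extChartAt (𝓡 k) z).symm e')).someVector _)) = s at he' ⊢
  generalize (SignType.sign ((o ((extChartAt (𝓡 k) z).symm e)).someVector _)) = s' at he' ⊢
  cases s <;> cases s' <;> simp at he' ⊢ <;> linarith

end Stokes

lemma extDeriv_const_zero {E : Type*} [NormedAddCommGroup E] [NormedSpace ℝ E] {q : ℕ} (e : E) :
    extDeriv (fun _ : E => (0 : E [⋀^Fin q]→L[ℝ] ℝ)) e = 0 := by
  rw [extDeriv, fderiv_fun_const]
  exact map_zero (ContinuousAlternatingMap.alternatizeUncurryFinCLM ℝ E ℝ)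

/-! ### Stokes' theorem: forms supported in one chart, then the general case -/

section GlobalStokes

open MeasureTheory

variable {q : ℕ} {M : Type*} [TopologicalSpace M]
  [ChartedSpace (EuclideanSpace ℝ (Fin (q + 1))) M] [T2Space M] [CompactSpace M]
  [IsManifold (𝓡 (q + 1)) ∞ M]
  {o : ∀ y : M, Orientation ℝ (TangentSpace (𝓡 (q + 1)) y) (Fin (q + 1))} (ho : IsOrientation o)

include ho

/-- Stokes' theorem for forms supported in a chart. -/
lemma integral_d_eq_zero_of_support {θ : Form (𝓡 (q + 1)) M q} (hθ : IsSmooth θ) (z : M)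
    (h0 : ∀ x, x ∉ tsupport (chartPartition (q + 1) M z) → θ x = 0) :
    integral o (d θ) = 0 := by
  have hT := isOpen_extChartAt_target (I := 𝓡 (q + 1)) z
  have hd0 : ∀ x, x ∉ tsupport (chartPartition (q + 1) M z) → d θ x = 0 := by
    intro x hx
    have h1 : localRep θ x =ᶠ[𝓝 (extChartAt (𝓡 (q + 1)) x x)] fun _ => 0 := by
      have h2 := (continuousAt_extChartAt_symm (I := 𝓡 (q + 1)) x).preimage_mem_nhds
        ((isClosed_tsupport (chartPartition (q + 1) M z)).isOpen_compl.mem_nhds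
          (by rwa [extChartAt_to_inv]))
      filter_upwards [h2] with e he
      rw [localRep, h0 _ he]
      rfl
    rw [d, h1.extDeriv_eq, extDeriv_const_zero]
    rfl
  -- All summands are moved to the chart at `z`, which contains the support; there the partition
  -- functions add up to `1` and disappear.
  rw [integral_eq_sum, Finset.sum_congr rfl fun y _ => integral_integrand_eq (d θ) y z hd0,
    ← integral_finsetSum]
  swap
  · intro y _
    refine integrableOn_target (continuousOn_integrand ho (isSmooth_d hθ) y z) fun e he h => ?_
    rw [localRep, hd0 _ (symm_notMem_tsupport he h)]
    exact (congrArg _ (mul_zero _)).trans (mul_zero _)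
  simp only [← Finset.sum_mul, sum_chartPartition, one_mul]
  -- Extension by zero of the signed local expression. It is smooth because the sign is locally
  -- constant and the support is compact inside the target.
  set g : EuclideanSpace ℝ (Fin (q + 1)) → EuclideanSpace ℝ (Fin (q + 1)) [⋀^Fin q]→L[ℝ] ℝ :=
    (extChartAt (𝓡 (q + 1)) z).target.indicator fun e => frameSign o z e • localRep θ z e with hg
  have hin : ∀ {e}, e ∈ (extChartAt (𝓡 (q + 1)) z).target →
      g =ᶠ[𝓝 e] frameSign o z e • localRep θ z := by
    intro e he
    filter_upwards [hT.mem_nhds he, eventually_frameSign_eq ho z he] with e' h1 h2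
    rw [hg, Set.indicator_of_mem h1, h2]
    rfl
  have hout' : ∀ {e}, e ∉ chartSupport (q + 1) z → g e = 0 := by
    intro e he
    by_cases h : e ∈ (extChartAt (𝓡 (q + 1)) z).target
    · have h1 : localRep θ z e = 0 := by
        rw [localRep, h0 _ (symm_notMem_tsupport h he)]
        rfl
      rw [hg, Set.indicator_of_mem h, h1, smul_zero]
    · exact Set.indicator_of_notMem h _
  have hout : ∀ {e}, e ∉ chartSupport (q + 1) z → g =ᶠ[𝓝 e] fun _ => 0 := by
    intro e he
    filter_upwards [(isCompact_chartSupport z).isClosed.isOpen_compl.mem_nhds he] with e' he'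
    exact hout' he'
  have hsm : ContDiff ℝ ∞ g := by
    rw [contDiff_iff_contDiffAt]
    intro e
    by_cases he : e ∈ chartSupport (q + 1) z
    · have he' := chartSupport_subset z he
      exact ContDiffAt.congr_of_eventuallyEq (f := frameSign o z e • localRep θ z)
        ((hθ.contDiffAt z he').const_smul (frameSign o z e)) (hin he')
    · exact contDiffAt_const.congr_of_eventuallyEq (hout he)
  have hc : HasCompactSupport g := HasCompactSupport.intro (isCompact_chartSupport z) fun e => hout'
  rw [← integral_extDeriv_eq_zero volume hsm hc (stdFrame (q + 1)),
    ← setIntegral_eq_integral_of_forall_compl_eq_zero (s := (extChartAt (𝓡 (q + 1)) z).target)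
      (f := fun e => extDeriv g e (stdFrame (q + 1)))]
  · refine setIntegral_congr_fun hT.measurableSet fun e he => ?_
    rw [(hin he).extDeriv_eq, extDeriv_smul, localRep_d hθ z he]
    rfl
  · intro e he
    rw [(hout fun h => he (chartSupport_subset z h)).extDeriv_eq]
    rw [extDeriv_const_zero]
    rfl

/-- Stokes' theorem on a compact oriented manifold without boundary. -/
theorem integral_d_eq_zero {η : Form (𝓡 (q + 1)) M q} (hη : IsSmooth η) :
    integral o (d η) = 0 := by
  set θ : M → Form (𝓡 (q + 1)) M q := fun z x => chartPartition (q + 1) M z x • η x with hθ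
  have hs : ∀ z, IsSmooth (θ z) := fun z x₀ =>
    (contDiffOn_chartPartition z x₀).smul (hη x₀)
  have h1 : η = ∑ z ∈ partitionIndex (q + 1) M, θ z := by
    funext x
    rw [Finset.sum_apply]
    simp only [hθ]
    rw [← Finset.sum_smul, sum_chartPartition, one_smul]
  rw [h1, d_sum _ fun z _ => hs z, integral_sum ho _ fun z => isSmooth_d (hs z)]
  refine Finset.sum_eq_zero fun z _ => integral_d_eq_zero_of_support ho (hs z) z fun x hx => ?_
  simp only [hθ]
  rw [image_eq_zero_of_notMem_tsupport hx, zero_smul]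

end GlobalStokes

/-! ### Integration over the slice `0 × M` -/

section Slice

variable {n k : ℕ} {M : Type*} [TopologicalSpace M] [ChartedSpace (EuclideanSpace ℝ (Fin k)) M]

/-- The inclusion of the slice `0 × M`. -/
def sliceIncl (n : ℕ) (M : Type*) (y : M) : EuclideanSpace ℝ (Fin n) × M := (0, y)

lemma contMDiff_sliceIncl : ContMDiff (𝓡 k) ((𝓡 n).prod (𝓡 k)) ∞ (sliceIncl n M) :=
  contMDiff_const.prodMk contMDiff_id

lemma mfderiv_sliceIncl (y : M) (u : EuclideanSpace ℝ (Fin k)) :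
    (mfderiv (𝓡 k) ((𝓡 n).prod (𝓡 k)) (sliceIncl n M) y u :
      EuclideanSpace ℝ (Fin n) × EuclideanSpace ℝ (Fin k)) = (0, u) := by
  have h := (hasMFDerivAt_const (I := 𝓡 k) (I' := 𝓡 n)
    (0 : EuclideanSpace ℝ (Fin n)) y).prodMk (hasMFDerivAt_id (I := 𝓡 k) y)
  have h2 : HasMFDerivAt (𝓡 k) ((𝓡 n).prod (𝓡 k)) (sliceIncl n M) y _ := h
  rw [h2.mfderiv]
  rfl

lemma pullback_sliceIncl_apply {q : ℕ}
    (θ : Form ((𝓡 n).prod (𝓡 k)) (EuclideanSpace ℝ (Fin n) × M) q) (y : M)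
    (u : Fin q → EuclideanSpace ℝ (Fin k)) :
    valueAt (pullback (𝓡 k) ((𝓡 n).prod (𝓡 k)) (sliceIncl n M) θ) y u =
      valueAt θ (0, y) fun i => (0, u i) :=
  form_congr θ rfl (funext fun i => mfderiv_sliceIncl y (u i))

lemma pullback_sliceIncl_sliceProj {q : ℕ}
    (θ : Form ((𝓡 n).prod (𝓡 k)) (EuclideanSpace ℝ (Fin n) × M) q) :
    pullback (𝓡 k) ((𝓡 n).prod (𝓡 k)) (sliceIncl n M)
      (pullback ((𝓡 n).prod (𝓡 k)) ((𝓡 n).prod (𝓡 k)) (sliceProj n M) θ) =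
    pullback (𝓡 k) ((𝓡 n).prod (𝓡 k)) (sliceIncl n M) θ := by
  funext y
  ext u
  refine (pullback_sliceIncl_apply _ y u).trans ?_
  refine Eq.trans ?_ (pullback_sliceIncl_apply θ y u).symm
  exact form_congr θ rfl (funext fun i => mfderiv_sliceProj _ _)

variable [T2Space M] [CompactSpace M] [IsManifold (𝓡 k) ∞ M]
  {o : ∀ y : M, Orientation ℝ (TangentSpace (𝓡 k) y) (Fin k)}

lemma sliceIntegral_smul (c : ℝ)
    (θ : Form ((𝓡 n).prod (𝓡 k)) (EuclideanSpace ℝ (Fin n) × M) k) :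
    sliceIntegral n o (c • θ) = c * sliceIntegral n o θ := integral_smul c
    (pullback (𝓡 k) ((𝓡 n).prod (𝓡 k)) (sliceIncl n M) θ)

lemma sliceIntegral_pullback_sliceProj
    (θ : Form ((𝓡 n).prod (𝓡 k)) (EuclideanSpace ℝ (Fin n) × M) k) :
    sliceIntegral n o (pullback ((𝓡 n).prod (𝓡 k)) ((𝓡 n).prod (𝓡 k)) (sliceProj n M) θ) =
      sliceIntegral n o θ :=
  congrArg (integral o) (pullback_sliceIncl_sliceProj θ)

variable (ho : IsOrientation o)

include ho

lemma sliceIntegral_add {θ η : Form ((𝓡 n).prod (𝓡 k)) (EuclideanSpace ℝ (Fin n) × M) k}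
    (hθ : IsSmooth θ) (hη : IsSmooth η) :
    sliceIntegral n o (θ + η) = sliceIntegral n o θ + sliceIntegral n o η :=
  integral_add ho (isSmooth_map_pullback contMDiff_sliceIncl hθ)
    (isSmooth_map_pullback contMDiff_sliceIncl hη)

end Slice

/-- Integrals of exact forms over the slice vanish. -/
lemma sliceIntegral_of_isExactForm {n : ℕ} : ∀ {k : ℕ} {M : Type*} [TopologicalSpace M]
    [ChartedSpace (EuclideanSpace ℝ (Fin k)) M] [T2Space M] [CompactSpace M]
    [IsManifold (𝓡 k) ∞ M] {o : ∀ y : M, Orientation ℝ (TangentSpace (𝓡 k) y) (Fin k)}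
    (_ : IsOrientation o) {θ : Form ((𝓡 n).prod (𝓡 k)) (EuclideanSpace ℝ (Fin n) × M) k}
    (_ : IsExactForm θ), sliceIntegral n o θ = 0
  | 0, _, _, _, _, _, _, _, _, _, hθ => by
    rw [show _ = _ from hθ]
    exact integral_zero_form
  | q + 1, _, _, _, _, _, _, _, ho, _, ⟨η, hη, h⟩ => by
    rw [h]
    refine (congrArg (integral _) (d_map_pullback contMDiff_sliceIncl hη).symm).trans ?_
    exact integral_d_eq_zero ho (isSmooth_map_pullback contMDiff_sliceIncl hη)

/-! ### Wedge products of forms pulled back from the factors of a product -/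

section WedgeAlgebra

variable {p q m : ℕ} (h : p + q = m)

/-- The sum of index sets underlying the wedge product. -/
abbrev wedgeIndex : Fin p ⊕ Fin q ≃ Fin m := finSumFinEquiv.trans (finCongr h)

/-- Multiplying by `p! q!` replaces the sum over shuffle classes by a sum over all permutations,
which is easier to handle; the factor is cancelled by `factorial_mul_injective`. -/
lemma factorial_mul_wedgeAlt {V : Type*} [AddCommGroup V] [Module ℝ V] [TopologicalSpace V]
    (a : V [⋀^Fin p]→L[ℝ] ℝ) (b : V [⋀^Fin q]→L[ℝ] ℝ) (v : Fin m → V) :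
    ((p.factorial * q.factorial : ℕ) : ℝ) * wedgeAlt h a b v =
      ∑ σ : Equiv.Perm (Fin p ⊕ Fin q), ((Equiv.Perm.sign σ : ℤ) : ℝ) *
        ((a fun i => v (wedgeIndex h (σ (Sum.inl i)))) *
          b fun i => v (wedgeIndex h (σ (Sum.inr i)))) := by
  have h1 := MultilinearMap.domCoprod_alternization_eq a.toAlternatingMap b.toAlternatingMap
  have h2 := congrArg (fun A : V [⋀^Fin p ⊕ Fin q]→ₗ[ℝ] TensorProduct ℝ ℝ ℝ =>
    LinearMap.mul' ℝ ℝ (A fun i => v (wedgeIndex h i))) h1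
  simp only [Fintype.card_fin] at h2
  refine Eq.trans ?_ (h2.symm.trans ?_)
  · rw [AlternatingMap.smul_apply, map_nsmul, nsmul_eq_mul]
    rfl
  · rw [MultilinearMap.alternatization_apply, map_sum]
    refine Finset.sum_congr rfl fun σ _ => ?_
    rw [Units.smul_def, map_zsmul, zsmul_eq_mul]
    rfl

lemma factorial_mul_injective {x y : ℝ}
    (hxy : ((p.factorial * q.factorial : ℕ) : ℝ) * x = ((p.factorial * q.factorial : ℕ) : ℝ) * y) :
    x = y :=
  mul_left_cancel₀ (by positivity) hxy

variable {V W : Type} [NormedAddCommGroup V] [NormedSpace ℝ V] [NormedAddCommGroup W]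
  [NormedSpace ℝ W]

/-- The wedge product `w ∧ b` on `V × W`. -/
def cylWedge (w : V [⋀^Fin p]→L[ℝ] ℝ) (b : W [⋀^Fin q]→L[ℝ] ℝ) : (V × W) [⋀^Fin m]→L[ℝ] ℝ :=
  wedgeAlt h (w.compContinuousLinearMap (ContinuousLinearMap.fst ℝ V W))
    (b.compContinuousLinearMap (ContinuousLinearMap.snd ℝ V W))

variable (w : V [⋀^Fin p]→L[ℝ] ℝ) (b : W [⋀^Fin q]→L[ℝ] ℝ)

lemma factorial_mul_cylWedge (v : Fin m → V × W) :
    ((p.factorial * q.factorial : ℕ) : ℝ) * cylWedge h w b v =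
      ∑ σ : Equiv.Perm (Fin p ⊕ Fin q), ((Equiv.Perm.sign σ : ℤ) : ℝ) *
        ((w fun i => (v (wedgeIndex h (σ (Sum.inl i)))).1) *
          b fun i => (v (wedgeIndex h (σ (Sum.inr i)))).2) :=
  factorial_mul_wedgeAlt h _ _ v

lemma cylWedge_smul (c : ℝ) : cylWedge h w (c • b) = c • cylWedge h w b := by
  ext v
  refine factorial_mul_injective (p := p) (q := q) ?_
  rw [factorial_mul_cylWedge, ContinuousAlternatingMap.smul_apply, smul_eq_mul, mul_left_comm,
    factorial_mul_cylWedge, Finset.mul_sum]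
  refine Finset.sum_congr rfl fun σ _ => ?_
  rw [ContinuousAlternatingMap.smul_apply, smul_eq_mul]
  ring

lemma cylWedge_map {W' : Type} [NormedAddCommGroup W'] [NormedSpace ℝ W'] (D : W' →L[ℝ] W)
    (v : Fin m → V × W') : (cylWedge h w b fun i => ((v i).1, D (v i).2)) =
      cylWedge h w (b.compContinuousLinearMap D) v := by
  refine factorial_mul_injective (p := p) (q := q) ?_
  rw [factorial_mul_cylWedge, factorial_mul_cylWedge]
  rfl

lemma cylWedge_scaleFst (t : ℝ) (v : Fin m → V × W) :
    (cylWedge h w b fun i => scaleFst V W t (v i)) = t ^ p * cylWedge h w b v := by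
  refine factorial_mul_injective (p := p) (q := q) ?_
  rw [factorial_mul_cylWedge, mul_left_comm, factorial_mul_cylWedge, Finset.mul_sum]
  refine Finset.sum_congr rfl fun σ _ => ?_
  have h1 := w.toMultilinearMap.map_smul_univ (fun _ => t)
    fun i => (v (wedgeIndex h (σ (Sum.inl i)))).1
  rw [Finset.prod_const, Finset.card_univ, Fintype.card_fin, smul_eq_mul] at h1
  simp only [scaleFst_apply]
  refine (congrArg (fun x => _ * (x * _)) h1).trans ?_
  change _ * (_ * w _ * _) = _
  ring

/-- In every term `b` receives `q` distinct vectors, at least one of them outside `S`. -/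
lemma cylWedge_eq_zero {v : Fin m → V × W} {S : Finset (Fin m)} (hS : S.card < q)
    (hv : ∀ i ∉ S, (v i).2 = 0) : cylWedge h w b v = 0 := by
  refine factorial_mul_injective (p := p) (q := q) ?_
  rw [factorial_mul_cylWedge, mul_zero]
  refine Finset.sum_eq_zero fun σ _ => ?_
  obtain ⟨i, hi⟩ : ∃ i : Fin q, wedgeIndex h (σ (Sum.inr i)) ∉ S := by
    by_contra! hc
    have h1 := Finset.card_le_card_of_injOn (s := (Finset.univ : Finset (Fin q))) (t := S)
      (fun i => wedgeIndex h (σ (Sum.inr i))) (fun i _ => hc i)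
      (((wedgeIndex h).injective.comp (σ.injective.comp Sum.inr_injective)).injOn)
    rw [Finset.card_univ, Fintype.card_fin] at h1
    omega
  rw [b.map_coord_zero i (hv _ hi), mul_zero, mul_zero]

/-- The value of `w ∧ b` on vectors tangent to the factors. -/
lemma cylWedge_block (v : Fin p → V) (u : Fin q → W) :
    cylWedge h w b (Sum.elim (fun i => (v i, 0)) (fun j => (0, u j)) ∘ (wedgeIndex h).symm) =
      w v * b u := by
  refine factorial_mul_injective (p := p) (q := q) ?_
  rw [factorial_mul_cylWedge]
  simp only [Function.comp_apply, Equiv.symm_apply_apply]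
  -- Only permutations preserving the two blocks contribute. Each contributes `w v * b u`, since its
  -- sign cancels those from `w` and `b`, and there are `p! q!` of them.
  rw [← Finset.sum_subset (Finset.subset_univ (Finset.univ.image
    (Equiv.Perm.sumCongrHom (Fin p) (Fin q)))), Finset.sum_image
      (Equiv.Perm.sumCongrHom_injective.injOn)]
  · rw [Finset.sum_congr rfl (g := fun _ => w v * b u), Finset.sum_const, Finset.card_univ,
      Fintype.card_prod, Fintype.card_perm, Fintype.card_perm, Fintype.card_fin, Fintype.card_fin,
      nsmul_eq_mul]
    rintro ⟨σ, τ⟩ _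
    have h1 : (w fun i => v (σ i)) = ((Equiv.Perm.sign σ : ℤ) : ℝ) * w v := by
      have := w.toAlternatingMap.map_perm v σ
      rw [Units.smul_def, zsmul_eq_mul] at this
      exact this
    have h2 : (b fun i => u (τ i)) = ((Equiv.Perm.sign τ : ℤ) : ℝ) * b u := by
      have := b.toAlternatingMap.map_perm u τ
      rw [Units.smul_def, zsmul_eq_mul] at this
      exact this
    have h3 : ∀ s : ℤˣ, ((s : ℤ) : ℝ) * ((s : ℤ) : ℝ) = 1 := fun s => by
      rcases Int.units_eq_one_or s with hs | hs <;> simp [hs]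
    simp only [Equiv.Perm.sumCongrHom_apply, Equiv.Perm.sumCongr_apply, Sum.map_inl, Sum.map_inr,
      Sum.elim_inl, Sum.elim_inr]
    rw [h1, h2, Equiv.Perm.sign_sumCongr]
    push_cast
    linear_combination w v * b u * (h3 (Equiv.Perm.sign σ) * (((Equiv.Perm.sign τ : ℤ) : ℝ) *
      ((Equiv.Perm.sign τ : ℤ) : ℝ)) + h3 (Equiv.Perm.sign τ))
  · intro σ _ hσ
    -- A permutation that mixes the blocks feeds `w` a vector of the second factor, whose first
    -- component is zero.
    have h1 : ¬ Set.MapsTo σ (Set.range Sum.inl) (Set.range Sum.inl) := fun h1 => by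
      obtain ⟨x, hx⟩ := Equiv.Perm.mem_sumCongrHom_range_of_perm_mapsTo_inl h1
      exact hσ (Finset.mem_image.2 ⟨x, Finset.mem_univ _, hx⟩)
    obtain ⟨i, hi⟩ : ∃ i : Fin p, ∃ j, σ (Sum.inl i) = Sum.inr j := by
      by_contra! hc
      refine h1 ?_
      rintro _ ⟨i, rfl⟩
      rcases hs : σ (Sum.inl i) with x | x
      · exact ⟨x, rfl⟩
      · exact absurd hs (hc i x)
    obtain ⟨j, hj⟩ := hi
    rw [w.map_coord_zero i (by rw [hj, Sum.elim_inr]), zero_mul, mul_zero]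

end WedgeAlgebra

/-! ### The forms `w ∧ υ` -/

section ConstWedge

variable {n k : ℕ} {M : Type*} [TopologicalSpace M] [ChartedSpace (EuclideanSpace ℝ (Fin k)) M]
  {p l m : ℕ}

lemma valueAt_constWedge (h : p + l = m) (w : EuclideanSpace ℝ (Fin n) [⋀^Fin p]→L[ℝ] ℝ)
    (υ : Form (𝓡 k) M l) (x : EuclideanSpace ℝ (Fin n) × M) :
    valueAt (constWedge h w υ) x = cylWedge h w (valueAt υ x.2) := by
  have h1 := mfderiv_fst (I := 𝓡 n) (I' := 𝓡 k) (x := x)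
  have h2 := mfderiv_snd (I := 𝓡 n) (I' := 𝓡 k) (x := x)
  unfold valueAt constWedge wedge pullback cylWedge
  congr 1
  · ext u
    exact congrArg w (funext fun i => congrArg (fun A : EuclideanSpace ℝ (Fin n) ×
      EuclideanSpace ℝ (Fin k) →L[ℝ] EuclideanSpace ℝ (Fin n) => A (u i)) h1)
  · ext u
    exact congrArg (valueAt υ x.2) (funext fun i => congrArg (fun A : EuclideanSpace ℝ (Fin n) ×
      EuclideanSpace ℝ (Fin k) →L[ℝ] EuclideanSpace ℝ (Fin k) => A (u i)) h2)

variable [IsManifold (𝓡 k) ∞ M]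

lemma localRep_constWedge (h : p + l = m) (w : EuclideanSpace ℝ (Fin n) [⋀^Fin p]→L[ℝ] ℝ)
    (υ : Form (𝓡 k) M l) (x₀ : EuclideanSpace ℝ (Fin n) × M)
    {z : EuclideanSpace ℝ (Fin n) × EuclideanSpace ℝ (Fin k)}
    (hz : z.2 ∈ (extChartAt (𝓡 k) x₀.2).target) :
    localRep (constWedge h w υ) x₀ z = cylWedge h w (localRep υ x₀.2 z.2) := by
  ext u
  rw [localRep_cylinder_apply _ x₀ hz, valueAt_constWedge]
  exact cylWedge_map h w _ _ u

variable (k) in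
/-- The determinant form on `ℝ^k`. -/
def detForm : EuclideanSpace ℝ (Fin k) [⋀^Fin k]→L[ℝ] ℝ :=
  { (EuclideanSpace.basisFun (Fin k) ℝ).toBasis.det with
    cont := by
      change Continuous fun v => (EuclideanSpace.basisFun (Fin k) ℝ).toBasis.det v
      simp only [Module.Basis.det_apply]
      refine Continuous.matrix_det (continuous_matrix fun i j => ?_)
      simp only [Module.Basis.toMatrix_apply, OrthonormalBasis.coe_toBasis_repr_apply,
        EuclideanSpace.basisFun_repr]
      fun_prop }

omit [TopologicalSpace M] [ChartedSpace (EuclideanSpace ℝ (Fin k)) M] [IsManifold (𝓡 k) ∞ M] in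
lemma eq_smul_detForm (A : EuclideanSpace ℝ (Fin k) [⋀^Fin k]→L[ℝ] ℝ) :
    A = A (stdFrame k) • detForm k := by
  have hstd : stdFrame k = (EuclideanSpace.basisFun (Fin k) ℝ).toBasis := by
    funext i
    simp [stdFrame]
  rw [hstd]
  ext v
  exact congrArg (fun B : EuclideanSpace ℝ (Fin k) [⋀^Fin k]→ₗ[ℝ] ℝ => B v)
    (AlternatingMap.eq_smul_basis_det (EuclideanSpace.basisFun (Fin k) ℝ).toBasis A.toAlternatingMap)

/-- A top degree form on the second factor, wedged with a constant form, is closed. -/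
lemma extDeriv_smul_cylWedge (h : p + k = m) (w : EuclideanSpace ℝ (Fin n) [⋀^Fin p]→L[ℝ] ℝ)
    (b : EuclideanSpace ℝ (Fin k) [⋀^Fin k]→L[ℝ] ℝ) {f : EuclideanSpace ℝ (Fin k) → ℝ}
    {z : EuclideanSpace ℝ (Fin n) × EuclideanSpace ℝ (Fin k)} (hf : DifferentiableAt ℝ f z.2) :
    extDeriv (fun z : EuclideanSpace ℝ (Fin n) × EuclideanSpace ℝ (Fin k) =>
      f z.2 • cylWedge h w b) z = 0 := by
  have hf' : HasFDerivAt (fun z : EuclideanSpace ℝ (Fin n) × EuclideanSpace ℝ (Fin k) => f z.2)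
      ((fderiv ℝ f z.2).comp (ContinuousLinearMap.snd ℝ _ _)) z :=
    hf.hasFDerivAt.comp z hasFDerivAt_snd
  -- It suffices to test on distinct vectors of a basis adapted to the product.
  refine ContinuousAlternatingMap.toAlternatingMap_injective
    (Module.Basis.ext_alternating ((EuclideanSpace.basisFun (Fin n) ℝ).toBasis.prod
      (EuclideanSpace.basisFun (Fin k) ℝ).toBasis) fun s hs => ?_)
  refine (extDeriv_apply (hf'.differentiableAt.smul_const _) _).trans ?_
  refine Finset.sum_eq_zero fun i _ => ?_
  set B := (EuclideanSpace.basisFun (Fin n) ℝ).toBasis.prod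
    (EuclideanSpace.basisFun (Fin k) ℝ).toBasis with hB
  have h1 : fderiv ℝ (fun x : EuclideanSpace ℝ (Fin n) × EuclideanSpace ℝ (Fin k) =>
      (f x.2 • cylWedge h w b) (i.removeNth fun j => B (s j))) z (B (s i)) =
      fderiv ℝ f z.2 (B (s i)).2 * cylWedge h w b (i.removeNth fun j => B (s j)) := by
    have h2 := (hf'.mul_const (cylWedge h w b (i.removeNth fun j => B (s j)))).fderiv
    have h3 := congrArg (fun L : (EuclideanSpace ℝ (Fin n) × EuclideanSpace ℝ (Fin k)) →L[ℝ] ℝ =>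
      L (B (s i))) h2
    refine h3.trans ?_
    simp [mul_comm]
  rw [h1]
  -- Differentiating along the first factor gives zero. Along the second, one of its `k` basis
  -- vectors is used up, so fewer than `k` are left for `b`.
  rcases hsi : s i with c | c
  · have h2 : (B (Sum.inl c)).2 = 0 := by simp [hB]
    rw [h2, map_zero, zero_mul, smul_zero]
  · rw [cylWedge_eq_zero h w b (S := Finset.univ.filter fun j => (s (i.succAbove j)).isRight),
      mul_zero, smul_zero]
    · have h2 := Finset.card_le_card_of_injOn
        (s := Finset.univ.filter fun j => (s (i.succAbove j)).isRight)
        (t := (Finset.univ.erase c).map Function.Embedding.inr)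
        (fun j => s (i.succAbove j)) (fun j hj => ?_)
        (hs.comp Fin.succAbove_right_injective).injOn
      · rw [Finset.card_map, Finset.card_erase_of_mem (Finset.mem_univ c), Finset.card_univ,
          Fintype.card_fin] at h2
        have := c.pos
        omega
      · rw [Finset.mem_coe, Finset.mem_filter] at hj
        obtain ⟨c', hc'⟩ := Sum.isRight_iff.1 hj.2
        rw [Finset.mem_coe, Finset.mem_map]
        refine ⟨c', Finset.mem_erase.2 ⟨?_, Finset.mem_univ _⟩, hc'.symm⟩
        rintro rfl
        exact i.succAbove_ne j (hs (hc'.trans hsi.symm))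
    · intro j hj
      rw [Finset.mem_filter, not_and] at hj
      have h2 := hj (Finset.mem_univ _)
      rw [Fin.removeNth]
      rcases hsj : s (i.succAbove j) with c' | c'
      · simp [hB]
      · simp [hsj] at h2

lemma localRep_constWedge_top (h : p + k = m) (w : EuclideanSpace ℝ (Fin n) [⋀^Fin p]→L[ℝ] ℝ)
    (υ : Form (𝓡 k) M k) (x₀ : EuclideanSpace ℝ (Fin n) × M)
    {z : EuclideanSpace ℝ (Fin n) × EuclideanSpace ℝ (Fin k)}
    (hz : z.2 ∈ (extChartAt (𝓡 k) x₀.2).target) :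
    localRep (constWedge h w υ) x₀ z =
      localRep υ x₀.2 z.2 (stdFrame k) • cylWedge h w (detForm k) := by
  rw [localRep_constWedge h w υ x₀ hz, ← cylWedge_smul, ← eq_smul_detForm]

omit [IsManifold (𝓡 k) ∞ M] in
lemma IsSmooth.contDiffOn_stdFrame {υ : Form (𝓡 k) M k} (hυ : IsSmooth υ) (y : M) :
    ContDiffOn ℝ ∞ (fun e => localRep υ y e (stdFrame k)) (extChartAt (𝓡 k) y).target :=
  (ContinuousLinearMap.contDiff (ContinuousAlternatingMap.apply ℝ (EuclideanSpace ℝ (Fin k)) ℝ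
    (stdFrame k))).comp_contDiffOn (hυ y)

/-- Locally the form is `f(y) w ∧ det`, and `df ∧ det` would be a form of degree `k + 1` in the `k`
coordinates of `M`. -/
lemma isClosedForm_constWedge (h : p + k = m) (w : EuclideanSpace ℝ (Fin n) [⋀^Fin p]→L[ℝ] ℝ)
    {υ : Form (𝓡 k) M k} (hυ : IsSmooth υ) : IsClosedForm (constWedge h w υ) := by
  have hs : IsSmooth (constWedge h w υ) := by
    intro x₀
    rw [extChartAt_cylinder_target]
    have h1 := (hυ.contDiffOn_stdFrame x₀.2).comp (t := (extChartAt (𝓡 k) x₀.2).target)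
      (s := Set.univ ×ˢ (extChartAt (𝓡 k) x₀.2).target)
      (f := (Prod.snd : EuclideanSpace ℝ (Fin n) × EuclideanSpace ℝ (Fin k) → _))
      contDiff_snd.contDiffOn fun z hz => hz.2
    exact (h1.smul (contDiffOn_const (c := cylWedge h w (detForm k)))).congr
      fun z hz => localRep_constWedge_top h w υ x₀ hz.2
  refine ⟨hs, form_ext_localRep fun x => ?_⟩
  have hx := mem_extChartAt_target (I := (𝓡 n).prod (𝓡 k)) x
  have hx2 : (extChartAt ((𝓡 n).prod (𝓡 k)) x x).2 ∈ (extChartAt (𝓡 k) x.2).target := by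
    rw [extChartAt_cylinder_target] at hx
    exact hx.2
  have hT := isOpen_extChartAt_target (I := 𝓡 k) x.2
  rw [localRep_d hs x hx]
  have h1 : localRep (constWedge h w υ) x =ᶠ[𝓝 (extChartAt ((𝓡 n).prod (𝓡 k)) x x)] fun z =>
      localRep υ x.2 z.2 (stdFrame k) • cylWedge h w (detForm k) := by
    filter_upwards [continuous_snd.continuousAt.preimage_mem_nhds (hT.mem_nhds hx2)] with z hz
    exact localRep_constWedge_top h w υ x hz
  rw [h1.extDeriv_eq, extDeriv_smul_cylWedge h w _
    (((hυ.contDiffOn_stdFrame x.2).contDiffAt (hT.mem_nhds hx2)).differentiableAt (by simp))]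
  rfl

end ConstWedge

/-! ### Translations of `ℝ^n × M` -/

section Translations

variable {n k : ℕ} {M : Type*} [TopologicalSpace M] [ChartedSpace (EuclideanSpace ℝ (Fin k)) M]

variable (k M) in
/-- The translation by `a` in the first factor. -/
def translation (a : EuclideanSpace ℝ (Fin n)) : (EuclideanSpace ℝ (Fin n) × M)
    ≃ₘ⟮(𝓡 n).prod (𝓡 k), (𝓡 n).prod (𝓡 k)⟯ (EuclideanSpace ℝ (Fin n) × M) where
  toEquiv := (Equiv.addRight a).prodCongr (Equiv.refl M)
  contMDiff_toFun :=
    ((contDiff_id.add contDiff_const).contMDiff.comp contMDiff_fst).prodMk contMDiff_snd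
  contMDiff_invFun :=
    ((contDiff_id.add contDiff_const).contMDiff.comp contMDiff_fst).prodMk contMDiff_snd

lemma mfderiv_translation (a : EuclideanSpace ℝ (Fin n)) (x : EuclideanSpace ℝ (Fin n) × M)
    (u : EuclideanSpace ℝ (Fin n) × EuclideanSpace ℝ (Fin k)) :
    (mfderiv ((𝓡 n).prod (𝓡 k)) ((𝓡 n).prod (𝓡 k)) (translation k M a) x u :
      EuclideanSpace ℝ (Fin n) × EuclideanSpace ℝ (Fin k)) = u := by
  have h1 : HasMFDerivAt (𝓡 n) (𝓡 n) (fun z : EuclideanSpace ℝ (Fin n) => z + a) x.1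
      (ContinuousLinearMap.id ℝ (EuclideanSpace ℝ (Fin n))) :=
    ((hasFDerivAt_id x.1).add_const a).hasMFDerivAt
  have h2 := (h1.comp x (hasMFDerivAt_fst (I := 𝓡 n) (I' := 𝓡 k) x)).prodMk
    (hasMFDerivAt_snd (I := 𝓡 n) (I' := 𝓡 k) x)
  have h3 : HasMFDerivAt ((𝓡 n).prod (𝓡 k)) ((𝓡 n).prod (𝓡 k)) (translation k M a) x _ := h2
  rw [h3.mfderiv]
  rfl

lemma valueAt_pullback_translation {q : ℕ} (a : EuclideanSpace ℝ (Fin n))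
    (θ : Form ((𝓡 n).prod (𝓡 k)) (EuclideanSpace ℝ (Fin n) × M) q)
    (x : EuclideanSpace ℝ (Fin n) × M) :
    valueAt (pullback ((𝓡 n).prod (𝓡 k)) ((𝓡 n).prod (𝓡 k)) (translation k M a) θ) x =
      valueAt θ (x.1 + a, x.2) := by
  ext u
  exact congrArg (valueAt θ (x.1 + a, x.2)) (funext fun i => mfderiv_translation a x (u i))

variable (n k M) in
/-- The group of translations. -/
def translationGroup : Subgroup ((EuclideanSpace ℝ (Fin n) × M)
    ≃ₘ⟮(𝓡 n).prod (𝓡 k), (𝓡 n).prod (𝓡 k)⟯ (EuclideanSpace ℝ (Fin n) × M)) where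
  carrier := Set.range (translation k M)
  mul_mem' := by
    rintro _ _ ⟨a, rfl⟩ ⟨b, rfl⟩
    refine ⟨b + a, Diffeomorph.ext fun x => ?_⟩
    exact Prod.ext (add_assoc _ _ _).symm rfl
  one_mem' := ⟨0, Diffeomorph.ext fun x => Prod.ext (add_zero _) rfl⟩
  inv_mem' := by
    rintro _ ⟨a, rfl⟩
    exact ⟨-a, Diffeomorph.ext fun x => Prod.ext rfl rfl⟩

/-- The vector of a translation, read off at the point `(0, y)`. -/
def translationVector (y : M) (g : translationGroup n k M) : EuclideanSpace ℝ (Fin n) :=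
  ((g : (EuclideanSpace ℝ (Fin n) × M) ≃ₘ⟮(𝓡 n).prod (𝓡 k), (𝓡 n).prod (𝓡 k)⟯
    (EuclideanSpace ℝ (Fin n) × M)) (0, y)).1

/-- The translation by `a`, as an element of the group of translations. -/
def toTranslationGroup (a : EuclideanSpace ℝ (Fin n)) : translationGroup n k M :=
  ⟨translation k M a, a, rfl⟩

lemma translationVector_toTranslationGroup (y : M) (a : EuclideanSpace ℝ (Fin n)) :
    translationVector y (toTranslationGroup (k := k) a) = a := zero_add a

lemma toTranslationGroup_translationVector (y : M) (g : translationGroup n k M) :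
    toTranslationGroup (translationVector y g) = g := by
  obtain ⟨_, a, rfl⟩ := g
  exact congrArg toTranslationGroup (translationVector_toTranslationGroup y a)

lemma toTranslationGroup_mul (a b : EuclideanSpace ℝ (Fin n)) :
    toTranslationGroup a * toTranslationGroup b = (toTranslationGroup (b + a) :
      translationGroup n k M) :=
  Subtype.ext (Diffeomorph.ext fun _ => Prod.ext (add_assoc _ _ _) rfl)

lemma translationVector_mul (y : M) (g h : translationGroup n k M) :
    translationVector y (g * h) = translationVector y g + translationVector y h := by
  rw [← toTranslationGroup_translationVector y g, ← toTranslationGroup_translationVector y h,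
    toTranslationGroup_mul]
  simp only [translationVector_toTranslationGroup, add_comm]

lemma translationGroup_mul_comm [Nonempty M] (g h : translationGroup n k M) : g * h = h * g := by
  obtain ⟨y⟩ := ‹Nonempty M›
  rw [← toTranslationGroup_translationVector y g, ← toTranslationGroup_translationVector y h,
    toTranslationGroup_mul, toTranslationGroup_mul, add_comm]

lemma valueAt_pullback_of_mem {q : ℕ} (y : M) (g : translationGroup n k M)
    (θ : Form ((𝓡 n).prod (𝓡 k)) (EuclideanSpace ℝ (Fin n) × M) q)
    (x : EuclideanSpace ℝ (Fin n) × M) :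
    valueAt (pullback ((𝓡 n).prod (𝓡 k)) ((𝓡 n).prod (𝓡 k))
      (g : (EuclideanSpace ℝ (Fin n) × M) ≃ₘ⟮(𝓡 n).prod (𝓡 k), (𝓡 n).prod (𝓡 k)⟯ _) θ) x =
      valueAt θ (x.1 + translationVector y g, x.2) := by
  obtain ⟨a, rfl⟩ : ∃ a, toTranslationGroup a = g := ⟨_, toTranslationGroup_translationVector y g⟩
  rw [translationVector_toTranslationGroup]
  exact valueAt_pullback_translation a θ x

lemma translationGroup_le_constWedgeGroup {l : ℕ} {ι : Type*} {deg : ι → ℕ}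
    (w : ∀ i, EuclideanSpace ℝ (Fin n) [⋀^Fin (deg i)]→L[ℝ] ℝ) (υ : Form (𝓡 k) M l) :
    translationGroup n k M ≤ constWedgeGroup w υ := by
  rintro _ ⟨a, rfl⟩ i
  funext x
  refine (valueAt_pullback_translation a _ x).trans ?_
  rw [valueAt_constWedge, ← valueAt_constWedge (rfl : deg i + l = deg i + l) (w i) υ x]

end Translations

/-! ### Contractions of translation invariant forms -/

section Contractions

variable {n k q : ℕ} {M : Type*} [TopologicalSpace M] [ChartedSpace (EuclideanSpace ℝ (Fin k)) M]

/-- The contraction of a form with a constant vector field in the first factor. -/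
def contractFst (a : EuclideanSpace ℝ (Fin n))
    (ζ : Form ((𝓡 n).prod (𝓡 k)) (EuclideanSpace ℝ (Fin n) × M) (q + 1)) :
    Form ((𝓡 n).prod (𝓡 k)) (EuclideanSpace ℝ (Fin n) × M) q :=
  fun x => (valueAt ζ x).curryLeft (a, 0)

lemma contractFst_apply (a : EuclideanSpace ℝ (Fin n))
    (ζ : Form ((𝓡 n).prod (𝓡 k)) (EuclideanSpace ℝ (Fin n) × M) (q + 1))
    (x : EuclideanSpace ℝ (Fin n) × M)
    (u : Fin q → EuclideanSpace ℝ (Fin n) × EuclideanSpace ℝ (Fin k)) :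
    valueAt (contractFst a ζ) x u = valueAt ζ x (Fin.cons (a, 0) u) := rfl

lemma contractFst_add (a b : EuclideanSpace ℝ (Fin n))
    (ζ : Form ((𝓡 n).prod (𝓡 k)) (EuclideanSpace ℝ (Fin n) × M) (q + 1)) :
    contractFst (a + b) ζ = contractFst a ζ + contractFst b ζ := by
  funext x
  have h : ((a + b, 0) : EuclideanSpace ℝ (Fin n) × EuclideanSpace ℝ (Fin k)) =
      (a, 0) + (b, 0) := by simp
  exact (congrArg (valueAt ζ x).curryLeft h).trans (map_add _ _ _)

lemma contractFst_add_form (a : EuclideanSpace ℝ (Fin n))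
    (ζ ξ : Form ((𝓡 n).prod (𝓡 k)) (EuclideanSpace ℝ (Fin n) × M) (q + 1)) :
    contractFst a (ζ + ξ) = contractFst a ζ + contractFst a ξ := rfl

/-- Forms on `ℝ^n × M` which are invariant under translations and homogeneous of degree `r - i`
under scalings of the first factor. -/
structure IsHomogeneous (i r : ℕ)
    (ζ : Form ((𝓡 n).prod (𝓡 k)) (EuclideanSpace ℝ (Fin n) × M) q) : Prop where
  const : ∀ a y, valueAt ζ (a, y) = valueAt ζ (0, y)
  scale : ∀ t : ℝ, t ≠ 0 → ∀ x u, t ^ i * (valueAt ζ x fun j =>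
    scaleFst (EuclideanSpace ℝ (Fin n)) (EuclideanSpace ℝ (Fin k)) t (u j)) =
      t ^ r * valueAt ζ x u

lemma isHomogeneous_zero (i r : ℕ) : IsHomogeneous i r
    (0 : Form ((𝓡 n).prod (𝓡 k)) (EuclideanSpace ℝ (Fin n) × M) q) where
  const _ _ := rfl
  scale _ _ _ _ := (mul_zero _).trans (mul_zero _).symm

lemma IsHomogeneous.smul {i r : ℕ}
    {ζ : Form ((𝓡 n).prod (𝓡 k)) (EuclideanSpace ℝ (Fin n) × M) q}
    (hζ : IsHomogeneous i r ζ) (c : ℝ) : IsHomogeneous i r (c • ζ) where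
  const a y := congrArg (c • ·) (hζ.const a y)
  scale t ht x u := (mul_left_comm _ _ _).trans
    ((congrArg (c * ·) (hζ.scale t ht x u)).trans (mul_left_comm _ _ _))

lemma isHomogeneous_constWedge {p l m : ℕ} (h : p + l = m)
    (w : EuclideanSpace ℝ (Fin n) [⋀^Fin p]→L[ℝ] ℝ) (υ : Form (𝓡 k) M l) :
    IsHomogeneous 0 p (constWedge h w υ) where
  const a y := by rw [valueAt_constWedge, valueAt_constWedge]
  scale t _ x u := by rw [valueAt_constWedge, cylWedge_scaleFst, pow_zero, one_mul]

lemma IsHomogeneous.contractFst {i r : ℕ}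
    {ζ : Form ((𝓡 n).prod (𝓡 k)) (EuclideanSpace ℝ (Fin n) × M) (q + 1)}
    (hζ : IsHomogeneous i r ζ) (a : EuclideanSpace ℝ (Fin n)) :
    IsHomogeneous (i + 1) r (contractFst a ζ) where
  const b y := by
    ext u
    rw [contractFst_apply, contractFst_apply, hζ.const]
  scale t ht x u := by
    have h1 : (fun j => scaleFst (EuclideanSpace ℝ (Fin n)) (EuclideanSpace ℝ (Fin k)) t
        ((Fin.cons (a, 0) u : Fin (q + 1) → _) j)) =
        Fin.cons (t • ((a, 0) : EuclideanSpace ℝ (Fin n) × EuclideanSpace ℝ (Fin k)))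
          fun j => scaleFst _ _ t (u j) := by
      funext j
      refine Fin.cases ?_ (fun j => ?_) j
      · simp [scaleFst_apply]
      · rfl
    have h2 := hζ.scale t ht x (Fin.cons (a, 0) u)
    rw [h1] at h2
    have h3 := congrArg (fun L : (EuclideanSpace ℝ (Fin n) × EuclideanSpace ℝ (Fin k))
      [⋀^Fin q]→L[ℝ] ℝ => L fun j => scaleFst _ _ t (u j))
      ((valueAt ζ x).curryLeft.map_smul t (a, 0))
    rw [contractFst_apply, contractFst_apply, ← h2, pow_succ, mul_assoc]
    exact congrArg (t ^ i * ·) h3.symm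

lemma homotopyOp_of_isHomogeneous {i s : ℕ}
    {ζ : Form ((𝓡 n).prod (𝓡 k)) (EuclideanSpace ℝ (Fin n) × M) (q + 1)}
    (hζ : IsHomogeneous i (i + s + 1) ζ) (x : EuclideanSpace ℝ (Fin n) × M) :
    valueAt (homotopyOp q ζ) x = ((s : ℝ) + 1)⁻¹ • valueAt (contractFst x.1 ζ) x := by
  have h1 : ∀ t ∈ Set.uIoc (0 : ℝ) 1, homotopyIntegrand (V := EuclideanSpace ℝ (Fin n))
      (W := EuclideanSpace ℝ (Fin k)) (fun z => valueAt ζ (z.1, x.2)) t (x.1, 0) =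
      t ^ s • valueAt (contractFst x.1 ζ) x := by
    intro t ht
    rw [Set.uIoc_of_le zero_le_one] at ht
    ext u
    have h2 := (hζ.contractFst x.1).scale t ht.1.ne' x u
    -- The contraction with `x` raises the first index to `i + 1`, so cancelling `t ^ (i + 1)`
    -- leaves `t ^ s`, whose integral is `1 / (s + 1)`. The half-open interval keeps `t ≠ 0`.
    have h3 : t ^ (i + s + 1) = t ^ (i + 1) * t ^ s := by ring
    rw [h3, mul_assoc] at h2
    refine Eq.trans ?_ (mul_left_cancel₀ (pow_ne_zero _ ht.1.ne') h2)
    rw [contractFst_apply]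
    have h4 : valueAt ζ (t • x.1, x.2) = valueAt ζ x := by
      rw [hζ.const, ← hζ.const x.1]
    exact congrArg (fun L : (EuclideanSpace ℝ (Fin n) × EuclideanSpace ℝ (Fin k))
      [⋀^Fin (q + 1)]→L[ℝ] ℝ => L (Fin.cons (x.1, 0) fun j => scaleFst _ _ t (u j))) h4
  refine (intervalIntegral.integral_congr_ae (Filter.Eventually.of_forall h1)).trans ?_
  rw [intervalIntegral.integral_smul_const, integral_pow]
  simp

/-- Iterated contractions of a family of forms. -/
def contractions (Θ : ∀ q, Form ((𝓡 n).prod (𝓡 k)) (EuclideanSpace ℝ (Fin n) × M) q) :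
    ∀ i q, (Fin i → EuclideanSpace ℝ (Fin n)) →
      Form ((𝓡 n).prod (𝓡 k)) (EuclideanSpace ℝ (Fin n) × M) q
  | 0, q => fun _ => Θ q
  | i + 1, q => fun v => contractFst (v (Fin.last i)) (contractions Θ i (q + 1) (Fin.init v))

variable {Θ : ∀ q, Form ((𝓡 n).prod (𝓡 k)) (EuclideanSpace ℝ (Fin n) × M) q}

lemma isHomogeneous_contractions {r : ℕ} (hΘ : ∀ q, IsHomogeneous 0 r (Θ q)) :
    ∀ i q v, IsHomogeneous i r (contractions Θ i q v)
  | 0, q, _ => hΘ q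
  | i + 1, q, _ => (isHomogeneous_contractions hΘ i (q + 1) _).contractFst _

lemma contractions_update_add : ∀ (i q : ℕ) (v : Fin i → EuclideanSpace ℝ (Fin n)) (j : Fin i)
    (a b : EuclideanSpace ℝ (Fin n)), contractions Θ i q (Function.update v j (a + b)) =
      contractions Θ i q (Function.update v j a) + contractions Θ i q (Function.update v j b)
  | 0, _, _, j, _, _ => j.elim0
  | i + 1, q, v, j, a, b => by
    refine Fin.lastCases ?_ (fun j => ?_) j
    · simp only [contractions, Fin.init_update_last, Function.update_self]
      exact contractFst_add a b _
    · simp only [contractions, Fin.init_update_castSucc]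
      rw [contractions_update_add i (q + 1) (Fin.init v) j a b, contractFst_add_form]
      simp only [Function.update_of_ne (Fin.castSucc_lt_last j).ne']

lemma contractions_apply : ∀ (i q : ℕ) {m : ℕ} (h : i + q = m)
    (v : Fin i → EuclideanSpace ℝ (Fin n)) (x : EuclideanSpace ℝ (Fin n) × M)
    (u : Fin q → EuclideanSpace ℝ (Fin n) × EuclideanSpace ℝ (Fin k)),
    valueAt (contractions Θ i q v) x u =
      valueAt (Θ m) x (Sum.elim (fun j => (v j, 0)) u ∘ (wedgeIndex h).symm)
  | 0, q, m, h, v, x, u => by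
    obtain rfl : q = m := by omega
    refine congrArg (valueAt (Θ q) x) (funext fun j => ?_)
    obtain ⟨j, rfl⟩ := (wedgeIndex h).surjective j
    rcases j with j | j
    · exact j.elim0
    · rw [Function.comp_apply, Equiv.symm_apply_apply, Sum.elim_inr]
      exact congrArg u (Fin.ext (by simp))
  | i + 1, q, m, h, v, x, u => by
    refine (contractions_apply i (q + 1) (m := m) (by omega) (Fin.init v) x
      (Fin.cons (v (Fin.last i), 0) u)).trans ?_
    refine congrArg (valueAt (Θ m) x) (funext fun j => ?_)
    obtain ⟨j, rfl⟩ := (wedgeIndex h).surjective j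
    rw [Function.comp_apply, Function.comp_apply, Equiv.symm_apply_apply]
    rcases j with j | j
    · refine Fin.lastCases ?_ (fun j => ?_) j
      · have h1 : wedgeIndex h (Sum.inl (Fin.last i)) =
            wedgeIndex (p := i) (q := q + 1) (by omega) (Sum.inr 0) := Fin.ext (by simp)
        rw [h1, Equiv.symm_apply_apply]
        rfl
      · have h1 : wedgeIndex h (Sum.inl j.castSucc) =
            wedgeIndex (p := i) (q := q + 1) (by omega) (Sum.inl j) := Fin.ext (by simp)
        rw [h1, Equiv.symm_apply_apply]
        rfl
    · have h1 : wedgeIndex h (Sum.inr j) =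
          wedgeIndex (p := i) (q := q + 1) (by omega) (Sum.inr j.succ) :=
        Fin.ext (by simp; omega)
      rw [h1, Equiv.symm_apply_apply]
      rfl

/-- With `x` frozen the cochain is additive in each translation, hence a cocycle for the trivial
action. The true action also moves `x` to `x + v` in the last face, and only this extra term
survives. -/
lemma delta₁_contractions {i r : ℕ} (hΘ : ∀ q, IsHomogeneous 0 r (Θ q)) (y : M) (C : ℝ)
    {φ : (Fin i → translationGroup n k M) →
      Form ((𝓡 n).prod (𝓡 k)) (EuclideanSpace ℝ (Fin n) × M) q}
    (hφ : ∀ g x, valueAt (φ g) x = C • valueAt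
      (contractions Θ (i + 1) q (Fin.snoc (fun j => translationVector y (g j)) x.1)) x)
    (g : Fin (i + 1) → translationGroup n k M) :
    delta₁ φ g = ((-1) ^ (i + 1) * C) •
      contractions Θ (i + 1) q fun j => translationVector y (g j) := by
  funext x
  -- The values at the frozen point `x`, as a cochain for the trivial action.
  set F : (Fin i → translationGroup n k M) →
      (EuclideanSpace ℝ (Fin n) × EuclideanSpace ℝ (Fin k)) [⋀^Fin q]→L[ℝ] ℝ := fun g =>
    C • valueAt (contractions Θ (i + 1) q (Fin.snoc (fun j => translationVector y (g j)) x.1)) x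
    with hF
  have hFadd : ∀ (j : Fin i) (g : Fin i → translationGroup n k M) a b,
      F (Function.update g j (a * b)) = F (Function.update g j a) + F (Function.update g j b) := by
    intro j g a b
    have h1 : ∀ c, (Fin.snoc (fun j' => translationVector y (Function.update g j c j')) x.1 :
        Fin (i + 1) → EuclideanSpace ℝ (Fin n)) =
        Function.update (Fin.snoc (fun j' => translationVector y (g j')) x.1 :
          Fin (i + 1) → EuclideanSpace ℝ (Fin n)) j.castSucc (translationVector y c) := by
      intro c
      rw [← Fin.snoc_update]
      congr 1
      funext j'
      exact Function.apply_update (fun _ => translationVector y) g j c j'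
    simp only [hF, h1, translationVector_mul]
    rw [contractions_update_add, ← smul_add]
    rfl
  have h1 := congrFun (cochainD_eq_zero_of_multiadditive F hFadd) g
  have h2 : valueAt (delta₁ φ g) x = F (fun j => g j.succ)
      + ∑ j : Fin i, (-1 : ℤ) ^ ((j : ℕ) + 1) • F (Fin.contractNth j.castSucc (· * ·) g)
      + (-1 : ℤ) ^ (i + 1) • C • valueAt (contractions Θ (i + 1) q
        (Fin.snoc (fun j => translationVector y (g j.castSucc))
          (x.1 + translationVector y (g (Fin.last i))))) x := by
    have h3 : valueAt (pullback ((𝓡 n).prod (𝓡 k)) ((𝓡 n).prod (𝓡 k)) ((g (Fin.last i) :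
        (EuclideanSpace ℝ (Fin n) × M) ≃ₘ⟮(𝓡 n).prod (𝓡 k), (𝓡 n).prod (𝓡 k)⟯ _))
        (φ fun j => g j.castSucc)) x = C • valueAt (contractions Θ (i + 1) q
        (Fin.snoc (fun j => translationVector y (g j.castSucc))
          (x.1 + translationVector y (g (Fin.last i))))) x := by
      rw [valueAt_pullback_of_mem y, hφ]
      have h4 := isHomogeneous_contractions hΘ (i + 1) q (Fin.snoc
        (fun j => translationVector y (g j.castSucc)) (x.1 + translationVector y (g (Fin.last i))))
      exact congrArg (C • ·) ((h4.const _ _).trans (h4.const x.1 _).symm)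
    rw [← h3]
    simp only [hF, ← hφ]
    unfold valueAt
    simp only [delta₁, cochainD, Pi.add_apply, Pi.smul_apply, Finset.sum_apply]
    rfl
  -- Additivity in the last slot separates the frozen term from the one in which `x` is replaced by
  -- the last translation vector.
  have h5 : valueAt (contractions Θ (i + 1) q (Fin.snoc (fun j => translationVector y
        (g j.castSucc)) (x.1 + translationVector y (g (Fin.last i))))) x =
      valueAt (contractions Θ (i + 1) q (Fin.snoc (fun j => translationVector y
        (g j.castSucc)) x.1)) x +
      valueAt (contractions Θ (i + 1) q fun j => translationVector y (g j)) x := by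
    have h6 := contractions_update_add (Θ := Θ) (i + 1) q (fun j => translationVector y (g j))
      (Fin.last i) x.1 (translationVector y (g (Fin.last i)))
    rw [Function.update_eq_self] at h6
    have h7 : ∀ a, Function.update (fun j => translationVector y (g j)) (Fin.last i) a =
        Fin.snoc (fun j => translationVector y (g j.castSucc)) a := by
      intro a
      rw [← Fin.snoc_init_self (fun j => translationVector y (g j)), Fin.update_snoc_last]
      rfl
    rw [h7, h7] at h6
    exact congrFun h6 x
  refine h2.trans ?_
  rw [h5, smul_add, smul_add, ← add_assoc]
  have h8 : F (fun j => g j.succ)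
      + ∑ j : Fin i, (-1 : ℤ) ^ ((j : ℕ) + 1) • F (Fin.contractNth j.castSucc (· * ·) g)
      + (-1 : ℤ) ^ (i + 1) • C • valueAt (contractions Θ (i + 1) q (Fin.snoc
        (fun j => translationVector y (g j.castSucc)) x.1)) x = 0 := h1
  rw [h8, zero_add, ← Int.cast_smul_eq_zsmul ℝ, smul_smul]
  push_cast
  rfl

/-- On translations, the cochains of the canonical descent are multiples of contractions. -/
lemma exists_descentCochain_translationGroup {p : ℕ}
    (hΘ : ∀ q, IsHomogeneous 0 (p + 1) (Θ q)) (y : M) : ∀ i, i ≤ p → ∃ C : ℝ, C ≠ 0 ∧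
    ∀ q g x, valueAt (descentCochain (translationGroup n k M) homotopyOp Θ i q g) x =
      C • valueAt (contractions Θ (i + 1) q
        (Fin.snoc (fun j => translationVector y (g j)) x.1)) x := by
  have hsucc : ∀ {i q : ℕ} (v : Fin i → EuclideanSpace ℝ (Fin n)) (a : EuclideanSpace ℝ (Fin n)),
      contractions Θ (i + 1) q (Fin.snoc v a) = contractFst a (contractions Θ i (q + 1) v) := by
    intro i q v a
    simp only [contractions, Fin.snoc_last, Fin.init_snoc]
  intro i
  induction i with
  | zero =>
    -- The descent starts with `-KΘ`, and `K` divides the contraction by the homogeneity degree `p +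
    -- 1`.
    refine fun _ => ⟨-((p : ℝ) + 1)⁻¹, neg_ne_zero.2 (by positivity), fun q g x => ?_⟩
    have h1 := homotopyOp_of_isHomogeneous (s := p) (i := 0) (q := q) (by
      rw [zero_add]; exact hΘ (q + 1)) x
    rw [hsucc]
    exact (congrArg Neg.neg h1).trans (neg_smul _ _).symm
  | succ i ih =>
    intro hi
    obtain ⟨C, hC, h⟩ := ih (by omega)
    -- Here `s + 1 = p - i` is the degree still left after `i + 1` contractions, so the next
    -- application of `K` divides by it and the constant stays nonzero.
    obtain ⟨s, rfl⟩ := Nat.exists_eq_add_of_lt (show i < p by omega)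
    refine ⟨(-1) ^ i * (((s : ℝ) + 1)⁻¹ * ((-1) ^ (i + 1) * C)), ?_, fun q g x => ?_⟩
    · have : ((s : ℝ) + 1)⁻¹ ≠ 0 := by positivity
      simp [hC, this]
    · have h1 : delta₁ (descentCochain (translationGroup n k M) homotopyOp Θ i (q + 1)) g = _ :=
        delta₁_contractions hΘ y C (h (q + 1)) g
      have h2 : IsHomogeneous (i + 1) (i + 1 + s + 1) (((-1) ^ (i + 1) * C) •
          contractions Θ (i + 1) (q + 1) fun j => translationVector y (g j)) := by
        rw [show i + 1 + s + 1 = i + s + 1 + 1 by omega]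
        exact (isHomogeneous_contractions hΘ (i + 1) (q + 1) _).smul _
      have h5 := homotopyOp_of_isHomogeneous h2 x
      rw [hsucc]
      simp only [descentCochain]
      have h6 := smul_smul ((s : ℝ) + 1)⁻¹ ((-1) ^ (i + 1) * C) (valueAt (contractFst x.1
        (contractions Θ (i + 1) (q + 1) fun j => translationVector y (g j))) x)
      rw [h1, zsmul_eq_smul]
      push_cast
      exact (congrArg ((-1 : ℝ) ^ i • ·) (h5.trans h6)).trans (smul_smul _ _ _)

end Contractions

/-! ### The cocycle of a form `w ∧ υ` -/

section Cocycle

lemma IsExactForm.pullback {E : Type*} [NormedAddCommGroup E] [NormedSpace ℝ E]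
    {H : Type*} [TopologicalSpace H] {X : Type*} [TopologicalSpace X] [ChartedSpace H X]
    {I : ModelWithCorners ℝ E H} [I.Boundaryless] [IsManifold I ∞ X] {f : X → X}
    (hf : ContMDiff I I ∞ f) : ∀ {q : ℕ} {θ : Form I X q}, IsExactForm θ →
      IsExactForm (pullback I I f θ)
  | 0, θ, hθ => by
    rw [show θ = 0 from hθ]
    rfl
  | q + 1, _, ⟨η, hη, h⟩ => ⟨DiffForm.pullback I I f η, isSmooth_pullback hf hη, by
      rw [h, d_pullback hf hη]⟩

variable {n k : ℕ} {M : Type*} [TopologicalSpace M] [ChartedSpace (EuclideanSpace ℝ (Fin k)) M]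
  [T2Space M] [CompactSpace M] [IsManifold (𝓡 k) ∞ M]
  {o : ∀ y : M, Orientation ℝ (TangentSpace (𝓡 k) y) (Fin k)}

/-- On the slice the contracted form is evaluated on `p` vectors of `ℝ^n` followed by `k` vectors of
`M`, where `w ∧ υ` factors by `cylWedge_block`. -/
lemma sliceIntegral_contractions {p m : ℕ}
    {Θ : ∀ q, Form ((𝓡 n).prod (𝓡 k)) (EuclideanSpace ℝ (Fin n) × M) q} (h : p + k = m)
    {w : EuclideanSpace ℝ (Fin n) [⋀^Fin p]→L[ℝ] ℝ} {υ : Form (𝓡 k) M k}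
    (hΘ : Θ m = constWedge h w υ) (v : Fin p → EuclideanSpace ℝ (Fin n)) :
    sliceIntegral n o (contractions Θ p k v) = w v * integral o υ := by
  rw [← integral_smul]
  refine congrArg (integral o) (funext fun y => ContinuousAlternatingMap.ext fun u => ?_)
  refine (pullback_sliceIncl_apply (contractions Θ p k v) y u).trans ?_
  rw [contractions_apply p k h, hΘ, valueAt_constWedge]
  exact cylWedge_block h w (valueAt υ y) v u

variable (ho : IsOrientation o)

include ho

/-- Split `θ` into its pullback from the slice, which translations leave unchanged, and an exact
form, which stays exact after translation and integrates to zero. -/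
lemma fixesClass_translation (a : EuclideanSpace ℝ (Fin n)) :
    FixesClass (sliceIntegral n o) (translation k M a) := by
  intro θ hθ
  set r := pullback ((𝓡 n).prod (𝓡 k)) ((𝓡 n).prod (𝓡 k)) (sliceProj n M) θ with hr
  have hrs : IsSmooth r := isSmooth_pullback contMDiff_sliceProj hθ.1
  have h1 : pullback ((𝓡 n).prod (𝓡 k)) ((𝓡 n).prod (𝓡 k)) (translation k M a) θ =
      pullback ((𝓡 n).prod (𝓡 k)) ((𝓡 n).prod (𝓡 k)) (translation k M a) (θ - r) + r := by
    funext x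
    refine (valueAt_pullback_translation a θ x).trans ?_
    refine Eq.trans ?_ (congrArg (· + valueAt r x)
      (valueAt_pullback_translation a (θ - r) x)).symm
    have h2 : valueAt r x = valueAt r (x.1 + a, x.2) := by
      ext u
      exact (form_congr θ rfl (funext fun i => mfderiv_sliceProj x (u i))).trans
        (form_congr θ rfl (funext fun i => mfderiv_sliceProj (x.1 + a, x.2) (u i))).symm
    rw [h2]
    exact (sub_add_cancel _ _).symm
  rw [h1, sliceIntegral_add ho (isSmooth_pullback (translation k M a).contMDiff (hθ.1.sub hrs)) hrs,
    sliceIntegral_of_isExactForm ho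
      ((isExactForm_sub_pullback_sliceProj hθ).pullback (translation k M a).contMDiff), zero_add,
    hr, sliceIntegral_pullback_sliceProj]

/-- The pullback of `υ` from `M`, written as `1 ∧ υ`, is closed with integral `1` over the slice,
whereas exact forms integrate to zero. -/
lemma not_deRhamVanishes_cylinder {υ : Form (𝓡 k) M k} (hυ : IsSmooth υ)
    (hυ₁ : integral o υ = 1) :
    ¬ DeRhamVanishes ((𝓡 n).prod (𝓡 k)) (EuclideanSpace ℝ (Fin n) × M) k := by
  intro hv
  set w : EuclideanSpace ℝ (Fin n) [⋀^Fin 0]→L[ℝ] ℝ :=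
    ContinuousAlternatingMap.constOfIsEmpty ℝ (EuclideanSpace ℝ (Fin n)) (Fin 0) (1 : ℝ)
  set Θ : ∀ q, Form ((𝓡 n).prod (𝓡 k)) (EuclideanSpace ℝ (Fin n) × M) q :=
    Function.update 0 k (constWedge (zero_add k) w υ) with hΘ
  have h1 : Θ k = constWedge (zero_add k) w υ := Function.update_self _ _ _
  have h2 := sliceIntegral_contractions (o := o) (zero_add k) h1 Fin.elim0
  have h3 : sliceIntegral n o (Θ k) = 0 := by
    rw [h1]
    exact sliceIntegral_of_isExactForm ho (hv _ (isClosedForm_constWedge _ w hυ))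
  rw [hυ₁, mul_one] at h2
  exact zero_ne_one (h3.symm.trans h2)

variable {υ : Form (𝓡 k) M k} (hυ : IsSmooth υ) (hυ₁ : integral o υ = 1)
  {Γ : Subgroup ((EuclideanSpace ℝ (Fin n) × M)
    ≃ₘ⟮(𝓡 n).prod (𝓡 k), (𝓡 n).prod (𝓡 k)⟯ (EuclideanSpace ℝ (Fin n) × M))}
  (hΓ : ∀ g ∈ Γ, FixesClass (sliceIntegral n o) g) {p : ℕ}

include hυ hυ₁ hΓ

lemma cocycleDefined_constWedge {d : ℕ} (h : d + k = p + k + 1)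
    {w : EuclideanSpace ℝ (Fin n) [⋀^Fin d]→L[ℝ] ℝ}
    (hinv : ∀ g ∈ Γ, pullback _ _ g (constWedge h w υ) = constWedge h w υ) :
    CocycleDefined Γ p k (constWedge h w υ) (sliceIntegral n o) where
  smooth := (isClosedForm_constWedge h w hυ).1
  invariant := hinv
  exact := deRhamVanishes_cylinder (by omega) _ (isClosedForm_constWedge h w hυ)
  vanishing j hj _ := deRhamVanishes_cylinder (by omega)
  nonvanishing := not_deRhamVanishes_cylinder ho hυ hυ₁
  cycle _ hθ := sliceIntegral_of_isExactForm ho hθ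
  class_invariant := hΓ
  exists_descent := ⟨_, isDescent_descentCochain (K := fun q => homotopyOp q)
    (fun _ _ => isSmooth_homotopyOp) (fun _ _ hq => d_homotopyOp_of_lt hq)
    (isClosedForm_constWedge h w hυ) hinv⟩
  cocycle φ hφ := hφ.trivD_periodCochain (fun _ _ => sliceIntegral_add ho) sliceIntegral_smul
    hinv hΓ
  unique φ ψ hφ hψ := hφ.exists_period_sub_eq (fun _ _ => sliceIntegral_add ho) sliceIntegral_smul
    (K := fun q => homotopyOp q) (fun _ _ => isSmooth_homotopyOp)
    (fun _ _ hq => d_homotopyOp_of_lt hq) hψ hΓ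

lemma cocycleNontrivial_constWedge [Nonempty M] (hT : translationGroup n k M ≤ Γ)
    (h : p + 1 + k = p + k + 1)
    {w : EuclideanSpace ℝ (Fin n) [⋀^Fin (p + 1)]→L[ℝ] ℝ} (hw : w ≠ 0)
    (hinv : ∀ g ∈ Γ, pullback _ _ g (constWedge h w υ) = constWedge h w υ) :
    CocycleNontrivial Γ p k (constWedge h w υ) (sliceIntegral n o) := by
  rintro φ hφ ⟨b, hb⟩
  obtain ⟨y⟩ := ‹Nonempty M›
  set Θ : ∀ q, Form ((𝓡 n).prod (𝓡 k)) (EuclideanSpace ℝ (Fin n) × M) q :=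
    Function.update 0 (p + k + 1) (constWedge h w υ) with hΘ
  have hΘ1 : Θ (p + k + 1) = constWedge h w υ := Function.update_self _ _ _
  have hhom : ∀ q, IsHomogeneous 0 (p + 1) (Θ q) := by
    intro q
    by_cases hq : q = p + k + 1
    · subst hq
      rw [hΘ1]
      exact isHomogeneous_constWedge h w υ
    · rw [hΘ, Function.update_of_ne hq]
      exact isHomogeneous_zero 0 (p + 1)
  have hψ : IsDescent (translationGroup n k M) p k (constWedge h w υ)
      (descentCochain (translationGroup n k M) homotopyOp Θ) :=
    isDescent_descentCochain (K := fun q => homotopyOp q)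
      (fun _ _ => isSmooth_homotopyOp) (fun _ _ hq => d_homotopyOp_of_lt hq)
      (isClosedForm_constWedge h w hυ) fun g hg => hinv g (hT hg)
  -- Over translations the given descent and the canonical one have cohomologous periods, so the
  -- canonical period cochain would also be a coboundary.
  obtain ⟨b', hb'⟩ := (hφ.restrict hT).exists_period_sub_eq
    (fun _ _ => sliceIntegral_add ho) sliceIntegral_smul
    (K := fun q => homotopyOp q) (fun _ _ => isSmooth_homotopyOp)
    (fun _ _ hq => d_homotopyOp_of_lt hq) hψ fun g hg => hΓ g (hT hg)
  have hcob : periodCochain p k (sliceIntegral n o)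
      (descentCochain (translationGroup n k M) homotopyOp Θ) =
      trivD ((fun g : Fin p → translationGroup n k M =>
        b fun j => Subgroup.inclusion hT (g j)) - b') := by
    rw [trivD_sub, ← hb']
    funext g
    have h1 : periodCochain p k (sliceIntegral n o) (restrictCochain hT φ) g =
        trivD (fun g : Fin p → translationGroup n k M =>
          b fun j => Subgroup.inclusion hT (g j)) g := by
      rw [trivD_restrict, ← hb, periodCochain, delta₁_restrictCochain]
      rfl
    simp only [Pi.sub_apply, ← h1, sub_sub_cancel]
  obtain ⟨C, hC, hCφ⟩ := exists_descentCochain_translationGroup (n := n) hhom y p le_rfl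
  have hval : ∀ g, periodCochain p k (sliceIntegral n o)
      (descentCochain (translationGroup n k M) homotopyOp Θ) g =
      ((-1) ^ (p + 1) * C) * w fun j => translationVector y (g j) := by
    intro g
    rw [periodCochain, delta₁_contractions hhom y C (hCφ k) g, sliceIntegral_smul,
      sliceIntegral_contractions h hΘ1, hυ₁, mul_one]
  obtain ⟨v, hv⟩ : ∃ v, w v ≠ 0 := by
    by_contra! hc
    exact hw (ContinuousAlternatingMap.ext hc)
  -- Antisymmetrizing over translations by vectors with `w v ≠ 0` gives zero for a coboundary, but
  -- `(p + 1)!` equal nonzero terms for the computed cocycle.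
  have hsum := sum_sign_trivD_eq_zero ((fun g : Fin p → translationGroup n k M =>
      b fun j => Subgroup.inclusion hT (g j)) - b')
    (fun j => toTranslationGroup (v j)) fun i j => by
      have : Nonempty M := ⟨y⟩
      exact translationGroup_mul_comm _ _
  rw [← hcob, Finset.sum_congr rfl (g := fun _ => (-1) ^ (p + 1) * C * w v), Finset.sum_const,
    Finset.card_univ, Fintype.card_perm, Fintype.card_fin, nsmul_eq_mul] at hsum
  · have hfac : ((p + 1).factorial : ℝ) ≠ 0 := by positivity
    simp [hC, hv, hfac] at hsum
  · intro σ _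
    rw [hval]
    simp only [Function.comp_apply, translationVector_toTranslationGroup]
    have h1 : (w fun j => v (σ j)) = ((Equiv.Perm.sign σ : ℤ) : ℝ) * w v := by
      have := w.toAlternatingMap.map_perm v σ
      rw [Units.smul_def, zsmul_eq_mul] at this
      exact this
    rw [h1]
    rcases Int.units_eq_one_or (Equiv.Perm.sign σ) with hs | hs <;> simp [hs]

lemma cocycle_constWedge [Nonempty M] (hT : translationGroup n k M ≤ Γ) {d : ℕ} (hd : d = p + 1)
    (h : d + k = p + k + 1) {w : EuclideanSpace ℝ (Fin n) [⋀^Fin d]→L[ℝ] ℝ} (hw : w ≠ 0)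
    (hinv : ∀ g ∈ Γ, pullback _ _ g (constWedge (rfl : d + k = d + k) w υ) =
      constWedge (rfl : d + k = d + k) w υ) :
    CocycleDefined Γ p k (constWedge h w υ) (sliceIntegral n o) ∧
      CocycleNontrivial Γ p k (constWedge h w υ) (sliceIntegral n o) := by
  subst hd
  -- The group preserves the form in degree `d + k`; generalizing the degree transports the
  -- invariance to degree `p + k + 1`.
  have hinv' : ∀ {m : ℕ} (h : p + 1 + k = m), ∀ g ∈ Γ,
      pullback _ _ g (constWedge h w υ) = constWedge h w υ := by
    rintro _ rfl
    exact hinv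
  exact ⟨cocycleDefined_constWedge ho hυ hυ₁ hΓ h (hinv' h),
    cocycleNontrivial_constWedge ho hυ hυ₁ hΓ hT h hw (hinv' h)⟩

end Cocycle

end DiffForm

end

open DiffForm in
theorem mainTheorem4 {n k : ℕ} {M : Type*} [TopologicalSpace M] [T2Space M] [CompactSpace M]
    [ConnectedSpace M] [ChartedSpace (EuclideanSpace ℝ (Fin k)) M] [IsManifold (𝓡 k) ∞ M]
    (o : ∀ y : M, Orientation ℝ (TangentSpace (𝓡 k) y) (Fin k)) (ho : IsOrientation o)
    (υ : Form (𝓡 k) M k) (hυ : IsSmooth υ) (hυ₀ : ∀ y, υ y ≠ 0) (hυ₁ : integral o υ = 1)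
    {ι : Type*} (deg : ι → ℕ) (w : ∀ i, EuclideanSpace ℝ (Fin n) [⋀^Fin (deg i)]→L[ℝ] ℝ)
    (hw : ∀ i, w i ≠ 0) (i : ι) (p : ℕ) (hp : deg i = p + 1)
    (Θ : Form ((𝓡 n).prod (𝓡 k)) (EuclideanSpace ℝ (Fin n) × M) (p + k + 1))
    (hΘ : Θ = constWedge (by omega) (w i) υ) :
    (CocycleDefined (classStabilizer (constWedgeGroup w υ) (sliceIntegral n o)) p k Θ
        (sliceIntegral n o) ∧
      CocycleNontrivial (classStabilizer (constWedgeGroup w υ) (sliceIntegral n o)) p k Θ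
        (sliceIntegral n o)) ∧
    ((∀ g ∈ constWedgeGroup w υ, FixesClass (sliceIntegral n o) g) →
      CocycleDefined (constWedgeGroup w υ) p k Θ (sliceIntegral n o) ∧
      CocycleNontrivial (constWedgeGroup w υ) p k Θ (sliceIntegral n o)) := by
  have hM : Nonempty M := inferInstance
  have hT := translationGroup_le_constWedgeGroup w υ
  -- The translations lie in the stabilizer of the class, so the obstruction survives the
  -- restriction from `G` to `G_a`.
  have hT' : translationGroup n k M ≤
      classStabilizer (constWedgeGroup w υ) (sliceIntegral n o) := by
    rintro g hg
    refine ⟨hT hg, ?_⟩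
    obtain ⟨a, rfl⟩ := hg
    exact fixesClass_translation ho a
  subst hΘ
  exact ⟨cocycle_constWedge ho hυ hυ₁
      (Γ := classStabilizer (constWedgeGroup w υ) (sliceIntegral n o))
      (fun g hg => hg.2) hT' hp _ (hw i) fun g hg => hg.1 i,
    fun hG => cocycle_constWedge ho hυ hυ₁ hG hT hp _ (hw i) fun g hg => hg i⟩
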